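/- Let $N\ge 2$, let $\Omega\subset\mathbb{R}^N$ be a bounded domain, and let $p\ge 2$, $s_1\in(0,1)$, $s_p\in\left(0,\frac{p-1}{p}\right]$. For $q\ge 1$, $\gamma\in(0,1)$ and $A\subset\mathbb{R}^N$ put $$[u]_{W^{\gamma,q}(A)}:=\left(\int_A\int_A\frac{|u(x)-u(y)|^q}{|x-y|^{N+\gamma q}}\,dx\,dy\right)^{1/q},$$ let $W^{\gamma,q}(A)$ be the set of $u\in L^q(A)$ with $[u]_{W^{\gamma,q}(A)}<\infty$, and let $W^{\gamma,q}_{\mathrm{loc}}(\Omega)$ be the set of $u$ that belong to $W^{\gamma,q}(V)$ for every open $V\subset\subset\Omega$. Let $L^{p-1}_{s_pp}(\mathbb{R}^N)$ be the set of $u\in L^{p-1}_{\mathrm{loc}}(\mathbb{R}^N)$ with $\int_{\mathbb{R}^N}\frac{|u(x)|^{p-1}}{(1+|x|)^{N+s_pp}}\,dx<\infty$, and let $$\mathrm{Tail}(u;x_0,R):=\left(R^{s_pp}\int_{\mathbb{R}^N\setminus B_R(x_0)}\frac{|u(x)|^{p-1}}{|x-x_0|^{N+s_pp}}\,dx\right)^{\frac1{p-1}}.$$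 A function $u\in W^{s_1,1}_{\mathrm{loc}}(\Omega)\cap W^{s_p,p}_{\mathrm{loc}}(\Omega)\cap L^{p-1}_{s_pp}(\mathbb{R}^N)$ is called a weak solution of $(-\Delta_1)^{s_1}u+(-\Delta_p)^{s_p}u=0$ in $\Omega$ if there is $Z\in L^\infty(\mathbb{R}^N\times\mathbb{R}^N)$ with $Z(x,y)\in\mathrm{sgn}(u(x)-u(y))$ for almost every $(x,y)$, where $\mathrm{sgn}(t)=\{t/|t|\}$ for $t\neq0$ and $\mathrm{sgn}(0)=[-1,1]$, such that $$\int_{\mathbb{R}^N}\int_{\mathbb{R}^N}Z(x,y)\frac{\varphi(x)-\varphi(y)}{|x-y|^{N+s_1}}\,dx\,dy+\int_{\mathbb{R}^N}\int_{\mathbb{R}^N}\frac{|u(x)-u(y)|^{p-2}(u(x)-u(y))(\varphi(x)-\varphi(y))}{|x-y|^{N+s_pp}}\,dx\,dy=0$$ for every $\varphi\in W^{s_1,1}(\mathbb{R}^N)\cap W^{s_p,p}(\mathbb{R}^N)$ with compact support in $\Omega$. Theorem. Let $q\ge p$ and $\gamma\in\left(0,\frac{s_pp}{p-1}\right)$.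 If $u$ is a weak solution in this sense and $u\in L^\infty_{\mathrm{loc}}(\Omega)$, then $u\in W^{\gamma,q}_{\mathrm{loc}}(\Omega)$. Moreover, there are constants $C,\kappa>0$ depending only on $N,p,q,s_1,s_p,\gamma$ such that, for every such $\Omega$ and $u$, every ball $B_R=B_R(x_0)\subset\subset\Omega$ with $R\in(0,1)$ and every $r\in(0,R)$, with $B_r=B_r(x_0)$, $$[u]^q_{W^{\gamma,q}(B_r)}\le\frac{C\left(\mathcal{T}+[u]_{W^{s_p,p}(B_R)}+1\right)^q}{(R-r)^\kappa},\qquad \mathcal{T}:=\|u\|_{L^\infty(B_R(x_0))}+\mathrm{Tail}(u;x_0,R).$$ -/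

import Mathlib

open MeasureTheory
open scoped ENNReal

noncomputable section

namespace NonlocalOneP

/-- The Gagliardo seminorm `[u]_{W^{s,q}(A)}`, with values in `[0, ∞]`. (On the diagonal, which is a
null set, the real quotient takes the value `0`.) -/
def gagliardo {N : ℕ} (s q : ℝ) (u : EuclideanSpace ℝ (Fin N) → ℝ)
    (A : Set (EuclideanSpace ℝ (Fin N))) : ℝ≥0∞ :=
  (∫⁻ x in A, ∫⁻ y in A,
    ENNReal.ofReal (|u x - u y| ^ q / ‖x - y‖ ^ ((N : ℝ) + s * q))) ^ (1 / q)

/-- `u ∈ W^{s,q}(A)`. -/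
def MemW {N : ℕ} (s q : ℝ) (u : EuclideanSpace ℝ (Fin N) → ℝ)
    (A : Set (EuclideanSpace ℝ (Fin N))) : Prop :=
  MemLp u (ENNReal.ofReal q) (volume.restrict A) ∧ gagliardo s q u A < ∞

/-- `u ∈ W^{s,q}_loc(Ω)`: `u ∈ W^{s,q}(V)` for every open `V ⊂⊂ Ω`. -/
def MemWLoc {N : ℕ} (s q : ℝ) (u : EuclideanSpace ℝ (Fin N) → ℝ)
    (Ω : Set (EuclideanSpace ℝ (Fin N))) : Prop :=
  ∀ V : Set (EuclideanSpace ℝ (Fin N)), IsOpen V → IsCompact (closure V) → closure V ⊆ Ω →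
    MemW s q u V

/-- `u ∈ L^∞_loc(Ω)`. -/
def LocallyBounded {N : ℕ} (u : EuclideanSpace ℝ (Fin N) → ℝ)
    (Ω : Set (EuclideanSpace ℝ (Fin N))) : Prop :=
  ∀ V : Set (EuclideanSpace ℝ (Fin N)), IsOpen V → IsCompact (closure V) → closure V ⊆ Ω →
    MemLp u ∞ (volume.restrict V)

/-- The tail space `L^q_a(ℝ^N)`. -/
def MemTailSpace {N : ℕ} (q a : ℝ) (u : EuclideanSpace ℝ (Fin N) → ℝ) : Prop :=
  (∀ K : Set (EuclideanSpace ℝ (Fin N)), IsCompact K →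
    MemLp u (ENNReal.ofReal q) (volume.restrict K)) ∧
  ∫⁻ x, ENNReal.ofReal (|u x| ^ q / (1 + ‖x‖) ^ ((N : ℝ) + a)) < ∞

/-- `Tail(u; x₀, R)`, with values in `[0, ∞]`. -/
def tail {N : ℕ} (p sp : ℝ) (u : EuclideanSpace ℝ (Fin N) → ℝ)
    (x₀ : EuclideanSpace ℝ (Fin N)) (R : ℝ) : ℝ≥0∞ :=
  (ENNReal.ofReal (R ^ (sp * p)) *
    ∫⁻ x in (Metric.ball x₀ R)ᶜ,
      ENNReal.ofReal (|u x| ^ (p - 1) / ‖x - x₀‖ ^ ((N : ℝ) + sp * p))) ^ (1 / (p - 1))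

/-- `𝒯 = ‖u‖_{L^∞(B_R(x₀))} + Tail(u; x₀, R)`. -/
def supTail {N : ℕ} (p sp : ℝ) (u : EuclideanSpace ℝ (Fin N) → ℝ)
    (x₀ : EuclideanSpace ℝ (Fin N)) (R : ℝ) : ℝ≥0∞ :=
  eLpNorm u ∞ (volume.restrict (Metric.ball x₀ R)) + tail p sp u x₀ R

/-- The set-valued sign function: `sgn t = {t / |t|}` for `t ≠ 0` and `sgn 0 = [-1, 1]`. -/
def sgnSet (t : ℝ) : Set ℝ :=
  {z | z ∈ Set.Icc (-1) 1 ∧ (t ≠ 0 → z = t / |t|)}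

/-- Weak solutions of `(-Δ₁)^{s₁} u + (-Δ_p)^{s_p} u = 0` in `Ω`. The test functions are the
`φ ∈ W^{s₁,1}(ℝ^N) ∩ W^{s_p,p}(ℝ^N)` with compact support in `Ω`. These belong to
`W₀^{s₁,1}(Ω) ∩ W₀^{s_p,p}(Ω)` for every usual meaning of the latter, and for them both
double integrals converge absolutely, by the membership conditions on `u`. -/
structure IsWeakSolution {N : ℕ} (p s₁ sp : ℝ) (Ω : Set (EuclideanSpace ℝ (Fin N)))
    (u : EuclideanSpace ℝ (Fin N) → ℝ) : Prop where
  memW_one : MemWLoc s₁ 1 u Ω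
  memW_p : MemWLoc sp p u Ω
  memTail : MemTailSpace (p - 1) (sp * p) u
  exists_sign : ∃ Z : EuclideanSpace ℝ (Fin N) × EuclideanSpace ℝ (Fin N) → ℝ,
    MemLp Z ∞ (volume.prod volume) ∧
    (∀ᵐ z ∂(volume.prod volume), Z z ∈ sgnSet (u z.1 - u z.2)) ∧
    ∀ φ : EuclideanSpace ℝ (Fin N) → ℝ,
      MemW s₁ 1 φ Set.univ → MemW sp p φ Set.univ → HasCompactSupport φ → tsupport φ ⊆ Ω →
      (∫ z, Z z * (φ z.1 - φ z.2) / ‖z.1 - z.2‖ ^ ((N : ℝ) + s₁) ∂(volume.prod volume)) +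
      (∫ z, |u z.1 - u z.2| ^ (p - 2) * (u z.1 - u z.2) * (φ z.1 - φ z.2) /
        ‖z.1 - z.2‖ ^ ((N : ℝ) + sp * p) ∂(volume.prod volume)) = 0

end NonlocalOneP

end

/-! The equation is compared with its own translate by a small vector h. Write w(x) = u(x + h) -
u(x) and q = p - 1 + β with β ≥ 1. The difference of the two equations is tested with the signed
power |w|^(β-1) w times a cutoff. Since `sgn` is a monotone graph, the part of the 1-Laplacian that
carries no derivative of the cutoff has a favourable sign and is dropped. The remaining part only
sees |Z| ≤ 1, so it is bounded by the kernel |x - y|^(-N-s₁) against a Lipschitz cutoff, which is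
integrable near the diagonal because s₁ < 1. Thus no regularity is asked of the 1-Laplacian. The
p-part controls the double integral of |w(x) - w(y)|^q / |x - y|^(N + s_p p) (`pointwise_energy`,
`dint_le_of_difference_eq`).

If u is already known in W^{γ,q}, Hölder's inequality bounds the errors by the W^{γ,q} energy to the
power (p-1)/q times the power β/q of the integral of |w|^q (`exists_energy_le`). The latter
contributes |h|^(γβ). The energy of w controls the second difference of u, with a further factor
|h|^(s_p p). Hence the second differences have L^q norm O(|h|^α) with α q = s_p p + γ β. As α < 1,
first differences obey the same bound (`exists_diff_le_of_second_diff`), and u lies in W^{γ',q} for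
all γ' < α (`exists_dint_le_of_diff`). This is `Regular.improve`.

The map γ ↦ (s_p p + γ β)/q has the fixed point σ = s_p p/(p-1), and lies above the identity below
σ. So for fixed q the attainable exponents have supremum σ (`Regular.all_lt`). The hypothesis s_p ≤
(p-1)/p says σ ≤ 1, which keeps α < 1.

The iteration needs a start with 1 - s_p p + γ (p-1) > 0, the condition for the Hölder error to be
integrable. For q = p the start is the assumed W^{s_p,p} regularity. Larger q are reached in steps
of ratio at most p/(p-1): interpolation with the bound on u turns W^{γ,q} into W^{γq/q',q'}, and γ
close to σ keeps the condition valid (`regular_of_lt`). All constants are quantified before the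
solution, so uniformity survives each step. -/

namespace NonlocalOneP

open Metric Set

/-! ### Elementary inequalities for powers -/

/-- The signed power `|t|^e t`. -/
noncomputable def spow (e t : ℝ) : ℝ := |t| ^ e * t

theorem measurable_spow (e : ℝ) : Measurable (spow e) := by
  unfold spow; fun_prop

theorem spow_neg (e t : ℝ) : spow e (-t) = -spow e t := by simp [spow]

theorem spow_of_nonneg {e t : ℝ} (he : 0 ≤ e) (ht : 0 ≤ t) : spow e t = t ^ (e + 1) := by
  rw [spow, abs_of_nonneg ht, Real.rpow_add_one' ht (by linarith)]

theorem abs_spow {e : ℝ} (he : 0 ≤ e) (t : ℝ) : |spow e t| = |t| ^ (e + 1) := by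
  rw [spow, abs_mul, abs_of_nonneg (Real.rpow_nonneg (abs_nonneg t) e),
    Real.rpow_add_one' (abs_nonneg t) (by linarith)]

theorem add_rpow_le_two_rpow {a b m : ℝ} (ha : 0 ≤ a) (hb : 0 ≤ b) (hm : 0 ≤ m) :
    (a + b) ^ m ≤ 2 ^ m * (a ^ m + b ^ m) := by
  have h1 : (a + b) ^ m ≤ (2 * max a b) ^ m := by
    apply Real.rpow_le_rpow (by positivity) _ hm
    linarith [le_max_left a b, le_max_right a b]
  rw [Real.mul_rpow (by norm_num) (by positivity)] at h1
  refine h1.trans (mul_le_mul_of_nonneg_left ?_ (by positivity))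
  rcases max_choice a b with h | h <;> rw [h]
  · linarith [Real.rpow_nonneg hb m]
  · linarith [Real.rpow_nonneg ha m]

theorem abs_sub_rpow_le {m : ℝ} (hm : 0 ≤ m) (a b : ℝ) :
    |a - b| ^ m ≤ 2 ^ m * (|a| ^ m + |b| ^ m) :=
  (Real.rpow_le_rpow (abs_nonneg _) (abs_sub a b) hm).trans
    (add_rpow_le_two_rpow (abs_nonneg a) (abs_nonneg b) hm)

/-- Strong monotonicity of signed powers. -/
theorem rpow_sub_le_spow_sub {e a b : ℝ} (he : 0 ≤ e) (hab : b ≤ a) :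
    (a - b) ^ (e + 1) ≤ 2 ^ (e + 1) * (spow e a - spow e b) := by
  have key : ∀ a b : ℝ, 0 ≤ b → b ≤ a →
      (a - b) ^ (e + 1) ≤ 2 ^ (e + 1) * (spow e a - spow e b) := by
    intro a b hb hab
    rw [spow_of_nonneg he hb, spow_of_nonneg he (hb.trans hab)]
    have h := Real.add_rpow_le_rpow_add (a := a - b) (b := b) (sub_nonneg.2 hab) hb
      (p := e + 1) (by linarith)
    rw [sub_add_cancel] at h
    have h2 : (1 : ℝ) ≤ 2 ^ (e + 1) := Real.one_le_rpow (by norm_num) (by linarith)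
    have h3 : 0 ≤ (a - b) ^ (e + 1) := Real.rpow_nonneg (sub_nonneg.2 hab) _
    nlinarith
  rcases le_total 0 b with hb | hb
  · exact key a b hb hab
  rcases le_total 0 a with ha | ha
  -- Across zero a - b = |a| + |b|, and this case dictates the constant 2^(e+1).
  · have h := add_rpow_le_two_rpow (m := e + 1) ha (neg_nonneg.2 hb) (by linarith)
    have h2 : spow e b = -(-b) ^ (e + 1) := by
      rw [← spow_of_nonneg he (neg_nonneg.2 hb), spow_neg, neg_neg]
    rw [h2, spow_of_nonneg he ha, sub_neg_eq_add]
    simpa [sub_eq_add_neg] using h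
  · have h := key (-b) (-a) (by linarith) (by linarith)
    simp only [spow_neg] at h
    convert h using 2 <;> ring

theorem spow_le_spow {e a b : ℝ} (he : 0 ≤ e) (hab : b ≤ a) : spow e b ≤ spow e a := by
  have h := rpow_sub_le_spow_sub he hab
  have h1 : 0 ≤ (a - b) ^ (e + 1) := Real.rpow_nonneg (sub_nonneg.2 hab) _
  have h2 : (0 : ℝ) < 2 ^ (e + 1) := by positivity
  have := nonneg_of_mul_nonneg_right (h1.trans h) h2
  linarith

/-- Signed powers are Lipschitz on bounded intervals. -/
theorem abs_spow_sub_le {e L a b : ℝ} (he : 0 ≤ e) (ha : |a| ≤ L) (hb : |b| ≤ L) :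
    |spow e a - spow e b| ≤ (e + 1) * (2 * L) ^ e * |a - b| := by
  have hL : 0 ≤ L := (abs_nonneg a).trans ha
  -- The range is 2L rather than L because values of opposite sign are handled by superadditivity,
  -- which reduces them to the interval from 0 to a - b.
  have pos : ∀ a b : ℝ, 0 ≤ b → b ≤ a → a ≤ 2 * L →
      a ^ (e + 1) - b ^ (e + 1) ≤ (e + 1) * (2 * L) ^ e * (a - b) := by
    intro a b hb hab haL
    rcases (hb.trans hab).eq_or_lt with h0 | h0
    · have : b = 0 := by linarith
      subst this; simp [← h0]
    -- Bernoulli's inequality is the tangent line bound for t^(e+1) at t = a, normalized by a.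
    have h := one_add_mul_self_le_rpow_one_add (s := b / a - 1) (p := e + 1)
      (by have := div_nonneg hb h0.le; linarith) (by linarith)
    rw [add_sub_cancel, Real.div_rpow hb h0.le, le_div_iff₀ (by positivity)] at h
    have h3 : (1 + (e + 1) * (b / a - 1)) * a ^ (e + 1)
        = a ^ (e + 1) - (e + 1) * a ^ e * (a - b) := by
      rw [Real.rpow_add_one h0.ne']; field_simp; ring
    rw [h3] at h
    have h4 : a ^ e ≤ (2 * L) ^ e := Real.rpow_le_rpow h0.le haL he
    have h5 : (e + 1) * a ^ e * (a - b) ≤ (e + 1) * (2 * L) ^ e * (a - b) := by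
      gcongr
    linarith
  wlog hab : b ≤ a generalizing a b
  · rw [abs_sub_comm, abs_sub_comm a b]
    exact this hb ha (le_of_not_ge hab)
  rw [abs_of_nonneg (sub_nonneg.2 (spow_le_spow he hab)), abs_of_nonneg (sub_nonneg.2 hab)]
  rw [abs_le] at ha hb
  rcases le_total 0 b with h | h
  · rw [spow_of_nonneg he h, spow_of_nonneg he (h.trans hab)]
    exact pos a b h hab (by linarith)
  rcases le_total 0 a with h' | h'
  · have h2 : spow e b = -(-b) ^ (e + 1) := by
      rw [← spow_of_nonneg he (neg_nonneg.2 h), spow_neg, neg_neg]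
    rw [h2, spow_of_nonneg he h', sub_neg_eq_add]
    refine (Real.add_rpow_le_rpow_add h' (neg_nonneg.2 h) (by linarith)).trans ?_
    have := pos (a + -b) 0 le_rfl (by linarith) (by linarith)
    rw [Real.zero_rpow (by linarith)] at this
    simpa [sub_eq_add_neg] using this
  · have h2 : spow e b = -(-b) ^ (e + 1) := by
      rw [← spow_of_nonneg he (neg_nonneg.2 h), spow_neg, neg_neg]
    have h3 : spow e a = -(-a) ^ (e + 1) := by
      rw [← spow_of_nonneg he (neg_nonneg.2 h'), spow_neg, neg_neg]
    have := pos (-b) (-a) (by linarith) (by linarith) (by linarith)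
    rw [h2, h3]
    calc _ = (-b) ^ (e + 1) - (-a) ^ (e + 1) := by ring
      _ ≤ _ := this
      _ = _ := by ring

theorem sgnSet_mono {a b y z : ℝ} (hab : b < a) (hy : y ∈ sgnSet a) (hz : z ∈ sgnSet b) :
    z ≤ y := by
  obtain ⟨⟨hy1, hy2⟩, hy3⟩ := hy
  obtain ⟨⟨hz1, hz2⟩, hz3⟩ := hz
  rcases lt_or_ge 0 a with ha | ha
  · have := hy3 ha.ne'
    rw [abs_of_pos ha, div_self ha.ne'] at this
    linarith
  · have hb : b < 0 := by linarith
    have := hz3 hb.ne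
    rw [abs_of_neg hb, div_neg, div_self hb.ne] at this
    linarith

/-! ### Integrals of powers of the distance -/

variable {N : ℕ}

local notation "𝔼" => EuclideanSpace ℝ (Fin N)

theorem lintegral_comp_sub_left' (f : 𝔼 → ℝ≥0∞) (x : 𝔼) (A B : Set 𝔼) (hA : MeasurableSet A)
    (hB : MeasurableSet B)
    (h : ∀ y ∈ A, y - x ∈ B) : ∫⁻ y in A, f (y - x) ≤ ∫⁻ y in B, f y := by
  rw [← lintegral_indicator hA, ← lintegral_indicator hB,
    ← lintegral_sub_right_eq_self (fun y => B.indicator f y) x]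
  refine lintegral_mono fun y => ?_
  by_cases hy : y ∈ A
  · simp [hy, h y hy]
  · simp [hy]

/-- An exponent above -N is locally integrable, and translation makes the constant independent of x.
Radius 2 is enough because all balls in use have radius at most 1. -/
theorem exists_lintegral_ball_rpow_le (hN : 1 ≤ N) {τ : ℝ} (hτ : 0 < τ) :
    ∃ C : ℝ, 0 < C ∧ ∀ (x : 𝔼) (A : Set 𝔼), MeasurableSet A → A ⊆ ball x 2 →
      ∫⁻ y in A, ENNReal.ofReal (‖x - y‖ ^ (τ - N)) ≤ ENNReal.ofReal C := by
  have h_int : IntegrableOn (fun y : 𝔼 => ‖y‖ ^ (τ - N)) (ball 0 2) := by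
    refine integrableOn_ball_of_norm_le_rpow (C := 1) (α := N - τ) ?_ ?_ ?_ ?_
    · simpa using hN
    · simp [hτ]
    · refine Filter.Eventually.of_forall fun y => ?_
      rw [Real.norm_of_nonneg (by positivity)]
      simp
    · exact (by fun_prop : Measurable fun y : 𝔼 => ‖y‖ ^ (τ - N)).aestronglyMeasurable
  have hfin : ∫⁻ y in ball (0 : 𝔼) 2, ENNReal.ofReal (‖y‖ ^ (τ - N)) ≠ ∞ :=
    ((hasFiniteIntegral_iff_ofReal
      (Filter.Eventually.of_forall fun y => by positivity)).1 h_int.2).ne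
  refine ⟨(∫⁻ y in ball (0 : 𝔼) 2, ENNReal.ofReal (‖y‖ ^ (τ - N))).toReal + 1, by positivity,
    fun x A hA hsub => ?_⟩
  have h1 := lintegral_comp_sub_left' (fun y : 𝔼 => ENNReal.ofReal (‖y‖ ^ (τ - N))) x A (ball 0 2)
    hA measurableSet_ball (fun y hy => by
      have := hsub hy
      rw [mem_ball, dist_eq_norm] at this
      simpa using this)
  simp_rw [norm_sub_rev x]
  refine h1.trans ?_
  rw [ENNReal.ofReal_add (by positivity) (by positivity), ENNReal.ofReal_toReal hfin]
  exact le_self_add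

/-- For ρ ≤ 1 and ‖x - y‖ ≥ ρ one has ρ (1 + ‖x - y‖) ≤ 2 ‖x - y‖, so an integrable weight
dominates. The power of ρ is not sharp, which is harmless as the final κ is free. -/
theorem exists_lintegral_far_le {τ : ℝ} (hτ : 0 < τ) :
    ∃ C : ℝ, 0 < C ∧ ∀ (ρ : ℝ) (x : 𝔼), 0 < ρ → ρ ≤ 1 →
      ∫⁻ y in {y | ρ ≤ ‖x - y‖}, ENNReal.ofReal (1 / ‖x - y‖ ^ (N + τ)) ≤
        ENNReal.ofReal (C * ρ ^ (-(N + τ))) := by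
  have hfin := finite_integral_one_add_norm (E := 𝔼) (μ := volume) (r := N + τ)
    (by simp [hτ])
  set I := ∫⁻ y : 𝔼, ENNReal.ofReal ((1 + ‖y‖) ^ (-((N : ℝ) + τ))) with hI
  have hτN : 0 < (N : ℝ) + τ := by positivity
  refine ⟨2 ^ ((N : ℝ) + τ) * (I.toReal + 1), by positivity, fun ρ x hρ hρ1 => ?_⟩
  calc ∫⁻ y in {y | ρ ≤ ‖x - y‖}, ENNReal.ofReal (1 / ‖x - y‖ ^ ((N : ℝ) + τ))
      ≤ ∫⁻ y in {y | ρ ≤ ‖x - y‖}, ENNReal.ofReal (2 ^ ((N : ℝ) + τ) * ρ ^ (-((N : ℝ) + τ))) *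
          ENNReal.ofReal ((1 + ‖x - y‖) ^ (-((N : ℝ) + τ))) := by
        refine setLIntegral_mono' (measurableSet_le (by fun_prop) (by fun_prop)) fun y hy => ?_
        have hy : ρ ≤ ‖x - y‖ := hy
        have hpos : 0 < ‖x - y‖ := hρ.trans_le hy
        rw [← ENNReal.ofReal_mul (by positivity)]
        apply ENNReal.ofReal_le_ofReal
        rw [Real.rpow_neg hρ.le, Real.rpow_neg (by positivity), one_div, ← div_eq_mul_inv,
          ← div_eq_mul_inv, div_div, ← Real.mul_rpow hρ.le (by positivity),
          ← Real.div_rpow (by norm_num) (by positivity), ← Real.inv_rpow hpos.le]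
        apply Real.rpow_le_rpow (by positivity) _ hτN.le
        rw [inv_eq_one_div, div_le_div_iff₀ hpos (by positivity)]
        nlinarith
    _ ≤ ∫⁻ y, ENNReal.ofReal (2 ^ ((N : ℝ) + τ) * ρ ^ (-((N : ℝ) + τ))) *
          ENNReal.ofReal ((1 + ‖x - y‖) ^ (-((N : ℝ) + τ))) := setLIntegral_le_lintegral _ _
    _ = ENNReal.ofReal (2 ^ ((N : ℝ) + τ) * ρ ^ (-((N : ℝ) + τ))) * I := by
        rw [lintegral_const_mul' _ _ ENNReal.ofReal_ne_top,
          lintegral_sub_left_eq_self (fun y : 𝔼 => ENNReal.ofReal ((1 + ‖y‖) ^ (-((N : ℝ) + τ)))) x]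
    _ ≤ _ := by
        nth_rewrite 1 [← ENNReal.ofReal_toReal hfin.ne]
        rw [← ENNReal.ofReal_mul (by positivity)]
        apply ENNReal.ofReal_le_ofReal
        have : 0 ≤ (2 : ℝ) ^ ((N : ℝ) + τ) * ρ ^ (-((N : ℝ) + τ)) := by positivity
        nlinarith

theorem exists_volume_ball_le : ∃ C : ℝ, 0 < C ∧ ∀ (x : 𝔼) (r : ℝ), r ≤ 1 →
    volume (ball x r) ≤ ENNReal.ofReal C := by
  refine ⟨(volume (ball (0 : 𝔼) 1)).toReal + 1, by positivity, fun x r hr => ?_⟩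
  refine (measure_mono (ball_subset_ball hr)).trans ?_
  rw [Measure.addHaar_ball_center, ENNReal.ofReal_add (by positivity) (by positivity),
    ENNReal.ofReal_toReal measure_ball_lt_top.ne]
  exact le_self_add

/-! ### Double integrals of differences and translations -/

/-- The double integral of `|u x - u y|^q / |x - y|^e` over `A × A`. -/
noncomputable def dint (e q : ℝ) (u : 𝔼 → ℝ) (A : Set 𝔼) : ℝ≥0∞ :=
  ∫⁻ x in A, ∫⁻ y in A, ENNReal.ofReal (|u x - u y| ^ q / ‖x - y‖ ^ e)

theorem dint_mono_set (e q : ℝ) (u : 𝔼 → ℝ) {A B : Set 𝔼} (h : A ⊆ B) :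
    dint e q u A ≤ dint e q u B :=
  (lintegral_mono fun _ => lintegral_mono_set h).trans (lintegral_mono_set h)

theorem lintegral_comp_add_le (f : 𝔼 → ℝ≥0∞) (h : 𝔼) {A B : Set 𝔼} (hA : MeasurableSet A)
    (hB : MeasurableSet B) (hAB : ∀ x ∈ A, x + h ∈ B) :
    ∫⁻ x in A, f (x + h) ≤ ∫⁻ x in B, f x := by
  have := lintegral_comp_sub_left' f (-h) A B hA hB (by simpa using hAB)
  simpa using this

theorem dint_translate_le (e q : ℝ) (u : 𝔼 → ℝ) (h : 𝔼) {A B : Set 𝔼} (hA : MeasurableSet A)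
    (hB : MeasurableSet B) (hAB : ∀ x ∈ A, x + h ∈ B) :
    dint e q (fun x => u (x + h)) A ≤ dint e q u B := by
  refine le_trans (lintegral_mono fun x => ?_) (lintegral_comp_add_le
    (fun x => ∫⁻ y in B, ENNReal.ofReal (|u x - u y| ^ q / ‖x - y‖ ^ e)) h hA hB hAB)
  refine le_trans (le_of_eq ?_) (lintegral_comp_add_le
    (fun y => ENNReal.ofReal (|u (x + h) - u y| ^ q / ‖x + h - y‖ ^ e)) h hA hB hAB)
  simp

theorem measurable_diff_kernel {u : 𝔼 → ℝ} (hu : Measurable u) (e q : ℝ) :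
    Measurable fun z : 𝔼 × 𝔼 => ENNReal.ofReal (|u z.1 - u z.2| ^ q / ‖z.1 - z.2‖ ^ e) := by
  fun_prop

theorem rpow_le_mul_div {t d D e q : ℝ} (hq : 0 < q) (he : 0 ≤ e) (hd : 0 ≤ d) (hdD : d ≤ D)
    (ht : 0 ≤ t) (h0 : d = 0 → t = 0) : t ^ q ≤ D ^ e * (t ^ q / d ^ e) := by
  rcases hd.eq_or_lt with h | h
  · rw [h0 h.symm, Real.zero_rpow hq.ne']; simp
  · rw [mul_div_assoc', le_div_iff₀ (by positivity), mul_comm]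
    gcongr

/-- For every z in the ball of radius ‖h‖ about x, both x and x + h are within 2‖h‖ of z. Inserting
F z and averaging over such z turns a difference into a piece of the double integral. With e = N + s
q the gain is ‖h‖^(s q). -/
theorem exists_lintegral_translate_le {q e : ℝ} (hq : 0 < q) (he : 0 ≤ e) :
    ∃ C : ℝ, 0 < C ∧ ∀ (F : 𝔼 → ℝ), Measurable F → ∀ (x₀ : 𝔼) (r ρ : ℝ) (h : 𝔼), ‖h‖ ≤ ρ →
      ∫⁻ x in ball x₀ r, ENNReal.ofReal (|F (x + h) - F x| ^ q) ≤
        ENNReal.ofReal (C * ‖h‖ ^ (e - N)) * dint e q F (ball x₀ (r + ρ)) := by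
  have hc : 0 < (volume (ball (0 : 𝔼) 1)).toReal :=
    ENNReal.toReal_pos (measure_ball_pos _ _ one_pos).ne' measure_ball_lt_top.ne
  set c := (volume (ball (0 : 𝔼) 1)).toReal with hcdef
  refine ⟨2 * (2 ^ q * 2 ^ e) / c, by positivity, fun F hF x₀ r ρ h hρ => ?_⟩
  rcases eq_or_ne h 0 with rfl | hh
  · simp [Real.zero_rpow hq.ne']
  have hpos : 0 < ‖h‖ := norm_pos_iff.2 hh
  set B' := ball x₀ (r + ρ)
  set Φ : 𝔼 → ℝ≥0∞ := fun x => ∫⁻ z in B', ENNReal.ofReal (|F x - F z| ^ q / ‖x - z‖ ^ e)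
  have hΦ : Measurable Φ := (measurable_diff_kernel hF e q).lintegral_prod_right'
  set D : ℝ := 2 ^ q * (2 * ‖h‖) ^ e
  have hvol : ∀ x : 𝔼, volume (ball x ‖h‖) = ENNReal.ofReal (‖h‖ ^ (N : ℝ) * c) := by
    intro x
    rw [Measure.addHaar_ball_of_pos _ _ hpos, ENNReal.ofReal_mul (by positivity), hcdef,
      ENNReal.ofReal_toReal measure_ball_lt_top.ne]
    simp
  have hpt : ∀ x ∈ ball x₀ r, ENNReal.ofReal (|F (x + h) - F x| ^ q) *
      ENNReal.ofReal (‖h‖ ^ (N : ℝ) * c) ≤ ENNReal.ofReal D * (Φ (x + h) + Φ x) := by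
    intro x hx
    have hsub : ball x ‖h‖ ⊆ B' := ball_subset_ball' (by
      rw [mem_ball] at hx; linarith)
    rw [← hvol x, ← setLIntegral_const]
    calc _ ≤ ∫⁻ z in ball x ‖h‖, ENNReal.ofReal D *
          (ENNReal.ofReal (|F (x + h) - F z| ^ q / ‖x + h - z‖ ^ e) +
            ENNReal.ofReal (|F x - F z| ^ q / ‖x - z‖ ^ e)) := by
          refine setLIntegral_mono' measurableSet_ball fun z hz => ?_
          rw [← ENNReal.ofReal_add (by positivity) (by positivity),
            ← ENNReal.ofReal_mul (by positivity)]
          apply ENNReal.ofReal_le_ofReal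
          have hz' : ‖x - z‖ < ‖h‖ := by rwa [mem_ball, dist_comm, dist_eq_norm] at hz
          have h1 := abs_sub_rpow_le hq.le (F (x + h) - F z) (F x - F z)
          rw [sub_sub_sub_cancel_right] at h1
          have h2 := rpow_le_mul_div (t := |F (x + h) - F z|) (d := ‖x + h - z‖) (D := 2 * ‖h‖)
            hq he (norm_nonneg _) (by
              calc ‖x + h - z‖ = ‖(x - z) + h‖ := by congr 1; abel
                _ ≤ ‖x - z‖ + ‖h‖ := norm_add_le _ _
                _ ≤ _ := by linarith) (abs_nonneg _) (fun h0 => by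
              rw [norm_eq_zero, sub_eq_zero] at h0; rw [h0]; simp)
          have h3 := rpow_le_mul_div (t := |F x - F z|) (d := ‖x - z‖) (D := 2 * ‖h‖)
            hq he (norm_nonneg _) (by linarith) (abs_nonneg _) (fun h0 => by
              rw [norm_eq_zero, sub_eq_zero] at h0; rw [h0]; simp)
          refine h1.trans ?_
          rw [mul_assoc, mul_add ((2 * ‖h‖) ^ e)]
          gcongr
      _ ≤ _ := by
          rw [lintegral_const_mul' _ _ ENNReal.ofReal_ne_top, lintegral_add_left (by fun_prop)]
          gcongr <;> exact lintegral_mono_set hsub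
  have h_int : (∫⁻ x in ball x₀ r, ENNReal.ofReal (|F (x + h) - F x| ^ q)) *
      ENNReal.ofReal (‖h‖ ^ (N : ℝ) * c) ≤ ENNReal.ofReal (2 * D) * dint e q F B' := by
    rw [← lintegral_mul_const' _ _ ENNReal.ofReal_ne_top]
    refine (setLIntegral_mono' measurableSet_ball hpt).trans ?_
    rw [lintegral_const_mul' _ _ ENNReal.ofReal_ne_top, lintegral_add_right _ hΦ]
    have h1 : ∫⁻ x in ball x₀ r, Φ (x + h) ≤ dint e q F B' :=
      lintegral_comp_add_le Φ h measurableSet_ball measurableSet_ball (fun x hx => by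
        rw [mem_ball, dist_eq_norm] at hx ⊢
        calc ‖x + h - x₀‖ = ‖(x - x₀) + h‖ := by congr 1; abel
          _ ≤ _ := norm_add_le _ _
          _ < _ := by linarith)
    have h2 : ∫⁻ x in ball x₀ r, Φ x ≤ dint e q F B' :=
      lintegral_mono_set (ball_subset_ball (by linarith))
    calc _ ≤ ENNReal.ofReal D * (dint e q F B' + dint e q F B') := by gcongr
      _ = _ := by
        rw [ENNReal.ofReal_mul (p := 2) (by norm_num), ← two_mul, ENNReal.ofReal_ofNat]
        ring
  have hV : ENNReal.ofReal (‖h‖ ^ (N : ℝ) * c) ≠ 0 := by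
    rw [Ne, ENNReal.ofReal_eq_zero, not_le]; positivity
  rw [← ENNReal.le_div_iff_mul_le (Or.inl hV) (Or.inl ENNReal.ofReal_ne_top)] at h_int
  refine h_int.trans (le_of_eq ?_)
  rw [mul_comm, mul_div_assoc, ← ENNReal.ofReal_div_of_pos (by positivity), mul_comm]
  congr 2
  simp only [D]
  rw [Real.mul_rpow (by norm_num) hpos.le, Real.rpow_sub hpos]
  field_simp

/-- Twice the increment over h is the increment over 2h minus the second difference. Minkowski then
bounds the norm a(h) of the increment by a(2h)/2 plus K‖h‖^α/2, and h is doubled until its length is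
comparable with ρ, where L takes over. The error sum is controlled because 2^α < 2. The set A never
changes. -/
theorem exists_diff_le_of_second_diff {q α : ℝ} (hq : 1 ≤ q) (hα : 0 ≤ α) (hα1 : α < 1) :
    ∃ C : ℝ, 0 < C ∧ ∀ (u : 𝔼 → ℝ), Measurable u → ∀ (A : Set 𝔼) (ρ K L : ℝ), 0 < ρ → 0 ≤ K →
      0 ≤ L →
      (∀ h : 𝔼, ‖h‖ ≤ ρ → ∫⁻ x in A, ENNReal.ofReal (|u (x + h) - u x| ^ q) ≤
        ENNReal.ofReal (L ^ q)) →
      (∀ h : 𝔼, ‖h‖ ≤ ρ → ∫⁻ x in A,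
        ENNReal.ofReal (|(u (x + h + h) - u (x + h)) - (u (x + h) - u x)| ^ q) ≤
        ENNReal.ofReal ((K * ‖h‖ ^ α) ^ q)) →
      ∀ h : 𝔼, ‖h‖ ≤ ρ → ∫⁻ x in A, ENNReal.ofReal (|u (x + h) - u x| ^ q) ≤
        ENNReal.ofReal ((C * (K + L * ρ ^ (-α)) * ‖h‖ ^ α) ^ q) := by
  have hq0 : 0 < q := by linarith
  have h2α : (2 : ℝ) ^ α < 2 := by
    calc (2 : ℝ) ^ α < 2 ^ (1 : ℝ) := Real.rpow_lt_rpow_of_exponent_lt (by norm_num) hα1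
      _ = 2 := Real.rpow_one 2
  -- The first entry serves the scale ‖h‖ > ρ/2, the second closes the induction on doublings: it
  -- gives 1 ≤ C (2 - 2^α).
  set C : ℝ := max (2 ^ α) (1 / (2 - 2 ^ α)) with hC
  have hCpos : 0 < C := lt_of_lt_of_le (by positivity) (le_max_left _ _)
  refine ⟨C, hCpos, fun u hu A ρ K L hρ hK hL hD hD2 => ?_⟩
  set a : 𝔼 → ℝ≥0∞ := fun h => (∫⁻ x in A, ENNReal.ofReal |u (x + h) - u x| ^ q) ^ (1 / q)
  have hmink : ∀ h : 𝔼, ‖h‖ ≤ ρ →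
      a h ≤ ENNReal.ofReal (1 / 2) * a (h + h) + ENNReal.ofReal (1 / 2 * (K * ‖h‖ ^ α)) := by
    intro h hh
    set f : 𝔼 → ℝ≥0∞ := fun x => ENNReal.ofReal (1 / 2) * ENNReal.ofReal |u (x + (h + h)) - u x|
    set g : 𝔼 → ℝ≥0∞ := fun x => ENNReal.ofReal (1 / 2) *
      ENNReal.ofReal |(u (x + h + h) - u (x + h)) - (u (x + h) - u x)|
    have hfm : Measurable f := by fun_prop
    have hgm : Measurable g := by fun_prop
    have h1 := ENNReal.lintegral_Lp_add_le (μ := volume.restrict A) hfm.aemeasurable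
      hgm.aemeasurable hq
    have hf : (∫⁻ x in A, f x ^ q) ^ (1 / q) = ENNReal.ofReal (1 / 2) * a (h + h) := by
      simp only [f, a, ENNReal.mul_rpow_of_nonneg _ _ hq0.le]
      rw [lintegral_const_mul' _ _ (ENNReal.rpow_ne_top_of_nonneg hq0.le ENNReal.ofReal_ne_top),
        ENNReal.mul_rpow_of_nonneg _ _ (by positivity), ← ENNReal.rpow_mul,
        mul_one_div_cancel hq0.ne', ENNReal.rpow_one]
    have hg : (∫⁻ x in A, g x ^ q) ^ (1 / q) ≤ ENNReal.ofReal (1 / 2 * (K * ‖h‖ ^ α)) := by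
      simp only [g, ENNReal.mul_rpow_of_nonneg _ _ hq0.le]
      rw [lintegral_const_mul' _ _ (ENNReal.rpow_ne_top_of_nonneg hq0.le ENNReal.ofReal_ne_top),
        ENNReal.mul_rpow_of_nonneg _ _ (by positivity), ← ENNReal.rpow_mul,
        mul_one_div_cancel hq0.ne', ENNReal.rpow_one, ENNReal.ofReal_mul (by norm_num)]
      gcongr
      have := hD2 h hh
      simp_rw [← ENNReal.ofReal_rpow_of_nonneg (abs_nonneg _) hq0.le] at this
      rw [← ENNReal.ofReal_rpow_of_nonneg (by positivity) hq0.le] at this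
      rw [one_div]
      exact (ENNReal.rpow_inv_le_iff hq0).2 this
    rw [hf] at h1
    refine le_trans (ENNReal.rpow_le_rpow (lintegral_mono fun x => ?_) (by positivity))
      (h1.trans (add_le_add le_rfl hg))
    simp only [f, g, Pi.add_apply]
    apply ENNReal.rpow_le_rpow _ hq0.le
    rw [← ENNReal.ofReal_mul (by norm_num), ← ENNReal.ofReal_mul (by norm_num),
      ← ENNReal.ofReal_add (by positivity) (by positivity)]
    apply ENNReal.ofReal_le_ofReal
    rw [← add_assoc]
    have := abs_sub (u (x + h + h) - u x) (u (x + h + h) - u (x + h) - (u (x + h) - u x))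
    rw [show u (x + h + h) - u x - (u (x + h + h) - u (x + h) - (u (x + h) - u x))
      = 2 * (u (x + h) - u x) by ring, abs_mul, abs_two] at this
    linarith
  -- Here n bounds the number of doublings still available before the length exceeds ρ; n = 0 is
  -- vacuous.
  have hmain : ∀ (n : ℕ) (h : 𝔼), ‖h‖ ≤ ρ → ρ < 2 ^ n * ‖h‖ →
      a h ≤ ENNReal.ofReal (C * (K + L * ρ ^ (-α)) * ‖h‖ ^ α) := by
    have hbig : ∀ h : 𝔼, ‖h‖ ≤ ρ → ρ < 2 * ‖h‖ →
        a h ≤ ENNReal.ofReal (C * (K + L * ρ ^ (-α)) * ‖h‖ ^ α) := by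
      intro h hh hlt
      have h1 := hD h hh
      simp_rw [← ENNReal.ofReal_rpow_of_nonneg (abs_nonneg _) hq0.le] at h1
      rw [← ENNReal.ofReal_rpow_of_nonneg hL hq0.le] at h1
      have h2 : a h ≤ ENNReal.ofReal L := by
        simp only [a, one_div]
        exact (ENNReal.rpow_inv_le_iff hq0).2 h1
      refine h2.trans (ENNReal.ofReal_le_ofReal ?_)
      have hpos : 0 < ‖h‖ := by linarith
      have h3 : 1 ≤ 2 ^ α * ρ ^ (-α) * ‖h‖ ^ α := by
        rw [Real.rpow_neg hρ.le, mul_right_comm, ← Real.mul_rpow (by norm_num) hpos.le,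
          ← div_eq_mul_inv, ← Real.div_rpow (by positivity) hρ.le]
        apply Real.one_le_rpow _ hα
        rw [le_div_iff₀ hρ]; linarith
      calc L ≤ L * (2 ^ α * ρ ^ (-α) * ‖h‖ ^ α) := by nlinarith
        _ = 2 ^ α * (0 + L * ρ ^ (-α)) * ‖h‖ ^ α := by ring
        _ ≤ _ := by gcongr; exact le_max_left _ _
    intro n
    induction n with
    | zero => intro h h1 h2; simp at h2; linarith
    | succ n ih =>
      intro h h1 h2
      by_cases h3 : ρ < 2 * ‖h‖
      · exact hbig h h1 h3
      push Not at h3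
      have hn : ‖h + h‖ = 2 * ‖h‖ := by
        rw [← two_smul ℝ h, norm_smul]; simp
      have h4 := ih (h + h) (by rw [hn]; exact h3) (by rw [hn]; rw [pow_succ] at h2; linarith)
      refine (hmink h h1).trans ?_
      refine (add_le_add (mul_le_mul_right h4 _) le_rfl).trans ?_
      rw [← ENNReal.ofReal_mul (by norm_num), ← ENNReal.ofReal_add (by positivity) (by positivity)]
      apply ENNReal.ofReal_le_ofReal
      rw [hn, Real.mul_rpow (by norm_num) (norm_nonneg h)]
      set X := K + L * ρ ^ (-α)
      have hX : K ≤ X := by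
        have : 0 ≤ L * ρ ^ (-α) := by positivity
        simp only [X]; linarith
      have hC2 : 1 ≤ C * (2 - 2 ^ α) := by
        have : 1 / (2 - 2 ^ α) ≤ C := le_max_right _ _
        rwa [div_le_iff₀ (by linarith)] at this
      have hX0 : 0 ≤ X := hK.trans hX
      have : K ≤ C * (2 - 2 ^ α) * X := by nlinarith
      have h5 : 0 ≤ ‖h‖ ^ α := by positivity
      nlinarith
  intro h hh
  rcases eq_or_ne h 0 with rfl | h0
  · simp [Real.zero_rpow hq0.ne']
  have hpos : 0 < ‖h‖ := norm_pos_iff.2 h0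
  obtain ⟨n, hn⟩ := pow_unbounded_of_one_lt (ρ / ‖h‖) (one_lt_two)
  have := hmain n h hh (by rwa [div_lt_iff₀ hpos] at hn)
  simp_rw [← ENNReal.ofReal_rpow_of_nonneg (abs_nonneg _) hq0.le]
  rw [← ENNReal.ofReal_rpow_of_nonneg (by positivity) hq0.le]
  simp only [a, one_div] at this
  exact (ENNReal.rpow_inv_le_iff hq0).1 this

/-- Substituting y = x + k and exchanging integrals leaves ‖k‖^(b-e) near the origin, integrable
exactly because e < N + b. Pairs at distance at least ρ only need the bound M. -/
theorem exists_dint_le_of_diff (hN : 1 ≤ N) {q e b : ℝ} (hq : 0 < q) (he : 0 ≤ e)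
    (heb : e < N + b) :
    ∃ C : ℝ, 0 < C ∧ ∀ (u : 𝔼 → ℝ), Measurable u → ∀ (x₀ : 𝔼) (r ρ K M : ℝ), r ≤ 1 → 0 < ρ →
      ρ ≤ 1 → 0 ≤ K → 0 ≤ M → (∀ x ∈ ball x₀ r, |u x| ≤ M) →
      (∀ h : 𝔼, ‖h‖ ≤ ρ → ∫⁻ x in ball x₀ r, ENNReal.ofReal (|u (x + h) - u x| ^ q) ≤
        ENNReal.ofReal (K * ‖h‖ ^ b)) →
      dint e q u (ball x₀ r) ≤ ENNReal.ofReal (C * (K + M ^ q * ρ ^ (-e))) := by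
  obtain ⟨C₁, hC₁, hnear⟩ := exists_lintegral_ball_rpow_le hN (τ := N + b - e) (by linarith)
  obtain ⟨C₂, hC₂, hvol⟩ := exists_volume_ball_le (N := N)
  set C := max C₁ (2 ^ q * C₂ * C₂)
  refine ⟨C, lt_of_lt_of_le hC₁ (le_max_left _ _),
    fun u hu x₀ r ρ K M hr hρ hρ1 hK hM hbd hD => ?_⟩
  set B := ball x₀ r
  have hsplit : ∀ x ∈ B, ∫⁻ y in B, ENNReal.ofReal (|u x - u y| ^ q / ‖x - y‖ ^ e) ≤
      (∫⁻ k in ball (0 : 𝔼) ρ, ENNReal.ofReal (‖k‖ ^ (-e)) *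
        ENNReal.ofReal (|u (x + k) - u x| ^ q)) +
        ENNReal.ofReal ((2 * M) ^ q * ρ ^ (-e)) * ENNReal.ofReal C₂ := by
    intro x hx
    rw [← lintegral_inter_add_sdiff _ B (measurableSet_ball (x := x) (ε := ρ))]
    refine add_le_add ?_ ?_
    · have h1 := lintegral_comp_sub_left' (fun k : 𝔼 => ENNReal.ofReal (‖k‖ ^ (-e)) *
        ENNReal.ofReal (|u (x + k) - u x| ^ q)) x (B ∩ ball x ρ) (ball 0 ρ)
        (measurableSet_ball.inter measurableSet_ball) measurableSet_ball (fun y hy => by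
          have := hy.2
          rw [mem_ball, dist_eq_norm] at this
          simpa using this)
      refine le_trans (le_of_eq ?_) h1
      refine lintegral_congr fun y => ?_
      rw [← ENNReal.ofReal_mul (by positivity), add_sub_cancel, abs_sub_comm, norm_sub_rev,
        Real.rpow_neg (norm_nonneg _), div_eq_inv_mul]
    · calc _ ≤ ∫⁻ y in B \ ball x ρ, ENNReal.ofReal ((2 * M) ^ q * ρ ^ (-e)) := by
            refine setLIntegral_mono' (measurableSet_ball.diff measurableSet_ball) fun y hy => ?_
            apply ENNReal.ofReal_le_ofReal
            have hy2 : ρ ≤ ‖x - y‖ := by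
              have := hy.2
              rwa [mem_ball, not_lt, dist_comm, dist_eq_norm] at this
            rw [div_eq_mul_inv, ← Real.rpow_neg (norm_nonneg _)]
            have h1 : |u x - u y| ≤ 2 * M := by
              have := abs_sub (u x) (u y)
              linarith [hbd x hx, hbd y hy.1]
            gcongr ?_ * ?_
            · exact Real.rpow_le_rpow (abs_nonneg _) h1 hq.le
            · exact Real.rpow_le_rpow_of_nonpos hρ hy2 (by linarith)
        _ ≤ _ := by
            rw [setLIntegral_const]
            gcongr
            exact (measure_mono sdiff_subset).trans (hvol x₀ r hr)
  calc dint e q u B ≤ ∫⁻ x in B, ((∫⁻ k in ball (0 : 𝔼) ρ, ENNReal.ofReal (‖k‖ ^ (-e)) *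
        ENNReal.ofReal (|u (x + k) - u x| ^ q)) +
        ENNReal.ofReal ((2 * M) ^ q * ρ ^ (-e)) * ENNReal.ofReal C₂) :=
        setLIntegral_mono' measurableSet_ball hsplit
    _ = (∫⁻ k in ball (0 : 𝔼) ρ, ∫⁻ x in B, ENNReal.ofReal (‖k‖ ^ (-e)) *
        ENNReal.ofReal (|u (x + k) - u x| ^ q)) +
        ENNReal.ofReal ((2 * M) ^ q * ρ ^ (-e)) * ENNReal.ofReal C₂ * volume B := by
        rw [lintegral_add_right _ measurable_const, setLIntegral_const, lintegral_lintegral_swap]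
        exact (by fun_prop : Measurable fun z : 𝔼 × 𝔼 => ENNReal.ofReal (‖z.2‖ ^ (-e)) *
          ENNReal.ofReal (|u (z.1 + z.2) - u z.1| ^ q)).aemeasurable
    _ ≤ ENNReal.ofReal K * ENNReal.ofReal C₁ +
        ENNReal.ofReal ((2 * M) ^ q * ρ ^ (-e)) * ENNReal.ofReal C₂ * ENNReal.ofReal C₂ := by
        gcongr
        · calc _ ≤ ∫⁻ k in ball (0 : 𝔼) ρ, ENNReal.ofReal K *
                ENNReal.ofReal (‖(0 : 𝔼) - k‖ ^ ((N + b - e) - N)) := by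
                refine setLIntegral_mono' measurableSet_ball fun k hk => ?_
                rw [lintegral_const_mul' _ _ ENNReal.ofReal_ne_top]
                rw [mem_ball_zero_iff] at hk
                rcases eq_or_ne k 0 with rfl | hk0
                · simp [Real.zero_rpow hq.ne']
                · have hkp : 0 < ‖k‖ := norm_pos_iff.2 hk0
                  refine (mul_le_mul_right (hD k hk.le) _).trans (le_of_eq ?_)
                  rw [← ENNReal.ofReal_mul (by positivity), ← ENNReal.ofReal_mul hK]
                  congr 1
                  rw [zero_sub, norm_neg, mul_left_comm, ← Real.rpow_add hkp]
                  congr 2; ring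
            _ ≤ _ := by
                rw [lintegral_const_mul' _ _ ENNReal.ofReal_ne_top]
                gcongr
                exact hnear 0 _ measurableSet_ball (ball_subset_ball (by linarith))
        · exact hvol x₀ r hr
    _ ≤ _ := by
        rw [← ENNReal.ofReal_mul hK, ← ENNReal.ofReal_mul (by positivity),
          ← ENNReal.ofReal_mul (by positivity), ← ENNReal.ofReal_add (by positivity)
          (by positivity)]
        apply ENNReal.ofReal_le_ofReal
        rw [Real.mul_rpow (by norm_num) hM, mul_add]
        have h1 : K * C₁ ≤ C * K := by
          rw [mul_comm]; gcongr; exact le_max_left _ _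
        have h2 : 2 ^ q * M ^ q * ρ ^ (-e) * C₂ * C₂ ≤ C * (M ^ q * ρ ^ (-e)) := by
          calc _ = (2 ^ q * C₂ * C₂) * (M ^ q * ρ ^ (-e)) := by ring
            _ ≤ _ := by gcongr; exact le_max_right _ _
        linarith

/-! ### Pointwise estimate for the difference of two equations -/

theorem abs_kernel_le {p a b z₁ z₀ k₁ kp : ℝ} (hp : 2 ≤ p) (hz₁ : z₁ ∈ sgnSet a)
    (hz₀ : z₀ ∈ sgnSet b) (hk₁ : 0 ≤ k₁) (hkp : 0 ≤ kp) :
    |(z₁ - z₀) * k₁ + (spow (p - 2) a - spow (p - 2) b) * kp| ≤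
      2 * k₁ + (|a| ^ (p - 1) + |b| ^ (p - 1)) * kp := by
  have hJ : ∀ t : ℝ, |spow (p - 2) t| = |t| ^ (p - 1) := fun t => by
    rw [abs_spow (by linarith)]; congr 1; ring
  have hz : |z₁ - z₀| ≤ 2 := by
    have h1 := hz₁.1
    have h0 := hz₀.1
    rw [abs_le]; constructor <;> linarith [h1.1, h1.2, h0.1, h0.2]
  refine (abs_add_le _ _).trans ?_
  rw [abs_mul, abs_mul, abs_of_nonneg hk₁, abs_of_nonneg hkp, ← hJ a, ← hJ b]
  exact add_le_add (mul_le_mul_of_nonneg_right hz hk₁)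
    (mul_le_mul_of_nonneg_right (abs_sub _ _) hkp)

/-- A and B stand for w(x) and w(y), while a and b are the increments from y to x of the translate
and of u; they are tied by A - B = a - b. Hence all monotone quantities increase together, and the
only loss comes from ηx ≠ ηy. -/
theorem pointwise_energy {p β A B a b z₁ z₀ ηx ηy k₁ kp : ℝ} (hp : 2 ≤ p) (hβ : 1 ≤ β)
    (hab : A - B = a - b) (hz₁ : z₁ ∈ sgnSet a) (hz₀ : z₀ ∈ sgnSet b) (hηx : 0 ≤ ηx)
    (hηy : 0 ≤ ηy) (hk₁ : 0 ≤ k₁) (hkp : 0 ≤ kp) :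
    (ηx + ηy) / 2 * (|A - B| ^ (p - 1 + β) * kp) ≤ 2 ^ (p - 1 + β) *
      (((z₁ - z₀) * k₁ + (spow (p - 2) a - spow (p - 2) b) * kp) *
        (spow (β - 1) A * ηx - spow (β - 1) B * ηy) +
        (2 * k₁ + (|a| ^ (p - 1) + |b| ^ (p - 1)) * kp) *
          ((|A| ^ β + |B| ^ β) * |ηx - ηy|)) := by
  have hg : ∀ t : ℝ, |spow (β - 1) t| = |t| ^ β := fun t => by
    rw [abs_spow (by linarith)]; congr 1; ring
  set K := (z₁ - z₀) * k₁ + (spow (p - 2) a - spow (p - 2) b) * kp with hK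
  set Kb := 2 * k₁ + (|a| ^ (p - 1) + |b| ^ (p - 1)) * kp with hKb
  have hKle : |K| ≤ Kb := abs_kernel_le hp hz₁ hz₀ hk₁ hkp
  have hmain : |A - B| ^ (p - 1 + β) * kp ≤
      2 ^ (p - 1 + β) * (K * (spow (β - 1) A - spow (β - 1) B)) := by
    have key : ∀ {A B a b z₁ z₀ : ℝ}, A - B = a - b → z₁ ∈ sgnSet a → z₀ ∈ sgnSet b → B ≤ A →
        |A - B| ^ (p - 1 + β) * kp ≤ 2 ^ (p - 1 + β) *
          (((z₁ - z₀) * k₁ + (spow (p - 2) a - spow (p - 2) b) * kp) *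
            (spow (β - 1) A - spow (β - 1) B)) := by
      intro A B a b z₁ z₀ hab hz₁ hz₀ hBA
      rcases hBA.eq_or_lt with rfl | hlt
      · simp [Real.zero_rpow (by linarith : p - 1 + β ≠ 0)]
      have hlt' : b < a := by linarith
      have h1 := rpow_sub_le_spow_sub (e := p - 2) (by linarith) hlt'.le
      have h2 := rpow_sub_le_spow_sub (e := β - 1) (by linarith) hlt.le
      rw [show p - 2 + 1 = p - 1 by ring, ← hab] at h1
      rw [sub_add_cancel] at h2
      -- The 1-Laplacian enters the diagonal part only through this sign, whatever the selection
      -- made at zero.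
      have h3 : 0 ≤ (z₁ - z₀) * k₁ :=
        mul_nonneg (sub_nonneg.2 (sgnSet_mono hlt' hz₁ hz₀)) hk₁
      have h4 : 0 < A - B := by linarith
      have h5 : 0 ≤ spow (β - 1) A - spow (β - 1) B :=
        sub_nonneg.2 (spow_le_spow (by linarith) hlt.le)
      rw [abs_of_pos h4, Real.rpow_add h4, Real.rpow_add (by norm_num)]
      have h6 := mul_le_mul h1 h2 (by positivity) (le_trans (by positivity) h1)
      calc (A - B) ^ (p - 1) * (A - B) ^ β * kp
          ≤ 2 ^ (p - 1) * (spow (p - 2) a - spow (p - 2) b) *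
              (2 ^ β * (spow (β - 1) A - spow (β - 1) B)) * kp := by gcongr
        _ = 2 ^ (p - 1) * 2 ^ β * ((0 + (spow (p - 2) a - spow (p - 2) b) * kp) *
            (spow (β - 1) A - spow (β - 1) B)) := by ring
        _ ≤ _ := by gcongr
    rcases le_total B A with h | h
    · exact key hab hz₁ hz₀ h
    · have := key (by linarith : B - A = b - a) hz₀ hz₁ h
      rw [abs_sub_comm]
      refine this.trans (le_of_eq ?_)
      rw [hK]; ring
  -- Symmetrized product rule: the mean of η multiplies the monotone difference, and the difference
  -- of η multiplies the mean of the powers.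
  have hdec : K * (spow (β - 1) A * ηx - spow (β - 1) B * ηy) =
      (ηx + ηy) / 2 * (K * (spow (β - 1) A - spow (β - 1) B)) +
        K * ((spow (β - 1) A + spow (β - 1) B) / 2 * (ηx - ηy)) := by ring
  have herr : -(Kb * ((|A| ^ β + |B| ^ β) * |ηx - ηy|)) ≤
      K * ((spow (β - 1) A + spow (β - 1) B) / 2 * (ηx - ηy)) := by
    refine neg_le_of_abs_le ?_
    rw [abs_mul, abs_mul, abs_div, abs_two, ← hg A, ← hg B]
    have h1 := abs_add_le (spow (β - 1) A) (spow (β - 1) B)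
    have h2 : 0 ≤ |spow (β - 1) A| + |spow (β - 1) B| := by positivity
    gcongr
    linarith
  rw [hdec]
  have h2 : (0 : ℝ) < 2 ^ (p - 1 + β) := by positivity
  have h3 := mul_le_mul_of_nonneg_left hmain (by positivity : 0 ≤ (ηx + ηy) / 2)
  nlinarith

/-- Here I is the tested equation and F the error. Integrability of I is required, but not of F,
since an infinite error makes the bound trivial. -/
theorem lintegral_le_of_le_add {α : Type*} [MeasurableSpace α] {μ : Measure α} {G I F : α → ℝ}
    {c : ℝ} (hc : 0 ≤ c) (hI : Integrable I μ) (hI0 : ∫ z, I z ∂μ = 0) (hF : Measurable F)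
    (hF0 : ∀ z, 0 ≤ F z) (hG0 : ∀ z, 0 ≤ G z) (h : ∀ z, G z ≤ c * (I z + F z)) :
    ∫⁻ z, ENNReal.ofReal (G z) ∂μ ≤ ENNReal.ofReal c * ∫⁻ z, ENNReal.ofReal (F z) ∂μ := by
  by_cases hfin : ∫⁻ z, ENNReal.ofReal (F z) ∂μ = ∞
  · rcases hc.eq_or_lt with rfl | hc
    · simp only [zero_mul] at h
      simp [fun z => le_antisymm (h z) (hG0 z)]
    · rw [hfin, ENNReal.mul_top (by simpa using hc)]
      exact le_top
  have hFi : Integrable F μ :=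
    ⟨hF.aestronglyMeasurable, (hasFiniteIntegral_iff_ofReal (Filter.Eventually.of_forall hF0)).2
      (lt_top_iff_ne_top.2 hfin)⟩
  calc ∫⁻ z, ENNReal.ofReal (G z) ∂μ ≤ ∫⁻ z, ENNReal.ofReal (c * (I z + F z)) ∂μ :=
        lintegral_mono fun z => ENNReal.ofReal_le_ofReal (h z)
    _ = ENNReal.ofReal (∫ z, c * (I z + F z) ∂μ) := by
        exact (ofReal_integral_eq_lintegral_ofReal ((hI.add hFi).const_mul c)
          (Filter.Eventually.of_forall fun z => (hG0 z).trans (h z))).symm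
    _ = ENNReal.ofReal c * ∫⁻ z, ENNReal.ofReal (F z) ∂μ := by
        rw [integral_const_mul, integral_add hI hFi, hI0, zero_add, ENNReal.ofReal_mul hc,
          ofReal_integral_eq_lintegral_ofReal hFi (Filter.Eventually.of_forall hF0)]

/-! ### Hölder estimates -/

theorem exists_lintegral_rpow_le_of_volume {β q : ℝ} (hβ : 0 < β) (hβq : β < q) :
    ∃ C : ℝ, 0 < C ∧ ∀ (w : 𝔼 → ℝ), Measurable w → ∀ (x₀ : 𝔼) (r : ℝ), r ≤ 1 →
      ∫⁻ x in ball x₀ r, ENNReal.ofReal (|w x| ^ β) ≤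
        ENNReal.ofReal C * (∫⁻ x in ball x₀ r, ENNReal.ofReal (|w x| ^ q)) ^ (β / q) := by
  obtain ⟨C, hC, hvol⟩ := exists_volume_ball_le (N := N)
  have hq : 0 < q := hβ.trans hβq
  refine ⟨C ^ (1 - β / q), by positivity, fun w hw x₀ r hr => ?_⟩
  have hconj : (q / β).HolderConjugate (q / (q - β)) := by
    rw [Real.holderConjugate_iff]
    refine ⟨by rw [lt_div_iff₀ hβ]; linarith, ?_⟩
    have : q - β ≠ 0 := by linarith
    field_simp; ring
  have h := ENNReal.lintegral_mul_le_Lp_mul_Lq (volume.restrict (ball x₀ r)) hconj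
    (f := fun x => ENNReal.ofReal (|w x| ^ β)) (g := fun _ => 1)
    (by fun_prop) (by fun_prop)
  simp only [Pi.mul_apply, mul_one, ENNReal.one_rpow, lintegral_const, Measure.restrict_apply_univ,
    one_mul] at h
  refine h.trans ?_
  rw [mul_comm]
  have hexp : ∀ x, ENNReal.ofReal (|w x| ^ β) ^ (q / β) = ENNReal.ofReal (|w x| ^ q) := fun x => by
    rw [ENNReal.ofReal_rpow_of_nonneg (by positivity) (by positivity), ← Real.rpow_mul
      (abs_nonneg _), mul_div_cancel₀ _ hβ.ne']
  simp_rw [hexp, one_div_div]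
  gcongr
  have h1 : (q - β) / q = 1 - β / q := by field_simp
  have h2 : 0 ≤ 1 - β / q := by rw [← h1]; exact div_nonneg (by linarith) hq.le
  rw [h1, ← ENNReal.ofReal_rpow_of_nonneg hC.le h2]
  exact ENNReal.rpow_le_rpow (hvol x₀ r hr) h2

theorem ball_subset_ball_two {x₀ x : 𝔼} {r : ℝ} (hr : r ≤ 1) (hx : x ∈ ball x₀ r) :
    ball x₀ r ⊆ ball x 2 := by
  intro y hy
  rw [mem_ball] at *
  have := dist_triangle_right y x x₀
  linarith

/-- The factor ‖x - y‖ supplied by a Lipschitz cutoff leaves the exponent 1 - N - s, which is above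
-N. This absorbs the 1-Laplacian error. -/
theorem exists_lintegral_near_le (hN : 1 ≤ N) {s β : ℝ} (hs : s < 1) :
    ∃ C : ℝ, 0 < C ∧ ∀ (w : 𝔼 → ℝ) (x₀ : 𝔼) (r : ℝ), r ≤ 1 →
      ∫⁻ x in ball x₀ r, ∫⁻ y in ball x₀ r,
        ENNReal.ofReal (|w x| ^ β * (‖x - y‖ / ‖x - y‖ ^ (N + s))) ≤
        ENNReal.ofReal C * ∫⁻ x in ball x₀ r, ENNReal.ofReal (|w x| ^ β) := by
  obtain ⟨C, hC, h⟩ := exists_lintegral_ball_rpow_le hN (τ := 1 - s) (by linarith)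
  refine ⟨C, hC, fun w x₀ r hr => ?_⟩
  rw [← lintegral_const_mul' _ _ ENNReal.ofReal_ne_top]
  refine setLIntegral_mono' measurableSet_ball fun x hx => ?_
  simp_rw [ENNReal.ofReal_mul (Real.rpow_nonneg (abs_nonneg (w x)) β)]
  rw [lintegral_const_mul' _ _ ENNReal.ofReal_ne_top, mul_comm]
  gcongr
  refine le_trans (lintegral_mono fun y => ENNReal.ofReal_le_ofReal ?_)
    (h x _ measurableSet_ball (ball_subset_ball_two hr hx))
  rcases (norm_nonneg (x - y)).eq_or_lt with h0 | h0
  · rw [← h0]; simp only [zero_div]; positivity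
  · nth_rewrite 1 [← Real.rpow_one ‖x - y‖]
    rw [← Real.rpow_sub h0]
    apply le_of_eq; congr 1; ring

/-- Hölder with exponents q/β and q/m, q = m + β, puts all of v in its own energy. The weight left
with w must be integrable in y, and this is the meaning of 1 - θ + γ m > 0. -/
theorem exists_lintegral_holder_le (hN : 1 ≤ N) {m β θ γ : ℝ} (hm : 0 < m) (hβ : 0 < β)
    (hτ : 0 < 1 - θ + γ * m) :
    ∃ C : ℝ, 0 < C ∧ ∀ (w v : 𝔼 → ℝ), Measurable w → Measurable v → ∀ (x₀ : 𝔼) (r : ℝ), r ≤ 1 →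
      ∫⁻ x in ball x₀ r, ∫⁻ y in ball x₀ r,
        ENNReal.ofReal (|w x| ^ β * (‖x - y‖ * (|v x - v y| ^ m / ‖x - y‖ ^ (N + θ)))) ≤
        ENNReal.ofReal C *
          (∫⁻ x in ball x₀ r, ENNReal.ofReal (|w x| ^ (m + β))) ^ (β / (m + β)) *
          dint (N + γ * (m + β)) (m + β) v (ball x₀ r) ^ (m / (m + β)) := by
  set q := m + β with hq
  have hq0 : 0 < q := by positivity
  obtain ⟨C, hC, h⟩ := exists_lintegral_ball_rpow_le hN (τ := (1 - θ + γ * m) * (q / β))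
    (by positivity)
  refine ⟨C ^ (β / q), by positivity, fun w v hw hv x₀ r hr => ?_⟩
  set μ := volume.restrict (ball x₀ r)
  have hconj : (q / β).HolderConjugate (q / m) := by
    rw [Real.holderConjugate_iff]
    refine ⟨by rw [lt_div_iff₀ hβ]; linarith, ?_⟩
    field_simp; linarith
  -- What remains of the total exponent 1 - N - θ once v has taken its share (N + γ q) m / q. Raised
  -- to q/β it becomes an exponent above -N.
  set e : ℝ := (1 - θ + γ * m) - N * (β / q)
  set f : 𝔼 × 𝔼 → ℝ≥0∞ := fun z => ENNReal.ofReal (|w z.1| ^ β * ‖z.1 - z.2‖ ^ e)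
  set g : 𝔼 × 𝔼 → ℝ≥0∞ := fun z =>
    ENNReal.ofReal (|v z.1 - v z.2| ^ m / ‖z.1 - z.2‖ ^ ((N + γ * q) * (m / q)))
  have hf : Measurable f := by fun_prop
  have hg : Measurable g := by fun_prop
  have hfq : ∫⁻ z, f z ^ (q / β) ∂(μ.prod μ) ≤
      ENNReal.ofReal C * ∫⁻ x in ball x₀ r, ENNReal.ofReal (|w x| ^ q) := by
    rw [lintegral_prod _ (hf.pow_const _).aemeasurable,
      ← lintegral_const_mul' _ _ ENNReal.ofReal_ne_top]
    refine setLIntegral_mono' measurableSet_ball fun x hx => ?_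
    have : ∀ y, f (x, y) ^ (q / β) = ENNReal.ofReal (|w x| ^ q) *
        ENNReal.ofReal (‖x - y‖ ^ ((1 - θ + γ * m) * (q / β) - N)) := fun y => by
      simp only [f]
      rw [ENNReal.ofReal_rpow_of_nonneg (by positivity) (by positivity),
        Real.mul_rpow (by positivity) (by positivity), ← Real.rpow_mul (abs_nonneg _),
        ← Real.rpow_mul (norm_nonneg _), ENNReal.ofReal_mul (by positivity),
        mul_div_cancel₀ _ hβ.ne']
      congr 3
      simp only [e]; field_simp
    simp_rw [this]
    rw [lintegral_const_mul' _ _ ENNReal.ofReal_ne_top, mul_comm]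
    gcongr
    exact h x _ measurableSet_ball (ball_subset_ball_two hr hx)
  have hgq : ∫⁻ z, g z ^ (q / m) ∂(μ.prod μ) = dint (N + γ * q) q v (ball x₀ r) := by
    rw [lintegral_prod _ (hg.pow_const _).aemeasurable]
    refine lintegral_congr fun x => lintegral_congr fun y => ?_
    simp only [g]
    rw [ENNReal.ofReal_rpow_of_nonneg (by positivity) (by positivity),
      Real.div_rpow (by positivity) (by positivity), ← Real.rpow_mul (abs_nonneg _),
      ← Real.rpow_mul (norm_nonneg _), mul_div_cancel₀ _ hm.ne']
    congr 3
    field_simp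
  have hH := ENNReal.lintegral_mul_le_Lp_mul_Lq (μ.prod μ) hconj hf.aemeasurable hg.aemeasurable
  rw [hgq, one_div_div, one_div_div] at hH
  calc _ = ∫⁻ z, (f * g) z ∂(μ.prod μ) := by
        rw [lintegral_prod _ (hf.mul hg).aemeasurable]
        refine lintegral_congr fun x => lintegral_congr fun y => ?_
        simp only [f, g, Pi.mul_apply]
        rw [← ENNReal.ofReal_mul (by positivity)]
        congr 1
        rcases (norm_nonneg (x - y)).eq_or_lt with h0 | h0
        · have : x = y := by rwa [eq_comm, norm_eq_zero, sub_eq_zero] at h0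
          simp [this, Real.zero_rpow hm.ne']
        · rw [mul_assoc]
          congr 1
          have h1 : ‖x - y‖ ^ (N + θ) = ‖x - y‖ ^ ((N + γ * q) * (m / q)) * ‖x - y‖ /
              ‖x - y‖ ^ e := by
            nth_rewrite 3 [← Real.rpow_one ‖x - y‖]
            rw [← Real.rpow_add h0, ← Real.rpow_sub h0]
            congr 1
            simp only [e, hq]; field_simp; ring
          rw [h1]
          field_simp
    _ ≤ _ := hH
    _ ≤ (ENNReal.ofReal C * ∫⁻ x in ball x₀ r, ENNReal.ofReal (|w x| ^ q)) ^ (β / q) *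
          dint (N + γ * q) q v (ball x₀ r) ^ (m / q) := by gcongr
    _ = _ := by
        rw [ENNReal.mul_rpow_of_nonneg _ _ (by positivity),
          ENNReal.ofReal_rpow_of_nonneg hC.le (by positivity)]

/-! ### Splitting double integrals of compactly supported functions -/

/-- A contributing pair has a point in A, so either both points lie in B or one is in A and the
other off B. Symmetry merges the two mixed cases. -/
theorem lintegral_split_le {F : 𝔼 → 𝔼 → ℝ≥0∞} (hF : Measurable (Function.uncurry F)) {A B : Set 𝔼}
    (hA : MeasurableSet A) (hB : MeasurableSet B) (hsymm : ∀ x y, F x y = F y x)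
    (hzero : ∀ x ∉ A, ∀ y ∉ A, F x y = 0) (hAB : A ⊆ B) :
    ∫⁻ x, ∫⁻ y, F x y ≤ (∫⁻ x in B, ∫⁻ y in B, F x y) + 2 * ∫⁻ x in A, ∫⁻ y in Bᶜ, F x y := by
  have hle : ∀ x y, F x y ≤ B.indicator (fun x => B.indicator (F x) y) x +
      (A.indicator (fun x => Bᶜ.indicator (F x) y) x +
        Bᶜ.indicator (fun x => A.indicator (F x) y) x) := by
    intro x y
    by_cases hx : x ∈ B <;> by_cases hy : y ∈ B <;> by_cases hx' : x ∈ A <;>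
      by_cases hy' : y ∈ A <;>
      first
        | exact absurd (hAB ‹_›) ‹_›
        | simp [hzero x hx' y hy']
        | simp [hx, hy, hx', hy']
  have hm1 : Measurable fun x => ∫⁻ y in B, F x y := hF.lintegral_prod_right'
  have hm2 : Measurable fun x => ∫⁻ y in Bᶜ, F x y := hF.lintegral_prod_right'
  have hm3 : Measurable fun x => ∫⁻ y in A, F x y := hF.lintegral_prod_right'
  have hin : ∀ (S T : Set 𝔼) (hT : MeasurableSet T) (x : 𝔼),
      ∫⁻ y, S.indicator (fun x => T.indicator (F x) y) x =
        S.indicator (fun x => ∫⁻ y in T, F x y) x := by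
    intro S T hT x
    by_cases hx : x ∈ S
    · simp [hx, lintegral_indicator hT]
    · simp [hx]
  have hmeas : ∀ (S T : Set 𝔼) (hT : MeasurableSet T) (x : 𝔼),
      Measurable fun y => S.indicator (fun x => T.indicator (F x) y) x := by
    intro S T hT x
    by_cases hx : x ∈ S
    · simp only [hx, indicator_of_mem]
      exact (hF.comp measurable_prodMk_left).indicator hT
    · simp [hx]
  calc ∫⁻ x, ∫⁻ y, F x y ≤ ∫⁻ x, (B.indicator (fun x => ∫⁻ y in B, F x y) x +
        (A.indicator (fun x => ∫⁻ y in Bᶜ, F x y) x +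
          Bᶜ.indicator (fun x => ∫⁻ y in A, F x y) x)) := by
        refine lintegral_mono fun x => (lintegral_mono fun y => hle x y).trans (le_of_eq ?_)
        rw [lintegral_add_left (hmeas B B hB x), lintegral_add_left (hmeas A Bᶜ hB.compl x),
          hin B B hB, hin A Bᶜ hB.compl, hin Bᶜ A hA]
    _ = (∫⁻ x in B, ∫⁻ y in B, F x y) + ((∫⁻ x in A, ∫⁻ y in Bᶜ, F x y) +
          ∫⁻ x in Bᶜ, ∫⁻ y in A, F x y) := by
        rw [lintegral_add_left (hm1.indicator hB), lintegral_add_left (hm2.indicator hA),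
          lintegral_indicator hB, lintegral_indicator hA, lintegral_indicator hB.compl]
    _ = _ := by
        have : ∫⁻ x in Bᶜ, ∫⁻ y in A, F x y = ∫⁻ x in A, ∫⁻ y in Bᶜ, F x y := by
          rw [lintegral_lintegral_swap hF.aemeasurable]
          simp_rw [fun x y => hsymm y x]
        rw [this, two_mul]

/-! ### Cutoff functions -/

/-- A Lipschitz cutoff function: `1` on the ball of radius `r + ρ`, `0` off the ball of radius
`r + 2 ρ`. -/
noncomputable def cutoff (x₀ : 𝔼) (r ρ : ℝ) (x : 𝔼) : ℝ :=
  max 0 (min 1 ((r + 2 * ρ - ‖x - x₀‖) / ρ))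

theorem measurable_cutoff (x₀ : 𝔼) (r ρ : ℝ) : Measurable (cutoff x₀ r ρ) := by
  unfold cutoff; fun_prop

theorem cutoff_nonneg (x₀ : 𝔼) (r ρ : ℝ) (x : 𝔼) : 0 ≤ cutoff x₀ r ρ x := le_max_left _ _

theorem cutoff_le_one (x₀ : 𝔼) (r ρ : ℝ) (x : 𝔼) : cutoff x₀ r ρ x ≤ 1 :=
  max_le zero_le_one (min_le_left _ _)

theorem cutoff_eq_one {x₀ : 𝔼} {r ρ : ℝ} (hρ : 0 < ρ) {x : 𝔼} (hx : x ∈ ball x₀ (r + ρ)) :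
    cutoff x₀ r ρ x = 1 := by
  rw [mem_ball, dist_eq_norm] at hx
  rw [cutoff, min_eq_left, max_eq_right zero_le_one]
  rw [le_div_iff₀ hρ]; linarith

theorem cutoff_eq_zero {x₀ : 𝔼} {r ρ : ℝ} (hρ : 0 < ρ) {x : 𝔼} (hx : x ∉ ball x₀ (r + 2 * ρ)) :
    cutoff x₀ r ρ x = 0 := by
  rw [mem_ball, dist_eq_norm, not_lt] at hx
  rw [cutoff, max_eq_left]
  refine (min_le_right _ _).trans ?_
  exact div_nonpos_of_nonpos_of_nonneg (by linarith) hρ.le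

theorem abs_cutoff_sub_le (x₀ : 𝔼) (r : ℝ) {ρ : ℝ} (hρ : 0 < ρ) (x y : 𝔼) :
    |cutoff x₀ r ρ x - cutoff x₀ r ρ y| ≤ ‖x - y‖ / ρ := by
  unfold cutoff
  rw [max_comm 0, max_comm 0, min_comm 1, min_comm 1]
  refine (abs_max_sub_max_le_abs _ _ _).trans ((abs_inf_sub_inf_le_abs _ _ _).trans ?_)
  rw [← sub_div, abs_div, abs_of_pos hρ]
  gcongr
  rw [sub_sub_sub_cancel_left, abs_sub_comm]
  refine (abs_norm_sub_norm_le _ _).trans (le_of_eq ?_)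
  congr 1; abel

/-! ### Local solutions -/

/-- A bounded solution of the mixed equation in the ball `B_R(x₀)`, with a pointwise normalized
representative, such that the size of `u` is controlled by `M`. -/
structure LocalSolution (p s₁ sp : ℝ) (u : 𝔼 → ℝ) (x₀ : 𝔼) (R M : ℝ) : Prop where
  measurable : Measurable u
  one_le : 1 ≤ M
  bound : ∀ x ∈ ball x₀ R, |u x| ≤ M
  tail_le : ∫⁻ x in (ball x₀ R)ᶜ, ENNReal.ofReal (|u x| ^ (p - 1) / ‖x - x₀‖ ^ (N + sp * p)) ≤
    ENNReal.ofReal (M ^ (p - 1) * R ^ (-(sp * p)))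
  dint_le : dint (N + sp * p) p u (ball x₀ R) ≤ ENNReal.ofReal (M ^ p)
  dint_one : dint (N + s₁ * 1) 1 u (ball x₀ R) < ∞
  exists_sign : ∃ Z : 𝔼 × 𝔼 → ℝ, Measurable Z ∧ (∀ z, Z z ∈ sgnSet (u z.1 - u z.2)) ∧
    ∀ φ : 𝔼 → ℝ, MemW s₁ 1 φ univ → MemW sp p φ univ → HasCompactSupport φ →
      tsupport φ ⊆ ball x₀ R →
      (∫ z, Z z * (φ z.1 - φ z.2) / ‖z.1 - z.2‖ ^ ((N : ℝ) + s₁) ∂(volume.prod volume)) +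
      (∫ z, spow (p - 2) (u z.1 - u z.2) * (φ z.1 - φ z.2) /
        ‖z.1 - z.2‖ ^ ((N : ℝ) + sp * p) ∂(volume.prod volume)) = 0

/-- Recentring the tail from x₀ to x costs a power of 1/ρ: for y off the ball of radius R ≤ 1 one
has ‖y - x₀‖ ≤ (2/ρ) ‖x - y‖. Inside that ball u is bounded by M. -/
theorem exists_lintegral_tail_le {p s₁ sp : ℝ} (hp : 2 ≤ p) (hsp : 0 < sp) :
    ∃ C κ : ℝ, 0 < C ∧ 0 < κ ∧ ∀ (u : 𝔼 → ℝ) (x₀ : 𝔼) (R M : ℝ),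
      LocalSolution p s₁ sp u x₀ R M → R ≤ 1 → ∀ (ρ : ℝ) (x : 𝔼), 0 < ρ →
      x ∈ ball x₀ (R - ρ) →
      ∫⁻ y in {y | ρ ≤ ‖x - y‖}, ENNReal.ofReal (|u x - u y| ^ (p - 1) /
        ‖x - y‖ ^ (N + sp * p)) ≤ ENNReal.ofReal (C * M ^ (p - 1) * ρ ^ (-κ)) := by
  have hθ : 0 < sp * p := by positivity
  obtain ⟨C, hC, hfar⟩ := exists_lintegral_far_le (N := N) hθ
  set e : ℝ := N + sp * p with he
  have he0 : 0 < e := by positivity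
  refine ⟨2 ^ (p - 1) * (2 * C) + 2 ^ (p - 1) * 2 ^ e, e + sp * p, by positivity, by positivity,
    fun u x₀ R M hu hR ρ x hρ hx => ?_⟩
  have hM : 0 < M := by linarith [hu.one_le]
  rw [mem_ball, dist_eq_norm] at hx
  have hρR : ρ < R := by linarith [norm_nonneg (x - x₀)]
  have hxR : x ∈ ball x₀ R := by rw [mem_ball, dist_eq_norm]; linarith
  set g : 𝔼 → ℝ≥0∞ := fun y =>
    ENNReal.ofReal (2 ^ (p - 1) * (2 / ρ) ^ e) *
      ENNReal.ofReal (|u y| ^ (p - 1) / ‖y - x₀‖ ^ e)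
  calc _ ≤ ∫⁻ y in {y | ρ ≤ ‖x - y‖}, (ENNReal.ofReal (2 ^ (p - 1) * (2 * M ^ (p - 1))) *
          ENNReal.ofReal (1 / ‖x - y‖ ^ e) + (ball x₀ R)ᶜ.indicator g y) := by
        refine setLIntegral_mono' (measurableSet_le (by fun_prop) (by fun_prop)) fun y hy => ?_
        have hy : ρ ≤ ‖x - y‖ := hy
        have hd : 0 < ‖x - y‖ := by linarith
        have h1 := abs_sub_rpow_le (m := p - 1) (by linarith) (u x) (u y)
        have h2 : |u x| ^ (p - 1) ≤ M ^ (p - 1) :=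
          Real.rpow_le_rpow (abs_nonneg _) (hu.bound x hxR) (by linarith)
        rw [← ENNReal.ofReal_mul (by positivity)]
        by_cases hyR : y ∈ ball x₀ R
        · have h3 : |u y| ^ (p - 1) ≤ M ^ (p - 1) :=
            Real.rpow_le_rpow (abs_nonneg _) (hu.bound y hyR) (by linarith)
          rw [indicator_of_notMem (by simpa using hyR), add_zero, mul_one_div]
          apply ENNReal.ofReal_le_ofReal
          gcongr
          refine h1.trans ?_
          gcongr; linarith
        · rw [indicator_of_mem (by simpa using hyR)]
          simp only [g]
          rw [← ENNReal.ofReal_mul (by positivity),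
            ← ENNReal.ofReal_add (by positivity) (by positivity)]
          apply ENNReal.ofReal_le_ofReal
          rw [mem_ball, dist_eq_norm, not_lt] at hyR
          have hy0 : 0 < ‖y - x₀‖ := by linarith
          have h4 : ‖y - x₀‖ ≤ 2 / ρ * ‖x - y‖ := by
            have h5 : ‖y - x₀‖ ≤ ‖x - y‖ + ‖x - x₀‖ := by
              calc ‖y - x₀‖ = ‖(x - x₀) - (x - y)‖ := by congr 1; abel
                _ ≤ _ := norm_sub_le _ _
                _ = _ := add_comm _ _
            rw [div_mul_eq_mul_div, le_div_iff₀ hρ]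
            nlinarith [norm_nonneg (x - x₀)]
          have h6 : 1 / ‖x - y‖ ^ e ≤ (2 / ρ) ^ e * (1 / ‖y - x₀‖ ^ e) := by
            rw [mul_one_div, div_le_div_iff₀ (by positivity) (by positivity), one_mul,
              ← Real.mul_rpow (by positivity) hd.le]
            exact Real.rpow_le_rpow hy0.le h4 he0.le
          calc |u x - u y| ^ (p - 1) / ‖x - y‖ ^ e
              ≤ (2 ^ (p - 1) * (2 * M ^ (p - 1) + |u y| ^ (p - 1))) * (1 / ‖x - y‖ ^ e) := by
                rw [mul_one_div]
                gcongr
                refine h1.trans ?_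
                have : 0 ≤ M ^ (p - 1) := by positivity
                gcongr; linarith
            _ = 2 ^ (p - 1) * (2 * M ^ (p - 1)) * (1 / ‖x - y‖ ^ e) +
                  2 ^ (p - 1) * |u y| ^ (p - 1) * (1 / ‖x - y‖ ^ e) := by ring
            _ ≤ 2 ^ (p - 1) * (2 * M ^ (p - 1)) * (1 / ‖x - y‖ ^ e) +
                  2 ^ (p - 1) * |u y| ^ (p - 1) * ((2 / ρ) ^ e * (1 / ‖y - x₀‖ ^ e)) := by gcongr
            _ = _ := by ring
    _ ≤ ENNReal.ofReal (2 ^ (p - 1) * (2 * M ^ (p - 1))) * ENNReal.ofReal (C * ρ ^ (-e)) +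
          ENNReal.ofReal (2 ^ (p - 1) * (2 / ρ) ^ e) *
            ENNReal.ofReal (M ^ (p - 1) * R ^ (-(sp * p))) := by
        rw [lintegral_add_left (by fun_prop), lintegral_const_mul' _ _ ENNReal.ofReal_ne_top]
        gcongr
        · exact hfar ρ x hρ (by linarith)
        · refine (setLIntegral_le_lintegral _ _).trans ?_
          rw [lintegral_indicator measurableSet_ball.compl]
          simp only [g]
          rw [lintegral_const_mul' _ _ ENNReal.ofReal_ne_top]
          gcongr
          exact hu.tail_le
    _ ≤ _ := by
        rw [← ENNReal.ofReal_mul (by positivity), ← ENNReal.ofReal_mul (by positivity),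
          ← ENNReal.ofReal_add (by positivity) (by have := hρ.trans hρR; positivity)]
        apply ENNReal.ofReal_le_ofReal
        have h1 : ρ ^ (-e) ≤ ρ ^ (-(e + sp * p)) :=
          Real.rpow_le_rpow_of_exponent_ge hρ (by linarith) (by linarith)
        have h3 : R ^ (-(sp * p)) ≤ ρ ^ (-(sp * p)) :=
          Real.rpow_le_rpow_of_nonpos hρ hρR.le (by linarith)
        have h2 : (2 / ρ) ^ e * R ^ (-(sp * p)) ≤ 2 ^ e * ρ ^ (-(e + sp * p)) := by
          rw [Real.div_rpow (by norm_num) hρ.le, div_eq_mul_inv, ← Real.rpow_neg hρ.le,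
            show -(e + sp * p) = -e + -(sp * p) by ring, Real.rpow_add hρ (-e), mul_assoc]
          gcongr
        calc _ = 2 ^ (p - 1) * (2 * C) * M ^ (p - 1) * ρ ^ (-e) +
              2 ^ (p - 1) * M ^ (p - 1) * ((2 / ρ) ^ e * R ^ (-(sp * p))) := by ring
          _ ≤ 2 ^ (p - 1) * (2 * C) * M ^ (p - 1) * ρ ^ (-(e + sp * p)) +
              2 ^ (p - 1) * M ^ (p - 1) * (2 ^ e * ρ ^ (-(e + sp * p))) := by gcongr
          _ = _ := by ring

/-! ### Admissible test functions -/

theorem gagliardo_lt_top_iff {s q : ℝ} (hq : 0 < q) (u : 𝔼 → ℝ) (A : Set 𝔼) :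
    gagliardo s q u A < ∞ ↔ dint (N + s * q) q u A < ∞ := by
  unfold gagliardo dint
  rw [ENNReal.rpow_lt_top_iff_of_pos (by positivity)]

theorem norm_ge_of_mem_ball {x₀ x y : 𝔼} {r ρ : ℝ} (hx : x ∈ ball x₀ r)
    (hy : y ∉ ball x₀ (r + ρ)) : ρ ≤ ‖x - y‖ := by
  rw [mem_ball] at *
  rw [← dist_eq_norm]
  have := dist_triangle_left y x₀ x
  linarith

/-- Bounded functions supported in a ball whose differences are controlled by those of functions
of finite energy. -/
theorem memW_of_abs_sub_le (hN : 1 ≤ N) {s m L L' r ρ : ℝ} {x₀ : 𝔼} (hs0 : 0 < s) (hs1 : s < 1)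
    (hm : 1 ≤ m) (hρ : 0 < ρ) (hr : r + ρ ≤ 1) (hr0 : 0 ≤ r) (hL' : 0 ≤ L')
    {φ v₀ v₁ : 𝔼 → ℝ}
    (hφ : Measurable φ) (hv₀ : Measurable v₀) (hv₁ : Measurable v₁) (hbd : ∀ x, |φ x| ≤ L)
    (hsupp : ∀ x ∉ ball x₀ r, φ x = 0)
    (hdiff : ∀ x ∈ ball x₀ (r + ρ), ∀ y ∈ ball x₀ (r + ρ),
      |φ x - φ y| ≤ L' * (|v₀ x - v₀ y| + |v₁ x - v₁ y| + ‖x - y‖))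
    (h₀ : dint (N + s * m) m v₀ (ball x₀ (r + ρ)) < ∞)
    (h₁ : dint (N + s * m) m v₁ (ball x₀ (r + ρ)) < ∞) : MemW s m φ univ := by
  have hm0 : 0 < m := by linarith
  have hL : 0 ≤ L := (abs_nonneg _).trans (hbd x₀)
  refine ⟨?_, ?_⟩
  · rw [Measure.restrict_univ]
    have h1 : φ = (ball x₀ r).indicator φ := by
      rw [eq_comm, indicator_eq_self]
      intro x hx
      by_contra h
      exact hx (hsupp x h)
    rw [h1, memLp_indicator_iff_restrict measurableSet_ball]
    have : IsFiniteMeasure (volume.restrict (ball x₀ r)) :=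
      ⟨by rw [Measure.restrict_apply_univ]; exact measure_ball_lt_top⟩
    exact MemLp.of_bound hφ.aestronglyMeasurable L (Filter.Eventually.of_forall hbd)
  rw [gagliardo_lt_top_iff hm0]
  set e : ℝ := N + s * m
  set F : 𝔼 → 𝔼 → ℝ≥0∞ := fun x y => ENNReal.ofReal (|φ x - φ y| ^ m / ‖x - y‖ ^ e)
  have hsplit := lintegral_split_le (F := F) (A := ball x₀ r) (B := ball x₀ (r + ρ))
    (measurable_diff_kernel hφ e m) measurableSet_ball measurableSet_ball
    (fun x y => by simp only [F]; rw [abs_sub_comm, norm_sub_rev])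
    (fun x hx y hy => by simp [F, hsupp x hx, hsupp y hy, Real.zero_rpow hm0.ne'])
    (ball_subset_ball (by linarith))
  unfold dint
  rw [Measure.restrict_univ]
  refine hsplit.trans_lt (ENNReal.add_lt_top.2 ⟨?_, ENNReal.mul_lt_top (by simp) ?_⟩)
  · obtain ⟨C, hC, hnear⟩ := exists_lintegral_ball_rpow_le hN (τ := m - s * m) (by nlinarith)
    set D : ℝ := L' ^ m * (2 ^ m * 2 ^ m)
    have hpt : ∀ x ∈ ball x₀ (r + ρ), ∀ y ∈ ball x₀ (r + ρ),
        F x y ≤ ENNReal.ofReal D * (ENNReal.ofReal (|v₀ x - v₀ y| ^ m / ‖x - y‖ ^ e) +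
          ENNReal.ofReal (|v₁ x - v₁ y| ^ m / ‖x - y‖ ^ e) +
          ENNReal.ofReal (‖x - y‖ ^ ((m - s * m) - N))) := by
      intro x hx y hy
      rw [← ENNReal.ofReal_add (by positivity) (by positivity),
        ← ENNReal.ofReal_add (by positivity) (by positivity), ← ENNReal.ofReal_mul (by positivity)]
      apply ENNReal.ofReal_le_ofReal
      rcases (norm_nonneg (x - y)).eq_or_lt with h0 | h0
      · have : x = y := by rwa [eq_comm, norm_eq_zero, sub_eq_zero] at h0
        simp only [this, sub_self, abs_zero, Real.zero_rpow hm0.ne', zero_div]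
        positivity
      have h2 : ‖x - y‖ ^ ((m - s * m) - N) = ‖x - y‖ ^ m / ‖x - y‖ ^ e := by
        rw [← Real.rpow_sub h0]; congr 1; simp only [e]; ring
      rw [h2, ← add_div, ← add_div, ← mul_div_assoc]
      gcongr
      calc |φ x - φ y| ^ m ≤ (L' * (|v₀ x - v₀ y| + |v₁ x - v₁ y| + ‖x - y‖)) ^ m :=
            Real.rpow_le_rpow (abs_nonneg _) (hdiff x hx y hy) hm0.le
        _ = L' ^ m * (|v₀ x - v₀ y| + |v₁ x - v₁ y| + ‖x - y‖) ^ m :=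
            Real.mul_rpow hL' (by positivity)
        _ ≤ L' ^ m * (2 ^ m * ((|v₀ x - v₀ y| + |v₁ x - v₁ y|) ^ m + ‖x - y‖ ^ m)) := by
            gcongr
            exact add_rpow_le_two_rpow (by positivity) (by positivity) hm0.le
        _ ≤ L' ^ m * (2 ^ m * (2 ^ m * (|v₀ x - v₀ y| ^ m + |v₁ x - v₁ y| ^ m) +
              2 ^ m * ‖x - y‖ ^ m)) := by
            gcongr
            · exact add_rpow_le_two_rpow (by positivity) (by positivity) hm0.le
            · exact le_mul_of_one_le_left (by positivity) (Real.one_le_rpow (by norm_num) hm0.le)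
        _ = _ := by simp only [D]; ring
    have hms : ∀ v : 𝔼 → ℝ, Measurable v → ∀ x, Measurable fun y =>
        ENNReal.ofReal (|v x - v y| ^ m / ‖x - y‖ ^ e) := by
      intro v hv x; fun_prop
    have hms' : ∀ v : 𝔼 → ℝ, Measurable v → Measurable fun x =>
        ∫⁻ y in ball x₀ (r + ρ), ENNReal.ofReal (|v x - v y| ^ m / ‖x - y‖ ^ e) :=
      fun v hv => (measurable_diff_kernel hv e m).lintegral_prod_right'
    calc _ ≤ ∫⁻ x in ball x₀ (r + ρ), ENNReal.ofReal D *
          ((∫⁻ y in ball x₀ (r + ρ), ENNReal.ofReal (|v₀ x - v₀ y| ^ m / ‖x - y‖ ^ e)) +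
          (∫⁻ y in ball x₀ (r + ρ), ENNReal.ofReal (|v₁ x - v₁ y| ^ m / ‖x - y‖ ^ e)) +
          ENNReal.ofReal C) := by
          refine setLIntegral_mono' measurableSet_ball fun x hx => ?_
          refine (setLIntegral_mono' measurableSet_ball (hpt x hx)).trans ?_
          rw [lintegral_const_mul' _ _ ENNReal.ofReal_ne_top,
            lintegral_add_left (by fun_prop),
            lintegral_add_left (hms v₀ hv₀ x)]
          gcongr
          exact hnear x _ measurableSet_ball (ball_subset_ball_two hr hx)
      _ = ENNReal.ofReal D * (dint e m v₀ (ball x₀ (r + ρ)) + dint e m v₁ (ball x₀ (r + ρ)) +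
            ENNReal.ofReal C * volume (ball x₀ (r + ρ))) := by
          rw [lintegral_const_mul' _ _ ENNReal.ofReal_ne_top, lintegral_add_right _ measurable_const,
            lintegral_add_left (hms' v₀ hv₀), setLIntegral_const]
          rfl
      _ < ∞ := ENNReal.mul_lt_top ENNReal.ofReal_lt_top (ENNReal.add_lt_top.2
            ⟨ENNReal.add_lt_top.2 ⟨h₀, h₁⟩,
              ENNReal.mul_lt_top ENNReal.ofReal_lt_top measure_ball_lt_top⟩)
  · obtain ⟨C, hC, hfar⟩ := exists_lintegral_far_le (N := N) (τ := s * m) (by positivity)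
    calc _ ≤ ∫⁻ x in ball x₀ r, ENNReal.ofReal (L ^ m) * ENNReal.ofReal (C * ρ ^ (-e)) := by
          refine setLIntegral_mono' measurableSet_ball fun x hx => ?_
          calc _ ≤ ∫⁻ y in (ball x₀ (r + ρ))ᶜ, ENNReal.ofReal (L ^ m) *
                ENNReal.ofReal (1 / ‖x - y‖ ^ e) := by
                refine setLIntegral_mono' measurableSet_ball.compl fun y hy => ?_
                have hy0 : φ y = 0 := hsupp y fun h => hy (ball_subset_ball (by linarith) h)
                rw [← ENNReal.ofReal_mul (by positivity), mul_one_div]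
                apply ENNReal.ofReal_le_ofReal
                rw [hy0, sub_zero]
                gcongr
                exact hbd x
            _ ≤ _ := by
                rw [lintegral_const_mul' _ _ ENNReal.ofReal_ne_top]
                gcongr
                refine (lintegral_mono_set fun y hy => ?_).trans (hfar ρ x hρ (by linarith))
                exact norm_ge_of_mem_ball hx hy
      _ < ∞ := by
          rw [setLIntegral_const]
          exact ENNReal.mul_lt_top (ENNReal.mul_lt_top ENNReal.ofReal_lt_top
            ENNReal.ofReal_lt_top) measure_ball_lt_top

theorem hasCompactSupport_of_ball {φ : 𝔼 → ℝ} {x₀ : 𝔼} {r R : ℝ} (hr : r < R)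
    (hsupp : ∀ x ∉ ball x₀ r, φ x = 0) : HasCompactSupport φ ∧ tsupport φ ⊆ ball x₀ R := by
  have h1 : Function.support φ ⊆ closedBall x₀ r := by
    intro x hx
    by_contra h
    exact hx (hsupp x fun h' => h (ball_subset_closedBall h'))
  have h2 : tsupport φ ⊆ closedBall x₀ r := closure_minimal h1 isClosed_closedBall
  exact ⟨HasCompactSupport.of_support_subset_isCompact (isCompact_closedBall x₀ r) h1,
    h2.trans (closedBall_subset_ball hr)⟩

theorem memW_comp_sub {s m : ℝ} (hm : 0 < m) {φ : 𝔼 → ℝ} (h : 𝔼) (hφ : MemW s m φ univ) :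
    MemW s m (fun x => φ (x - h)) univ := by
  obtain ⟨h1, h2⟩ := hφ
  refine ⟨?_, ?_⟩
  · rw [Measure.restrict_univ] at *
    exact h1.comp_measurePreserving (measurePreserving_sub_right volume h)
  · rw [gagliardo_lt_top_iff hm] at *
    simp_rw [sub_eq_add_neg]
    exact (dint_translate_le _ m φ (-h) MeasurableSet.univ MeasurableSet.univ (by simp)).trans_lt h2

/-! ### Absolute convergence of the weak form -/

theorem integrable_sign_part {s₁ : ℝ} {φ : 𝔼 → ℝ} {Z : 𝔼 × 𝔼 → ℝ} (hφm : Measurable φ)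
    (hφ : MemW s₁ 1 φ univ) (hZ : Measurable Z) (hZ1 : ∀ z, |Z z| ≤ 1) :
    Integrable (fun z : 𝔼 × 𝔼 => Z z * (φ z.1 - φ z.2) / ‖z.1 - z.2‖ ^ ((N : ℝ) + s₁))
      (volume.prod volume) := by
  refine ⟨(by fun_prop : Measurable _).aestronglyMeasurable, ?_⟩
  have h := (gagliardo_lt_top_iff one_pos φ univ).1 hφ.2
  unfold dint at h
  rw [Measure.restrict_univ, ← lintegral_prod
    (fun z : 𝔼 × 𝔼 => ENNReal.ofReal (|φ z.1 - φ z.2| ^ (1 : ℝ) / ‖z.1 - z.2‖ ^ ((N : ℝ) + s₁ * 1)))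
    (measurable_diff_kernel hφm _ _).aemeasurable] at h
  rw [hasFiniteIntegral_iff_norm]
  refine lt_of_le_of_lt (lintegral_mono fun z => ENNReal.ofReal_le_ofReal ?_) h
  rw [Real.norm_eq_abs, abs_div, abs_mul, Real.rpow_one, mul_one,
    abs_of_nonneg (Real.rpow_nonneg (norm_nonneg _) _)]
  gcongr
  exact mul_le_of_le_one_left (abs_nonneg _) (hZ1 z)

/-- On nearby pairs a^(p-1) b ≤ a^p + b^p reduces to the two energies. On distant pairs one value of
φ vanishes, the other is bounded, and the tail of v remains. Integrability is needed before the
integrals of two equations may be subtracted. -/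
theorem integrable_power_part {p sp L T r ρ : ℝ} {x₀ : 𝔼} (hp : 2 ≤ p) (hρ : 0 < ρ)
    {φ v : 𝔼 → ℝ} (hφm : Measurable φ) (hv : Measurable v)
    (hφ : MemW sp p φ univ) (hbd : ∀ x, |φ x| ≤ L) (hsupp : ∀ x ∉ ball x₀ r, φ x = 0)
    (hnear : dint (N + sp * p) p v (ball x₀ (r + ρ)) < ∞)
    (hfar : ∀ x ∈ ball x₀ r, ∫⁻ y in (ball x₀ (r + ρ))ᶜ, ENNReal.ofReal
      (|v x - v y| ^ (p - 1) / ‖x - y‖ ^ (N + sp * p)) ≤ ENNReal.ofReal T) :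
    Integrable (fun z : 𝔼 × 𝔼 => spow (p - 2) (v z.1 - v z.2) * (φ z.1 - φ z.2) /
      ‖z.1 - z.2‖ ^ ((N : ℝ) + sp * p)) (volume.prod volume) := by
  have hspm := measurable_spow (p - 2)
  refine ⟨(by fun_prop : Measurable _).aestronglyMeasurable, ?_⟩
  rw [hasFiniteIntegral_iff_norm]
  set e : ℝ := N + sp * p
  set F : 𝔼 → 𝔼 → ℝ≥0∞ := fun x y =>
    ENNReal.ofReal (|v x - v y| ^ (p - 1) * |φ x - φ y| / ‖x - y‖ ^ e)
  have hFm : Measurable (Function.uncurry F) := by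
    simp only [F, Function.uncurry_def]; fun_prop
  have hL : 0 ≤ L := (abs_nonneg _).trans (hbd x₀)
  have hsplit := lintegral_split_le (F := F) (A := ball x₀ r) (B := ball x₀ (r + ρ))
    hFm measurableSet_ball measurableSet_ball
    (fun x y => by simp only [F]; rw [abs_sub_comm, norm_sub_rev, abs_sub_comm (φ x)])
    (fun x hx y hy => by simp [F, hsupp x hx, hsupp y hy])
    (ball_subset_ball (by linarith))
  have heq : ∀ z : 𝔼 × 𝔼, ENNReal.ofReal ‖spow (p - 2) (v z.1 - v z.2) * (φ z.1 - φ z.2) /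
      ‖z.1 - z.2‖ ^ e‖ = Function.uncurry F z := by
    intro z
    simp only [F, Function.uncurry_def]
    rw [Real.norm_eq_abs, abs_div, abs_mul, abs_spow (by linarith),
      abs_of_nonneg (Real.rpow_nonneg (norm_nonneg _) _), show p - 2 + 1 = p - 1 by ring]
  simp_rw [heq]
  rw [lintegral_prod _ hFm.aemeasurable]
  refine hsplit.trans_lt (ENNReal.add_lt_top.2 ⟨?_, ENNReal.mul_lt_top (by simp) ?_⟩)
  · have hφd := (gagliardo_lt_top_iff (by linarith) φ univ).1 hφ.2
    have hm : Measurable fun x : 𝔼 => ∫⁻ y in ball x₀ (r + ρ),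
        ENNReal.ofReal (|v x - v y| ^ p / ‖x - y‖ ^ e) :=
      (measurable_diff_kernel hv e p).lintegral_prod_right'
    calc _ ≤ dint e p v (ball x₀ (r + ρ)) + dint e p φ (ball x₀ (r + ρ)) := by
          unfold dint
          rw [← lintegral_add_left hm]
          refine lintegral_mono fun x => ?_
          rw [← lintegral_add_left (by fun_prop)]
          refine lintegral_mono fun y => ?_
          rw [← ENNReal.ofReal_add (by positivity) (by positivity)]
          apply ENNReal.ofReal_le_ofReal
          rw [← add_div]
          gcongr
          set a := |v x - v y|
          set b := |φ x - φ y|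
          have ha : 0 ≤ a := abs_nonneg _
          have hb : 0 ≤ b := abs_nonneg _
          have hpow : ∀ t : ℝ, 0 ≤ t → t ^ (p - 1) * t = t ^ p := fun t ht => by
            rw [← Real.rpow_add_one' ht (by linarith)]; congr 1; ring
          rcases le_total a b with h | h
          · have h1 : a ^ (p - 1) * b ≤ b ^ (p - 1) * b := by gcongr; linarith
            rw [hpow b hb] at h1
            linarith [Real.rpow_nonneg ha p]
          · have h1 : a ^ (p - 1) * b ≤ a ^ (p - 1) * a := by gcongr
            rw [hpow a ha] at h1
            linarith [Real.rpow_nonneg hb p]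
      _ < ∞ := ENNReal.add_lt_top.2 ⟨hnear, (dint_mono_set _ _ _ (subset_univ _)).trans_lt hφd⟩
  · calc _ ≤ ∫⁻ x in ball x₀ r, ENNReal.ofReal L * ENNReal.ofReal T := by
          refine setLIntegral_mono' measurableSet_ball fun x hx => ?_
          refine le_trans ?_ (mul_le_mul_right (hfar x hx) _)
          rw [← lintegral_const_mul' _ _ ENNReal.ofReal_ne_top]
          refine setLIntegral_mono' measurableSet_ball.compl fun y hy => ?_
          have hy0 : φ y = 0 := hsupp y fun h => hy (ball_subset_ball (by linarith) h)
          rw [← ENNReal.ofReal_mul hL]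
          apply ENNReal.ofReal_le_ofReal
          rw [hy0, sub_zero, mul_comm, mul_div_assoc]
          gcongr
          exact hbd x
      _ < ∞ := by
          rw [setLIntegral_const]
          exact ENNReal.mul_lt_top (ENNReal.mul_lt_top ENNReal.ofReal_lt_top
            ENNReal.ofReal_lt_top) measure_ball_lt_top

/-! ### The energy estimate for difference quotients -/

/-- An upper bound for the kernel in the difference of the equations of `v₁` and `v₀`. -/
noncomputable def kerBound (p s₁ sp : ℝ) (v₁ v₀ : 𝔼 → ℝ) (x y : 𝔼) : ℝ :=
  2 * (1 / ‖x - y‖ ^ (N + s₁)) +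
    (|v₁ x - v₁ y| ^ (p - 1) + |v₀ x - v₀ y| ^ (p - 1)) * (1 / ‖x - y‖ ^ (N + sp * p))

theorem kerBound_nonneg (p s₁ sp : ℝ) (v₁ v₀ : 𝔼 → ℝ) (x y : 𝔼) :
    0 ≤ kerBound p s₁ sp v₁ v₀ x y := by
  unfold kerBound; positivity

theorem kerBound_comm (p s₁ sp : ℝ) (v₁ v₀ : 𝔼 → ℝ) (x y : 𝔼) :
    kerBound p s₁ sp v₁ v₀ x y = kerBound p s₁ sp v₁ v₀ y x := by
  unfold kerBound
  rw [norm_sub_rev, abs_sub_comm, abs_sub_comm (v₀ x)]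

theorem measurable_kerBound (p s₁ sp : ℝ) {v₁ v₀ : 𝔼 → ℝ} (h₁ : Measurable v₁)
    (h₀ : Measurable v₀) :
    Measurable fun z : 𝔼 × 𝔼 => kerBound p s₁ sp v₁ v₀ z.1 z.2 := by
  unfold kerBound; fun_prop

theorem setLIntegral_prod_iterated {f : 𝔼 × 𝔼 → ℝ≥0∞} (hf : Measurable f) (A B : Set 𝔼) :
    ∫⁻ z in A ×ˢ B, f z ∂(volume.prod volume) = ∫⁻ x in A, ∫⁻ y in B, f (x, y) := by
  rw [← Measure.prod_restrict, lintegral_prod _ hf.aemeasurable]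

/-- Testing the difference of two equations with a truncated signed power of the difference of the
solutions. -/
theorem dint_le_of_difference_eq {p s₁ sp β r ρ : ℝ} {x₀ : 𝔼} (hp : 2 ≤ p) (hβ : 1 ≤ β)
    (hρ : 0 < ρ) {v₁ v₀ : 𝔼 → ℝ} {Z₁ Z₀ : 𝔼 × 𝔼 → ℝ} (hv₁ : Measurable v₁) (hv₀ : Measurable v₀)
    (hZ₁ : ∀ z, Z₁ z ∈ sgnSet (v₁ z.1 - v₁ z.2)) (hZ₀ : ∀ z, Z₀ z ∈ sgnSet (v₀ z.1 - v₀ z.2))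
    {φ I : 𝔼 × 𝔼 → ℝ}
    (hφ : ∀ z, φ z = spow (β - 1) (v₁ z.1 - v₀ z.1) * cutoff x₀ r ρ z.1 -
      spow (β - 1) (v₁ z.2 - v₀ z.2) * cutoff x₀ r ρ z.2)
    (hI : ∀ z, I z = (Z₁ z * φ z / ‖z.1 - z.2‖ ^ ((N : ℝ) + s₁) +
        spow (p - 2) (v₁ z.1 - v₁ z.2) * φ z / ‖z.1 - z.2‖ ^ ((N : ℝ) + sp * p)) -
      (Z₀ z * φ z / ‖z.1 - z.2‖ ^ ((N : ℝ) + s₁) +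
        spow (p - 2) (v₀ z.1 - v₀ z.2) * φ z / ‖z.1 - z.2‖ ^ ((N : ℝ) + sp * p)))
    (h_int : Integrable I (volume.prod volume)) (hI0 : ∫ z, I z ∂(volume.prod volume) = 0) :
    dint (N + sp * p) (p - 1 + β) (fun x => v₁ x - v₀ x) (ball x₀ (r + ρ)) ≤
      ENNReal.ofReal (2 * 2 ^ (p - 1 + β)) *
      ((∫⁻ x in ball x₀ (r + 2 * ρ + ρ), ∫⁻ y in ball x₀ (r + 2 * ρ + ρ), ENNReal.ofReal
        (kerBound p s₁ sp v₁ v₀ x y * (|v₁ x - v₀ x| ^ β * (‖x - y‖ / ρ)))) +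
      ∫⁻ x in ball x₀ (r + 2 * ρ), ∫⁻ y in (ball x₀ (r + 2 * ρ + ρ))ᶜ, ENNReal.ofReal
        (kerBound p s₁ sp v₁ v₀ x y * |v₁ x - v₀ x| ^ β)) := by
  set B₁ := ball x₀ (r + ρ)
  set B₂ := ball x₀ (r + 2 * ρ)
  set B₃ := ball x₀ (r + 2 * ρ + ρ)
  have hB₁ : MeasurableSet B₁ := measurableSet_ball
  have hB₂ : MeasurableSet B₂ := measurableSet_ball
  have hB₃ : MeasurableSet B₃ := measurableSet_ball
  have h12 : B₁ ⊆ B₃ := ball_subset_ball (by linarith)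
  have h23 : B₂ ⊆ B₃ := ball_subset_ball (by linarith)
  set w : 𝔼 → ℝ := fun x => v₁ x - v₀ x
  have hw : Measurable w := hv₁.sub hv₀
  set K : 𝔼 → 𝔼 → ℝ := kerBound p s₁ sp v₁ v₀
  have hK0 : ∀ x y, 0 ≤ K x y := kerBound_nonneg p s₁ sp v₁ v₀
  have hKm : Measurable fun z : 𝔼 × 𝔼 => K z.1 z.2 := measurable_kerBound p s₁ sp hv₁ hv₀
  set η := cutoff x₀ r ρ
  have hβ0 : 0 < β := by linarith
  -- D dominates the share of x in the cutoff error: Lipschitz when both points are in B₃, trivial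
  -- when x is in B₂ and y is off B₃. The share of y is D at the swapped pair.
  set D : 𝔼 × 𝔼 → ℝ := fun z => |w z.1| ^ β *
    ((B₃ ×ˢ B₃).indicator (fun z => ‖z.1 - z.2‖ / ρ) z + (B₂ ×ˢ B₃ᶜ).indicator (fun _ => 1) z)
  have hD0 : ∀ z, 0 ≤ D z := fun z => by
    have h1 : 0 ≤ (B₃ ×ˢ B₃).indicator (fun z : 𝔼 × 𝔼 => ‖z.1 - z.2‖ / ρ) z :=
      indicator_nonneg (fun z _ => by positivity) z
    have h2 : 0 ≤ (B₂ ×ˢ B₃ᶜ).indicator (fun _ : 𝔼 × 𝔼 => (1 : ℝ)) z :=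
      indicator_nonneg (fun z _ => zero_le_one) z
    simp only [D]; positivity
  have hDm : Measurable D := by
    have h1 : Measurable ((B₃ ×ˢ B₃).indicator (fun z : 𝔼 × 𝔼 => ‖z.1 - z.2‖ / ρ)) :=
      (by fun_prop : Measurable fun z : 𝔼 × 𝔼 => ‖z.1 - z.2‖ / ρ).indicator (hB₃.prod hB₃)
    have h2 : Measurable ((B₂ ×ˢ B₃ᶜ).indicator (fun _ : 𝔼 × 𝔼 => (1 : ℝ))) :=
      measurable_const.indicator (hB₂.prod hB₃.compl)
    fun_prop
  set G : 𝔼 × 𝔼 → ℝ := (B₁ ×ˢ B₁).indicator fun z =>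
    |w z.1 - w z.2| ^ (p - 1 + β) / ‖z.1 - z.2‖ ^ (N + sp * p)
  set F : 𝔼 × 𝔼 → ℝ := fun z => K z.1 z.2 * (D z + D z.swap)
  have hFm : Measurable F := by
    have := hDm.comp measurable_swap
    exact hKm.mul (hDm.add this)
  have hspow : ∀ t, |spow (β - 1) t| = |t| ^ β := fun t => by
    rw [abs_spow (by linarith), sub_add_cancel]
  have hKI : ∀ z : 𝔼 × 𝔼, I z = ((Z₁ z - Z₀ z) * (1 / ‖z.1 - z.2‖ ^ ((N : ℝ) + s₁)) +
      (spow (p - 2) (v₁ z.1 - v₁ z.2) - spow (p - 2) (v₀ z.1 - v₀ z.2)) *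
        (1 / ‖z.1 - z.2‖ ^ ((N : ℝ) + sp * p))) *
      (spow (β - 1) (w z.1) * η z.1 - spow (β - 1) (w z.2) * η z.2) := by
    intro z; rw [hI, hφ]; ring
  have hpe := fun z : 𝔼 × 𝔼 => pointwise_energy (A := w z.1) (B := w z.2)
    (k₁ := 1 / ‖z.1 - z.2‖ ^ ((N : ℝ) + s₁)) (kp := 1 / ‖z.1 - z.2‖ ^ ((N : ℝ) + sp * p))
    hp hβ (by simp only [w]; ring) (hZ₁ z) (hZ₀ z) (cutoff_nonneg x₀ r ρ z.1)
    (cutoff_nonneg x₀ r ρ z.2) (by positivity) (by positivity)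
  have hpt : ∀ z, G z ≤ 2 ^ (p - 1 + β) * (I z + F z) := by
    rintro ⟨x, y⟩
    by_cases hxy : x ∈ B₃ ∧ y ∈ B₃
    · obtain ⟨hx, hy⟩ := hxy
      have hz := hpe (x, y)
      have h1 : D (x, y) + D (y, x) = (|w x| ^ β + |w y| ^ β) * (‖x - y‖ / ρ) := by
        simp [D, hx, hy, norm_sub_rev y x]; ring
      have h2 : G (x, y) ≤ (η x + η y) / 2 *
          (|w x - w y| ^ (p - 1 + β) * (1 / ‖x - y‖ ^ ((N : ℝ) + sp * p))) := by
        by_cases hB : x ∈ B₁ ∧ y ∈ B₁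
        · simp only [G, indicator_of_mem (show (x, y) ∈ B₁ ×ˢ B₁ from hB), η,
            cutoff_eq_one hρ hB.1, cutoff_eq_one hρ hB.2]
          apply le_of_eq; ring
        · simp only [G, indicator_of_notMem (show (x, y) ∉ B₁ ×ˢ B₁ from hB)]
          have := cutoff_nonneg x₀ r ρ x
          have := cutoff_nonneg x₀ r ρ y
          positivity
      refine h2.trans (hz.trans ?_)
      have h3 : (|w x| ^ β + |w y| ^ β) * |η x - η y| ≤ D (x, y) + D (y, x) := by
        rw [h1]
        gcongr
        exact abs_cutoff_sub_le x₀ r hρ x y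
      gcongr ?_ * (?_ + ?_)
      · rw [hKI]
      · exact mul_le_mul_of_nonneg_left h3 (hK0 x y)
    · have hG0 : G (x, y) = 0 := indicator_of_notMem (fun h => hxy ⟨h12 h.1, h12 h.2⟩) _
      have hφD : |spow (β - 1) (w x) * η x - spow (β - 1) (w y) * η y| ≤
          D (x, y) + D (y, x) := by
        have hle : ∀ x y : 𝔼, y ∉ B₃ → |spow (β - 1) (w x) * η x| ≤ D (x, y) := by
          intro x y hy
          by_cases hx : x ∈ B₂
          · have hDxy : D (x, y) = |w x| ^ β := by simp [D, hx, hy]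
            rw [hDxy, abs_mul, hspow, abs_of_nonneg (cutoff_nonneg x₀ r ρ x)]
            exact mul_le_of_le_one_right (by positivity) (cutoff_le_one x₀ r ρ x)
          · simp only [η, cutoff_eq_zero hρ hx, mul_zero, abs_zero]
            exact hD0 _
        have hη0 : ∀ y ∉ B₃, η y = 0 := fun y hy => cutoff_eq_zero hρ fun h => hy (h23 h)
        by_cases hy : y ∈ B₃
        · have hx : x ∉ B₃ := fun h => hxy ⟨h, hy⟩
          rw [hη0 x hx, mul_zero, zero_sub, abs_neg]
          exact (hle y x hx).trans (le_add_of_nonneg_left (hD0 _))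
        · rw [hη0 y hy, mul_zero, sub_zero]
          exact (hle x y hy).trans (le_add_of_nonneg_right (hD0 _))
      -- Off B₃ × B₃ the left side vanishes, so monotonicity is not needed and absolute values
      -- suffice.
      have hIle : |I (x, y)| ≤ F (x, y) := by
        rw [hKI, abs_mul]
        exact mul_le_mul (abs_kernel_le hp (hZ₁ (x, y)) (hZ₀ (x, y)) (by positivity)
          (by positivity)) hφD (abs_nonneg _) (hK0 x y)
      rw [hG0]
      have := neg_le_of_abs_le hIle
      have h2 : (0 : ℝ) < 2 ^ (p - 1 + β) := by positivity
      exact mul_nonneg h2.le (by linarith)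
  have hmain := lintegral_le_of_le_add (by positivity) h_int hI0 hFm
    (fun z => mul_nonneg (hK0 _ _) (add_nonneg (hD0 _) (hD0 _)))
    (fun z => indicator_nonneg (fun z _ => by positivity) z) hpt
  have hG : ∫⁻ z, ENNReal.ofReal (G z) ∂(volume.prod volume) =
      dint (N + sp * p) (p - 1 + β) w B₁ := by
    unfold dint
    rw [← setLIntegral_prod_iterated (measurable_diff_kernel hw _ _), ← lintegral_indicator
      (hB₁.prod hB₁)]
    refine lintegral_congr fun z => ?_
    by_cases hz : z ∈ B₁ ×ˢ B₁
    · simp only [G, indicator_of_mem hz]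
    · simp only [G, indicator_of_notMem hz, ENNReal.ofReal_zero]
  have hFsymm : ∫⁻ z, ENNReal.ofReal (F z) ∂(volume.prod volume) =
      2 * ∫⁻ z, ENNReal.ofReal (K z.1 z.2 * D z) ∂(volume.prod volume) := by
    have h1 : ∀ z, ENNReal.ofReal (F z) = ENNReal.ofReal (K z.1 z.2 * D z) +
        ENNReal.ofReal (K z.swap.1 z.swap.2 * D z.swap) := by
      intro z
      rw [← ENNReal.ofReal_add (mul_nonneg (hK0 _ _) (hD0 _)) (mul_nonneg (hK0 _ _) (hD0 _))]
      congr 1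
      simp only [F, Prod.fst_swap, Prod.snd_swap]
      rw [show K z.2 z.1 = K z.1 z.2 from kerBound_comm ..]; ring
    simp_rw [h1]
    rw [lintegral_add_left (by fun_prop),
      lintegral_prod_swap (fun z : 𝔼 × 𝔼 => ENNReal.ofReal (K z.1 z.2 * D z)), two_mul]
  have hKD : ∫⁻ z, ENNReal.ofReal (K z.1 z.2 * D z) ∂(volume.prod volume) ≤
      (∫⁻ x in B₃, ∫⁻ y in B₃, ENNReal.ofReal (K x y * (|w x| ^ β * (‖x - y‖ / ρ)))) +
      ∫⁻ x in B₂, ∫⁻ y in B₃ᶜ, ENNReal.ofReal (K x y * |w x| ^ β) := by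
    have hm1 : Measurable fun z : 𝔼 × 𝔼 =>
      ENNReal.ofReal (K z.1 z.2 * (|w z.1| ^ β * (‖z.1 - z.2‖ / ρ))) := by fun_prop
    have hm2 : Measurable fun z : 𝔼 × 𝔼 =>
      ENNReal.ofReal (K z.1 z.2 * |w z.1| ^ β) := by fun_prop
    rw [← setLIntegral_prod_iterated hm1, ← setLIntegral_prod_iterated hm2,
      ← lintegral_indicator (hB₃.prod hB₃), ← lintegral_indicator (hB₂.prod hB₃.compl),
      ← lintegral_add_left (hm1.indicator (hB₃.prod hB₃))]
    refine lintegral_mono fun z => ?_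
    have h0 := hK0 z.1 z.2
    by_cases hz : z ∈ B₃ ×ˢ B₃
    · have hz' : z ∉ B₂ ×ˢ B₃ᶜ := fun h => h.2 hz.2
      simp only [D, indicator_of_mem hz, indicator_of_notMem hz', add_zero, le_refl]
    · by_cases hz' : z ∈ B₂ ×ˢ B₃ᶜ
      · simp only [D, indicator_of_mem hz', indicator_of_notMem hz, zero_add, mul_one, le_refl]
      · simp only [D, indicator_of_notMem hz', indicator_of_notMem hz, add_zero, mul_zero,
          ENNReal.ofReal_zero, le_refl]
  rw [hG, hFsymm] at hmain
  refine hmain.trans ?_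
  rw [mul_comm (2 : ℝ), ENNReal.ofReal_mul (by positivity), ENNReal.ofReal_ofNat, mul_assoc]
  gcongr

/-! ### Comparing a solution with its translate -/

theorem add_mem_ball_of_norm_le {x₀ x h : 𝔼} {r ρ R : ℝ} (hx : x ∈ ball x₀ r) (hh : ‖h‖ ≤ ρ)
    (hR : r + ρ ≤ R) : x + h ∈ ball x₀ R := by
  rw [mem_ball, dist_eq_norm] at *
  calc ‖x + h - x₀‖ = ‖(x - x₀) + h‖ := by congr 1; abel
    _ ≤ _ := norm_add_le _ _
    _ < _ := by linarith

theorem abs_le_one_of_mem_sgnSet {z t : ℝ} (h : z ∈ sgnSet t) : |z| ≤ 1 := abs_le.2 h.1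

theorem lintegral_tail_translate_le {u : 𝔼 → ℝ} {x₀ : 𝔼} {p e r ρ T : ℝ} {h x : 𝔼}
    (hx : x ∈ ball x₀ r)
    (hT : ∫⁻ y in {y | ρ ≤ ‖x + h - y‖}, ENNReal.ofReal
      (|u (x + h) - u y| ^ (p - 1) / ‖x + h - y‖ ^ e) ≤ ENNReal.ofReal T) :
    ∫⁻ y in (ball x₀ (r + ρ))ᶜ, ENNReal.ofReal
      (|u (x + h) - u (y + h)| ^ (p - 1) / ‖x - y‖ ^ e) ≤ ENNReal.ofReal T := by
  refine le_trans ?_ hT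
  have h1 := lintegral_comp_add_le (fun y => ENNReal.ofReal
    (|u (x + h) - u y| ^ (p - 1) / ‖x + h - y‖ ^ e)) h (A := (ball x₀ (r + ρ))ᶜ)
    (B := {y | ρ ≤ ‖x + h - y‖}) measurableSet_ball.compl
    (measurableSet_le (by fun_prop) (by fun_prop)) (fun y hy => by
      simp only [mem_ofPred_eq, add_sub_add_right_eq_sub]
      exact norm_ge_of_mem_ball hx hy)
  simpa only [add_sub_add_right_eq_sub] using h1

/-- Supplies what the abstract difference estimate assumes: the truncated power of w is an
admissible test function because w is bounded near its support, and all four integrals converge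
absolutely. -/
theorem LocalSolution.dint_translate_sub_le (hN : 1 ≤ N) {p s₁ sp β r ρ R M : ℝ} {x₀ h : 𝔼}
    {u : 𝔼 → ℝ} (hp : 2 ≤ p) (hs₁ : 0 < s₁) (hs₁' : s₁ < 1) (hsp : 0 < sp) (hsp' : sp < 1)
    (hβ : 1 ≤ β) (hu : LocalSolution p s₁ sp u x₀ R M) (hR : R ≤ 1) (hr : 0 ≤ r) (hρ : 0 < ρ)
    (hrR : r + 8 * ρ ≤ R) (hh : ‖h‖ ≤ ρ) :
    dint (N + sp * p) (p - 1 + β) (fun x => u (x + h) - u x) (ball x₀ (r + ρ)) ≤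
      ENNReal.ofReal (2 * 2 ^ (p - 1 + β)) *
      ((∫⁻ x in ball x₀ (r + 2 * ρ + ρ), ∫⁻ y in ball x₀ (r + 2 * ρ + ρ), ENNReal.ofReal
        (kerBound p s₁ sp (fun x => u (x + h)) u x y *
          (|u (x + h) - u x| ^ β * (‖x - y‖ / ρ)))) +
      ∫⁻ x in ball x₀ (r + 2 * ρ), ∫⁻ y in (ball x₀ (r + 2 * ρ + ρ))ᶜ, ENNReal.ofReal
        (kerBound p s₁ sp (fun x => u (x + h)) u x y * |u (x + h) - u x| ^ β)) := by
  obtain ⟨Z, hZm, hZ, heq⟩ := hu.exists_sign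
  have hum := hu.measurable
  have hM : 0 < M := by linarith [hu.one_le]
  set v : 𝔼 → ℝ := fun x => u (x + h) with hv
  have hvm : Measurable v := by fun_prop
  set η := cutoff x₀ r ρ
  have hηm : Measurable η := measurable_cutoff x₀ r ρ
  set φ : 𝔼 → ℝ := fun x => spow (β - 1) (v x - u x) * η x with hφ
  have hsm := measurable_spow (β - 1)
  have hφm : Measurable φ := by fun_prop
  have hw : ∀ x ∈ ball x₀ (r + 2 * ρ + ρ), |v x - u x| ≤ 2 * M := by
    intro x hx
    have h1 := hu.bound x (ball_subset_ball (by linarith) hx)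
    have h2 := hu.bound (x + h) (add_mem_ball_of_norm_le hx hh (by linarith))
    have := abs_sub (v x) (u x)
    simp only [hv] at *
    linarith
  have hspow : ∀ x ∈ ball x₀ (r + 2 * ρ + ρ), |spow (β - 1) (v x - u x)| ≤ (2 * M) ^ β := by
    intro x hx
    rw [abs_spow (by linarith), sub_add_cancel]
    exact Real.rpow_le_rpow (abs_nonneg _) (hw x hx) (by linarith)
  have hsupp : ∀ x ∉ ball x₀ (r + 2 * ρ), φ x = 0 := by
    intro x hx
    simp only [hφ, η, cutoff_eq_zero hρ hx, mul_zero]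
  have hbd : ∀ x, |φ x| ≤ (2 * M) ^ β := by
    intro x
    by_cases hx : x ∈ ball x₀ (r + 2 * ρ)
    · simp only [hφ]
      rw [abs_mul, abs_of_nonneg (cutoff_nonneg x₀ r ρ x)]
      exact (mul_le_of_le_one_right (abs_nonneg _) (cutoff_le_one x₀ r ρ x)).trans
        (hspow x (ball_subset_ball (by linarith) hx))
    · rw [hsupp x hx, abs_zero]; positivity
  set L' : ℝ := (β - 1 + 1) * (2 * (2 * M)) ^ (β - 1) + (2 * M) ^ β / ρ
  have hL' : 0 ≤ L' := by
    have : 0 ≤ β - 1 := by linarith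
    positivity
  have hdiff : ∀ x ∈ ball x₀ (r + 2 * ρ + ρ), ∀ y ∈ ball x₀ (r + 2 * ρ + ρ),
      |φ x - φ y| ≤ L' * (|u x - u y| + |v x - v y| + ‖x - y‖) := by
    intro x hx y hy
    have h1 := abs_spow_sub_le (e := β - 1) (by linarith) (hw x hx) (hw y hy)
    have h2 := abs_cutoff_sub_le x₀ r hρ x y
    have h3 : |(v x - u x) - (v y - u y)| ≤ |u x - u y| + |v x - v y| := by
      rw [show (v x - u x) - (v y - u y) = (v x - v y) - (u x - u y) by ring, add_comm]
      exact abs_sub _ _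
    have h4 : φ x - φ y = (spow (β - 1) (v x - u x) - spow (β - 1) (v y - u y)) * η x +
        spow (β - 1) (v y - u y) * (η x - η y) := by simp only [hφ]; ring
    have hβ0 : 0 ≤ β - 1 := by linarith
    rw [h4]
    calc _ ≤ |spow (β - 1) (v x - u x) - spow (β - 1) (v y - u y)| * |η x| +
          |spow (β - 1) (v y - u y)| * |η x - η y| := by
          rw [← abs_mul, ← abs_mul]; exact abs_add_le _ _
      _ ≤ ((β - 1 + 1) * (2 * (2 * M)) ^ (β - 1) * (|u x - u y| + |v x - v y|)) * 1 +
          (2 * M) ^ β * (‖x - y‖ / ρ) := by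
          gcongr
          · exact h1.trans (by gcongr)
          · rw [abs_of_nonneg (cutoff_nonneg x₀ r ρ x)]; exact cutoff_le_one x₀ r ρ x
          · exact hspow y hy
      _ = (β - 1 + 1) * (2 * (2 * M)) ^ (β - 1) * (|u x - u y| + |v x - v y| + 0) +
          (2 * M) ^ β / ρ * (0 + ‖x - y‖) := by ring
      _ ≤ (β - 1 + 1) * (2 * (2 * M)) ^ (β - 1) * (|u x - u y| + |v x - v y| + ‖x - y‖) +
          (2 * M) ^ β / ρ * ((|u x - u y| + |v x - v y|) + ‖x - y‖) := by
          gcongr <;> positivity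
      _ = _ := by simp only [L']; ring
  have hsub : ball x₀ (r + 2 * ρ + ρ) ⊆ ball x₀ R := ball_subset_ball (by linarith)
  have htr : ∀ e q : ℝ, dint e q v (ball x₀ (r + 2 * ρ + ρ)) ≤ dint e q u (ball x₀ R) :=
    fun e q => dint_translate_le e q u h measurableSet_ball measurableSet_ball
      (fun x hx => add_mem_ball_of_norm_le hx hh (by linarith))
  have hφ1 : MemW s₁ 1 φ univ :=
    memW_of_abs_sub_le hN hs₁ hs₁' le_rfl hρ (by linarith) (by linarith) hL' hφm hum hvm hbd hsupp
      hdiff ((dint_mono_set _ _ _ hsub).trans_lt hu.dint_one) ((htr _ _).trans_lt hu.dint_one)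
  have hdp : dint (N + sp * p) p u (ball x₀ R) < ∞ := hu.dint_le.trans_lt ENNReal.ofReal_lt_top
  have hφp : MemW sp p φ univ :=
    memW_of_abs_sub_le hN hsp hsp' (by linarith) hρ (by linarith) (by linarith) hL' hφm hum hvm
      hbd hsupp hdiff ((dint_mono_set _ _ _ hsub).trans_lt hdp) ((htr _ _).trans_lt hdp)
  obtain ⟨C, κ, hC, hκ, htail⟩ := exists_lintegral_tail_le (N := N) (s₁ := s₁) hp hsp
  set Z₁ : 𝔼 × 𝔼 → ℝ := fun z => Z (z.1 + h, z.2 + h)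
  have hZ₁m : Measurable Z₁ := by fun_prop
  have hZ₁ : ∀ z, Z₁ z ∈ sgnSet (v z.1 - v z.2) := fun z => hZ (z.1 + h, z.2 + h)
  have hcs := hasCompactSupport_of_ball (R := R) (by linarith) hsupp
  have heq₀ := heq φ hφ1 hφp hcs.1 hcs.2
  have hsupp' : ∀ x ∉ ball x₀ (r + 2 * ρ + ρ), φ (x - h) = 0 := fun x hx =>
    hsupp _ fun h' => hx (by simpa using add_mem_ball_of_norm_le h' hh le_rfl)
  have hcs' := hasCompactSupport_of_ball (R := R) (by linarith) hsupp'
  -- Testing with the shifted function and then translating both variables by h yields the equation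
  -- of v tested with φ, with sign selection Z₁.
  have heq₁ := heq (fun x => φ (x - h)) (memW_comp_sub one_pos h hφ1)
    (memW_comp_sub (by linarith) h hφp) hcs'.1 hcs'.2
  have t₁ : ∫ z : 𝔼 × 𝔼, Z z * (φ (z.1 - h) - φ (z.2 - h)) / ‖z.1 - z.2‖ ^ ((N : ℝ) + s₁)
      ∂(volume.prod volume) = ∫ z : 𝔼 × 𝔼, Z₁ z * (φ z.1 - φ z.2) / ‖z.1 - z.2‖ ^ ((N : ℝ) + s₁)
      ∂(volume.prod volume) := by
    rw [← integral_add_right_eq_self (μ := (volume : Measure 𝔼).prod volume) _ (h, h)]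
    simp only [Prod.fst_add, Prod.snd_add, add_sub_cancel_right, add_sub_add_right_eq_sub]
    rfl
  have t₂ : ∫ z : 𝔼 × 𝔼, spow (p - 2) (u z.1 - u z.2) * (φ (z.1 - h) - φ (z.2 - h)) /
      ‖z.1 - z.2‖ ^ ((N : ℝ) + sp * p) ∂(volume.prod volume) =
      ∫ z : 𝔼 × 𝔼, spow (p - 2) (v z.1 - v z.2) * (φ z.1 - φ z.2) /
      ‖z.1 - z.2‖ ^ ((N : ℝ) + sp * p) ∂(volume.prod volume) := by
    rw [← integral_add_right_eq_self (μ := (volume : Measure 𝔼).prod volume) _ (h, h)]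
    simp only [Prod.fst_add, Prod.snd_add, add_sub_cancel_right, add_sub_add_right_eq_sub]
    rfl
  rw [t₁, t₂] at heq₁
  have i₁ : Integrable (fun z : 𝔼 × 𝔼 => Z₁ z * (φ z.1 - φ z.2) / ‖z.1 - z.2‖ ^ ((N : ℝ) + s₁))
      (volume.prod volume) :=
    integrable_sign_part hφm hφ1 hZ₁m fun z => abs_le_one_of_mem_sgnSet (hZ₁ z)
  have i₀ : Integrable (fun z : 𝔼 × 𝔼 => Z z * (φ z.1 - φ z.2) / ‖z.1 - z.2‖ ^ ((N : ℝ) + s₁))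
      (volume.prod volume) :=
    integrable_sign_part hφm hφ1 hZm fun z => abs_le_one_of_mem_sgnSet (hZ z)
  have j₁ := integrable_power_part hp hρ hφm hvm hφp hbd hsupp ((htr _ _).trans_lt hdp)
    (T := C * M ^ (p - 1) * ρ ^ (-κ)) (fun x hx => lintegral_tail_translate_le hx
      (htail u x₀ R M hu hR ρ (x + h) hρ (add_mem_ball_of_norm_le hx hh (by linarith))))
  have j₀ := integrable_power_part hp hρ hφm hum hφp hbd hsupp
    ((dint_mono_set _ _ _ hsub).trans_lt hdp)
    (T := C * M ^ (p - 1) * ρ ^ (-κ)) (fun x hx => (lintegral_mono_set fun y hy =>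
      norm_ge_of_mem_ball hx hy).trans (htail u x₀ R M hu hR ρ x hρ
        (ball_subset_ball (by linarith) hx)))
  refine dint_le_of_difference_eq (φ := fun z => φ z.1 - φ z.2) hp hβ hρ hvm hum hZ₁ hZ
    (fun z => rfl) (fun z => rfl) ((i₁.add j₁).sub (i₀.add j₀)) ?_
  have e₁ := integral_add i₁ j₁
  have e₀ := integral_add i₀ j₀
  have e := integral_sub (i₁.add j₁) (i₀.add j₀)
  simp only [Pi.add_apply] at e
  rw [e, e₁, e₀, heq₀, heq₁, sub_zero]

theorem lintegral_lintegral_add {f g : 𝔼 → 𝔼 → ℝ≥0∞} (hf : Measurable (Function.uncurry f))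
    (A B : Set 𝔼) : ∫⁻ x in A, ∫⁻ y in B, (f x y + g x y) =
      (∫⁻ x in A, ∫⁻ y in B, f x y) + ∫⁻ x in A, ∫⁻ y in B, g x y := by
  have hm : Measurable fun x => ∫⁻ y in B, f x y := hf.lintegral_prod_right'
  rw [← lintegral_add_left hm]
  refine lintegral_congr fun x => ?_
  have hx : Measurable fun y => f x y := hf.comp measurable_prodMk_left
  rw [lintegral_add_left hx]

theorem rpow_neg_le_rpow_neg {ρ a b : ℝ} (hρ : 0 < ρ) (hρ1 : ρ ≤ 1) (hab : a ≤ b) :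
    ρ ^ (-a) ≤ ρ ^ (-b) :=
  Real.rpow_le_rpow_of_exponent_ge hρ hρ1 (by linarith)

theorem one_le_rpow_neg {ρ a : ℝ} (hρ : 0 < ρ) (hρ1 : ρ ≤ 1) (ha : 0 ≤ a) :
    1 ≤ ρ ^ (-a) :=
  Real.one_le_rpow_of_pos_of_le_one_of_nonpos hρ hρ1 (by linarith)

/-- The Caccioppoli type estimate for the differences of a solution. -/
theorem exists_energy_le (hN : 1 ≤ N) {p s₁ sp β γ : ℝ} (hp : 2 ≤ p) (hs₁ : 0 < s₁)
    (hs₁' : s₁ < 1) (hsp : 0 < sp) (hsp' : sp < 1) (hβ : 1 ≤ β)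
    (hγ : 0 < 1 - sp * p + γ * (p - 1)) :
    ∃ C κ : ℝ, 0 < C ∧ 0 < κ ∧ ∀ (u : 𝔼 → ℝ) (x₀ : 𝔼) (R M : ℝ),
      LocalSolution p s₁ sp u x₀ R M → R ≤ 1 → ∀ (r ρ : ℝ) (h : 𝔼), 0 ≤ r → 0 < ρ →
      r + 8 * ρ ≤ R → ‖h‖ ≤ ρ →
      dint (N + sp * p) (p - 1 + β) (fun x => u (x + h) - u x) (ball x₀ (r + ρ)) ≤
        ENNReal.ofReal (C * ρ ^ (-κ)) * (ENNReal.ofReal (M ^ (p - 1)) +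
          dint (N + γ * (p - 1 + β)) (p - 1 + β) u (ball x₀ (r + 4 * ρ)) ^
            ((p - 1) / (p - 1 + β))) *
          (∫⁻ x in ball x₀ (r + 3 * ρ), ENNReal.ofReal (|u (x + h) - u x| ^ (p - 1 + β))) ^
            (β / (p - 1 + β)) := by
  have hp1 : 0 < p - 1 := by linarith
  have hβ0 : 0 < β := by linarith
  obtain ⟨C₁, hC₁, hnear⟩ := exists_lintegral_near_le (N := N) (β := β) hN hs₁'
  obtain ⟨C₂, hC₂, hvol⟩ := exists_lintegral_rpow_le_of_volume (N := N) (q := p - 1 + β) hβ0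
    (by linarith)
  obtain ⟨C₃, hC₃, hhol⟩ := exists_lintegral_holder_le (N := N) hN hp1 hβ0 hγ
  obtain ⟨C₄, hC₄, hfar⟩ := exists_lintegral_far_le (N := N) hs₁
  obtain ⟨C₅, κ₅, hC₅, hκ₅, htail⟩ := exists_lintegral_tail_le (N := N) (s₁ := s₁) hp hsp
  set q := p - 1 + β
  -- One power for the slope 1/ρ of the cutoff, N + s₁ for the far part of the 1-Laplacian, κ₅ for
  -- the tail.
  set κ : ℝ := 1 + (N + s₁) + κ₅
  set A : ℝ := 2 * C₁ * C₂ + 2 * C₃ + (2 * C₄ + 2 * C₅) * C₂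
  refine ⟨2 * 2 ^ q * A, κ, by positivity, by positivity,
    fun u x₀ R M hu hR r ρ h hr hρ hrR hh => ?_⟩
  have hρ1 : ρ ≤ 1 := by linarith
  have hM1 := hu.one_le
  have hM : 0 < M := by linarith
  have hMp : 1 ≤ M ^ (p - 1) := Real.one_le_rpow hM1 hp1.le
  have hum := hu.measurable
  refine (hu.dint_translate_sub_le hN hp hs₁ hs₁' hsp hsp' hβ hR hr hρ hrR hh).trans ?_
  have h3 : r + 3 * ρ = r + 2 * ρ + ρ := by ring
  rw [h3]
  set v : 𝔼 → ℝ := fun x => u (x + h)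
  have hvm : Measurable v := by fun_prop
  set w : 𝔼 → ℝ := fun x => u (x + h) - u x
  have hwm : Measurable w := by fun_prop
  set B₂ := ball x₀ (r + 2 * ρ)
  set B₃ := ball x₀ (r + 2 * ρ + ρ)
  set V := (∫⁻ x in B₃, ENNReal.ofReal (|w x| ^ q)) ^ (β / q)
  set X := ENNReal.ofReal (M ^ (p - 1))
  set Y := dint (N + γ * q) q u (ball x₀ (r + 4 * ρ)) ^ ((p - 1) / q)
  set e : ℝ := N + sp * p
  have hX1 : 1 ≤ X := ENNReal.one_le_ofReal.2 hMp
  have hV : ∫⁻ x in B₃, ENNReal.ofReal (|w x| ^ β) ≤ ENNReal.ofReal C₂ * V :=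
    hvol w hwm x₀ _ (by linarith)
  have hρκ : 0 < ρ ^ (-κ) := by positivity
  have hhol' : ∀ v' : 𝔼 → ℝ, Measurable v' →
      dint (N + γ * q) q v' B₃ ≤ dint (N + γ * q) q u (ball x₀ (r + 4 * ρ)) →
      ∫⁻ x in B₃, ∫⁻ y in B₃, ENNReal.ofReal
        (|w x| ^ β * (‖x - y‖ * (|v' x - v' y| ^ (p - 1) / ‖x - y‖ ^ e))) ≤
        ENNReal.ofReal C₃ * V * Y := by
    intro v' hv' hle
    refine (hhol w v' hwm hv' x₀ _ (by linarith)).trans ?_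
    gcongr
    exact ENNReal.rpow_le_rpow hle (by positivity)
  have hnear' : ∫⁻ x in B₃, ∫⁻ y in B₃, ENNReal.ofReal
      (kerBound p s₁ sp v u x y * (|w x| ^ β * (‖x - y‖ / ρ))) ≤
      ENNReal.ofReal ((2 * C₁ * C₂ + 2 * C₃) * ρ ^ (-κ)) * (X + Y) * V := by
    -- Three errors: the 1-Laplacian kernel, for which w alone matters, and one Hölder term each for
    -- v and u.
    have hpt : ∀ x y : 𝔼, ENNReal.ofReal
        (kerBound p s₁ sp v u x y * (|w x| ^ β * (‖x - y‖ / ρ))) =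
        ENNReal.ofReal (2 / ρ) * ENNReal.ofReal (|w x| ^ β * (‖x - y‖ / ‖x - y‖ ^ (N + s₁))) +
        (ENNReal.ofReal (1 / ρ) * ENNReal.ofReal
          (|w x| ^ β * (‖x - y‖ * (|v x - v y| ^ (p - 1) / ‖x - y‖ ^ e))) +
        ENNReal.ofReal (1 / ρ) * ENNReal.ofReal
          (|w x| ^ β * (‖x - y‖ * (|u x - u y| ^ (p - 1) / ‖x - y‖ ^ e)))) := by
      intro x y
      rw [← ENNReal.ofReal_mul (by positivity), ← ENNReal.ofReal_mul (by positivity),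
        ← ENNReal.ofReal_mul (by positivity), ← ENNReal.ofReal_add (by positivity) (by positivity),
        ← ENNReal.ofReal_add (by positivity) (by positivity)]
      congr 1
      simp only [kerBound, e]; ring
    simp_rw [hpt]
    rw [lintegral_lintegral_add (by simp only [Function.uncurry_def]; fun_prop),
      lintegral_lintegral_add (by simp only [Function.uncurry_def]; fun_prop)]
    simp_rw [lintegral_const_mul' _ _ ENNReal.ofReal_ne_top]
    have h1 : 1 / ρ ≤ ρ ^ (-κ) := by
      rw [one_div, ← Real.rpow_neg_one]
      exact rpow_neg_le_rpow_neg hρ hρ1 (by simp only [κ]; linarith [Nat.cast_nonneg (α := ℝ) N])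
    calc _ ≤ ENNReal.ofReal (2 / ρ) * (ENNReal.ofReal C₁ * (ENNReal.ofReal C₂ * V)) +
          (ENNReal.ofReal (1 / ρ) * (ENNReal.ofReal C₃ * V * Y) +
            ENNReal.ofReal (1 / ρ) * (ENNReal.ofReal C₃ * V * Y)) := by
          gcongr
          · exact (hnear w x₀ _ (by linarith)).trans (by gcongr)
          · exact hhol' v hvm (dint_translate_le _ _ u h measurableSet_ball measurableSet_ball
              (fun x hx => add_mem_ball_of_norm_le hx hh (by linarith)))
          · exact hhol' u hum (dint_mono_set _ _ _ (ball_subset_ball (by linarith)))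
      _ = (ENNReal.ofReal (2 / ρ * C₁ * C₂) * 1 + ENNReal.ofReal (2 * C₃ * (1 / ρ)) * Y) * V := by
          rw [ENNReal.ofReal_mul (by positivity), ENNReal.ofReal_mul (by positivity),
            ENNReal.ofReal_mul (p := 2 * C₃) (by positivity), ENNReal.ofReal_mul (p := 2)
            (by positivity), ENNReal.ofReal_ofNat]
          ring
      _ ≤ (ENNReal.ofReal ((2 * C₁ * C₂ + 2 * C₃) * ρ ^ (-κ)) * X +
          ENNReal.ofReal ((2 * C₁ * C₂ + 2 * C₃) * ρ ^ (-κ)) * Y) * V := by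
          have ha : 2 / ρ * C₁ * C₂ ≤ (2 * C₁ * C₂ + 2 * C₃) * ρ ^ (-κ) := by
            calc 2 / ρ * C₁ * C₂ = (2 * C₁ * C₂) * (1 / ρ) := by ring
              _ ≤ _ := by gcongr; linarith
          have hb : 2 * C₃ * (1 / ρ) ≤ (2 * C₁ * C₂ + 2 * C₃) * ρ ^ (-κ) := by
            gcongr; linarith [show 0 < 2 * C₁ * C₂ by positivity]
          exact mul_le_mul' (add_le_add (mul_le_mul' (ENNReal.ofReal_le_ofReal ha) hX1)
            (mul_le_mul' (ENNReal.ofReal_le_ofReal hb) le_rfl)) le_rfl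
      _ = _ := by ring
  have hfar' : ∫⁻ x in B₂, ∫⁻ y in B₃ᶜ, ENNReal.ofReal (kerBound p s₁ sp v u x y * |w x| ^ β) ≤
      ENNReal.ofReal ((2 * C₄ + 2 * C₅) * C₂ * ρ ^ (-κ)) * (X + Y) * V := by
    set T : ℝ := C₅ * M ^ (p - 1) * ρ ^ (-κ₅)
    have hin : ∀ x ∈ B₂, ∫⁻ y in B₃ᶜ, ENNReal.ofReal (kerBound p s₁ sp v u x y * |w x| ^ β) ≤
        ENNReal.ofReal (|w x| ^ β) *
          (ENNReal.ofReal 2 * ENNReal.ofReal (C₄ * ρ ^ (-(N + s₁))) +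
            (ENNReal.ofReal T + ENNReal.ofReal T)) := by
      intro x hx
      have hpt : ∀ y : 𝔼, ENNReal.ofReal (kerBound p s₁ sp v u x y * |w x| ^ β) =
          ENNReal.ofReal (|w x| ^ β) * (ENNReal.ofReal 2 *
            ENNReal.ofReal (1 / ‖x - y‖ ^ (N + s₁)) +
            (ENNReal.ofReal (|v x - v y| ^ (p - 1) / ‖x - y‖ ^ e) +
              ENNReal.ofReal (|u x - u y| ^ (p - 1) / ‖x - y‖ ^ e))) := by
        intro y
        rw [← ENNReal.ofReal_mul (by positivity), ← ENNReal.ofReal_add (by positivity)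
          (by positivity), ← ENNReal.ofReal_add (by positivity) (by positivity),
          ← ENNReal.ofReal_mul (by positivity)]
        congr 1
        simp only [kerBound, e]; ring
      simp_rw [hpt]
      rw [lintegral_const_mul' _ _ ENNReal.ofReal_ne_top, lintegral_add_left (by fun_prop),
        lintegral_add_left (by fun_prop), lintegral_const_mul' _ _ ENNReal.ofReal_ne_top]
      have hsub : B₃ᶜ ⊆ {y | ρ ≤ ‖x - y‖} := fun y hy => norm_ge_of_mem_ball hx hy
      gcongr
      · exact (lintegral_mono_set hsub).trans (hfar ρ x hρ hρ1)
      · exact lintegral_tail_translate_le hx (htail u x₀ R M hu hR ρ (x + h) hρ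
          (add_mem_ball_of_norm_le hx hh (by linarith)))
      · exact (lintegral_mono_set hsub).trans (htail u x₀ R M hu hR ρ x hρ
          (ball_subset_ball (by linarith) hx))
    refine (setLIntegral_mono' measurableSet_ball hin).trans ?_
    rw [← ENNReal.ofReal_add (by positivity) (by positivity),
      ← ENNReal.ofReal_mul (by norm_num), ← ENNReal.ofReal_add (by positivity) (by positivity),
      lintegral_mul_const' _ _ ENNReal.ofReal_ne_top]
    have h1 : ρ ^ (-(N + s₁)) ≤ ρ ^ (-κ) :=
      rpow_neg_le_rpow_neg hρ hρ1 (by simp only [κ]; linarith)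
    have h2 : ρ ^ (-κ₅) ≤ ρ ^ (-κ) :=
      rpow_neg_le_rpow_neg hρ hρ1
        (by simp only [κ]; linarith [Nat.cast_nonneg (α := ℝ) N])
    have h4 : 2 * (C₄ * ρ ^ (-(N + s₁))) + (T + T) ≤
        (2 * C₄ + 2 * C₅) * ρ ^ (-κ) * M ^ (p - 1) := by
      calc _ = 2 * C₄ * ρ ^ (-(N + s₁)) * 1 + 2 * C₅ * ρ ^ (-κ₅) * M ^ (p - 1) := by
            simp only [T]; ring
        _ ≤ 2 * C₄ * ρ ^ (-κ) * M ^ (p - 1) + 2 * C₅ * ρ ^ (-κ) * M ^ (p - 1) := by gcongr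
        _ = _ := by ring
    calc _ ≤ (ENNReal.ofReal C₂ * V) *
          ENNReal.ofReal ((2 * C₄ + 2 * C₅) * ρ ^ (-κ) * M ^ (p - 1)) := by
          gcongr
          exact (lintegral_mono_set (ball_subset_ball (by linarith))).trans hV
      _ = ENNReal.ofReal ((2 * C₄ + 2 * C₅) * C₂ * ρ ^ (-κ)) * X * V := by
          rw [ENNReal.ofReal_mul (q := M ^ (p - 1)) (by positivity),
            ENNReal.ofReal_mul (q := ρ ^ (-κ)) (by positivity),
            ENNReal.ofReal_mul (q := ρ ^ (-κ)) (by positivity),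
            ENNReal.ofReal_mul (q := C₂) (by positivity)]
          ring
      _ ≤ _ := by gcongr; exact le_self_add
  calc _ ≤ ENNReal.ofReal (2 * 2 ^ q) *
        (ENNReal.ofReal ((2 * C₁ * C₂ + 2 * C₃) * ρ ^ (-κ)) * (X + Y) * V +
          ENNReal.ofReal ((2 * C₄ + 2 * C₅) * C₂ * ρ ^ (-κ)) * (X + Y) * V) := by gcongr
    _ = _ := by
        rw [← add_mul, ← add_mul, ← ENNReal.ofReal_add (by positivity) (by positivity),
          ← mul_assoc, ← mul_assoc, ← ENNReal.ofReal_mul (by positivity)]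
        congr 3
        simp only [A]; ring

/-! ### Self-improvement of the interior estimate -/

/-- The interior estimate in `W^{γ,q}` for all local solutions. -/
def Regular (N : ℕ) (p s₁ sp γ q : ℝ) : Prop :=
  ∃ C κ : ℝ, 0 < C ∧ 0 < κ ∧ ∀ (u : EuclideanSpace ℝ (Fin N) → ℝ)
    (x₀ : EuclideanSpace ℝ (Fin N)) (R M : ℝ), LocalSolution p s₁ sp u x₀ R M → R ≤ 1 →
    ∀ r : ℝ, 0 ≤ r → r < R →
      dint (N + γ * q) q u (ball x₀ r) ≤ ENNReal.ofReal (C * M ^ q * (R - r) ^ (-κ))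

/-- The L^q norm of w gives ‖h‖^(γ β) in the energy estimate, and a second translation by h gives
‖h‖^(sp p). So u gains the differentiability α = (sp p + γ β)/q, up to an arbitrarily small loss in
returning to the fractional Sobolev scale. -/
theorem Regular.improve (hN : 1 ≤ N) {p s₁ sp β γ γ' : ℝ} (hp : 2 ≤ p) (hs₁ : 0 < s₁)
    (hs₁' : s₁ < 1) (hsp : 0 < sp) (hsp' : sp < 1) (hβ : 1 ≤ β) (hγ0 : 0 ≤ γ)
    (hγ : 0 < 1 - sp * p + γ * (p - 1)) (hγ'0 : 0 ≤ γ')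
    (hγ' : γ' * (p - 1 + β) < sp * p + γ * β) (hlt : sp * p + γ * β < p - 1 + β)
    (hreg : Regular N p s₁ sp γ (p - 1 + β)) : Regular N p s₁ sp γ' (p - 1 + β) := by
  have hp1 : 0 < p - 1 := by linarith
  have hβ0 : 0 < β := by linarith
  obtain ⟨C₀, κ₀, hC₀, hκ₀, h₀⟩ := hreg
  obtain ⟨C₁, κ₁, hC₁, hκ₁, henergy⟩ := exists_energy_le (N := N) hN hp hs₁ hs₁' hsp hsp' hβ hγ
  set q := p - 1 + β with hq
  have hq0 : 0 < q := by positivity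
  obtain ⟨C₂, hC₂, htr⟩ := exists_lintegral_translate_le (N := N) (e := N + γ * q) hq0
    (by positivity)
  obtain ⟨C₃, hC₃, htr'⟩ := exists_lintegral_translate_le (N := N) (e := N + sp * p) hq0
    (by positivity)
  set α : ℝ := (sp * p + γ * β) / q with hα
  have hα0 : 0 < α := by positivity
  have hαq : α * q = sp * p + γ * β := div_mul_cancel₀ _ hq0.ne'
  obtain ⟨C₄, hC₄, hsecond⟩ := exists_diff_le_of_second_diff (N := N) (q := q) (α := α)
    (by linarith) hα0.le (by rw [hα, div_lt_one hq0]; exact hlt)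
  obtain ⟨C₅, hC₅, hdint⟩ := exists_dint_le_of_diff (N := N) hN (q := q) (e := N + γ' * q)
    (b := α * q) hq0 (by positivity) (by rw [hαq]; linarith)
  obtain ⟨C₆, hC₆, hvol⟩ := exists_volume_ball_le (N := N)
  -- At least 1, so that M^q ≤ Λ and the term M^(p-1) of the energy estimate is absorbed by the
  -- power of Λ beside it.
  set C₀' := max C₀ 1
  have hC₀' : 0 < C₀' := lt_of_lt_of_le one_pos (le_max_right _ _)
  set κ₂ := κ₁ + κ₀
  set C₇ : ℝ := C₃ * (2 * C₁ * C₂ ^ (β / q) * C₀')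
  set κ : ℝ := κ₂ + α * q + (N + γ' * q)
  set C₈ : ℝ := C₅ * (C₄ ^ q * (2 ^ q * (C₇ + 2 ^ q * C₆)) + 1)
  refine ⟨C₈ * 8 ^ κ, κ, by positivity, by positivity,
    fun u x₀ R M hu hR r hr hrR => ?_⟩
  have hum := hu.measurable
  have hM1 := hu.one_le
  have hM : 0 < M := by linarith
  -- The energy estimate asks for r + 8ρ ≤ R.
  set ρ := (R - r) / 8 with hρdef
  have hρ : 0 < ρ := by simp only [hρdef]; linarith
  have h8 : R - r = 8 * ρ := by simp only [hρdef]; ring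
  have hρ1 : ρ ≤ 1 := by linarith
  set Λ : ℝ := C₀' * M ^ q * ρ ^ (-κ₀) with hΛdef
  have hΛ0 : 0 < Λ := by positivity
  have hΛ : dint (N + γ * q) q u (ball x₀ (r + 4 * ρ)) ≤ ENNReal.ofReal Λ := by
    refine (h₀ u x₀ R M hu hR (r + 4 * ρ) (by linarith) (by linarith)).trans ?_
    apply ENNReal.ofReal_le_ofReal
    simp only [Λ]
    have h1 : (R - (r + 4 * ρ)) ^ (-κ₀) ≤ ρ ^ (-κ₀) :=
      Real.rpow_le_rpow_of_nonpos hρ (by linarith) (by linarith)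
    have h2 : C₀ ≤ C₀' := le_max_left _ _
    have h3 : 0 ≤ (R - (r + 4 * ρ)) ^ (-κ₀) := Real.rpow_nonneg (by linarith) _
    gcongr
  have hMΛ : M ^ (p - 1) ≤ Λ ^ ((p - 1) / q) := by
    have h1 : M ^ q ≤ Λ := by
      simp only [Λ]
      have h2 : 1 ≤ C₀' := le_max_right _ _
      have h3 : 1 ≤ ρ ^ (-κ₀) := one_le_rpow_neg hρ hρ1 hκ₀.le
      have h4 : 0 < M ^ q := by positivity
      calc M ^ q = 1 * M ^ q * 1 := by ring
        _ ≤ _ := by gcongr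
    calc M ^ (p - 1) = (M ^ q) ^ ((p - 1) / q) := by
          rw [← Real.rpow_mul hM.le]; congr 1; field_simp
      _ ≤ _ := Real.rpow_le_rpow (by positivity) h1 (by positivity)
  have hfirst : ∀ h : 𝔼, ‖h‖ ≤ ρ →
      dint (N + sp * p) q (fun x => u (x + h) - u x) (ball x₀ (r + ρ)) ≤
        ENNReal.ofReal (2 * C₁ * C₂ ^ (β / q) * ρ ^ (-κ₁) * Λ * ‖h‖ ^ (γ * β)) := by
    intro h hh
    have hW : ∫⁻ x in ball x₀ (r + 3 * ρ), ENNReal.ofReal (|u (x + h) - u x| ^ q) ≤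
        ENNReal.ofReal (C₂ * ‖h‖ ^ (γ * q) * Λ) := by
      refine (htr u hum x₀ (r + 3 * ρ) ρ h hh).trans ?_
      rw [ENNReal.ofReal_mul (q := Λ) (by positivity), add_sub_cancel_left,
        show r + 3 * ρ + ρ = r + 4 * ρ by ring]
      gcongr
    refine (henergy u x₀ R M hu hR r ρ h hr hρ (by linarith) hh).trans ?_
    calc _ ≤ ENNReal.ofReal (C₁ * ρ ^ (-κ₁)) * (ENNReal.ofReal (Λ ^ ((p - 1) / q)) +
          ENNReal.ofReal Λ ^ ((p - 1) / q)) *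
          ENNReal.ofReal (C₂ * ‖h‖ ^ (γ * q) * Λ) ^ (β / q) := by gcongr
      _ = ENNReal.ofReal (C₁ * ρ ^ (-κ₁) * (Λ ^ ((p - 1) / q) + Λ ^ ((p - 1) / q)) *
          (C₂ * ‖h‖ ^ (γ * q) * Λ) ^ (β / q)) := by
          rw [ENNReal.ofReal_rpow_of_nonneg hΛ0.le (by positivity),
            ENNReal.ofReal_rpow_of_nonneg (by positivity) (by positivity),
            ← ENNReal.ofReal_add (by positivity) (by positivity),
            ← ENNReal.ofReal_mul (by positivity), ← ENNReal.ofReal_mul (by positivity)]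
      _ = _ := by
          congr 1
          rw [Real.mul_rpow (by positivity) hΛ0.le, Real.mul_rpow hC₂.le (by positivity),
            ← Real.rpow_mul (norm_nonneg h)]
          -- Homogeneity: the two Hölder exponents add to 1, so the bound is linear in Λ and hence
          -- of order M^q.
          have h1 : Λ ^ ((p - 1) / q) * Λ ^ (β / q) = Λ := by
            rw [← Real.rpow_add hΛ0, ← add_div, ← hq, div_self hq0.ne', Real.rpow_one]
          have h2 : γ * q * (β / q) = γ * β := by field_simp
          rw [h2]
          linear_combination (2 * C₁ * C₂ ^ (β / q) * ρ ^ (-κ₁) * ‖h‖ ^ (γ * β)) * h1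
  set Q : ℝ := C₇ * M ^ q * ρ ^ (-κ₂) with hQ
  have hQ0 : 0 < Q := by positivity
  have hsnd : ∀ h : 𝔼, ‖h‖ ≤ ρ → ∫⁻ x in ball x₀ r,
      ENNReal.ofReal (|(u (x + h + h) - u (x + h)) - (u (x + h) - u x)| ^ q) ≤
      ENNReal.ofReal ((Q ^ (1 / q) * ‖h‖ ^ α) ^ q) := by
    intro h hh
    -- The difference over h of w, with the same h, is the second difference of u.
    refine (htr' (fun x => u (x + h) - u x) (by fun_prop) x₀ r ρ h hh).trans ?_
    refine (mul_le_mul_right (hfirst h hh) _).trans (le_of_eq ?_)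
    rw [← ENNReal.ofReal_mul (by positivity), add_sub_cancel_left]
    congr 1
    rw [Real.mul_rpow (by positivity) (by positivity), ← Real.rpow_mul hQ0.le,
      ← Real.rpow_mul (norm_nonneg h), one_div_mul_cancel hq0.ne', Real.rpow_one, hαq,
      Real.rpow_add' (norm_nonneg h) (by positivity)]
    simp only [hQ, C₇, hΛdef, κ₂]
    rw [show -(κ₁ + κ₀) = -κ₁ + -κ₀ by ring, Real.rpow_add hρ]
    ring
  set L : ℝ := 2 * M * C₆ ^ (1 / q)
  have hLq : L ^ q = 2 ^ q * C₆ * M ^ q := by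
    simp only [L]
    rw [Real.mul_rpow (by positivity) (by positivity), Real.mul_rpow (by positivity) hM.le,
      ← Real.rpow_mul hC₆.le, one_div_mul_cancel hq0.ne', Real.rpow_one]
    ring
  have hbdd : ∀ h : 𝔼, ‖h‖ ≤ ρ → ∫⁻ x in ball x₀ r, ENNReal.ofReal (|u (x + h) - u x| ^ q) ≤
      ENNReal.ofReal (L ^ q) := by
    intro h hh
    calc _ ≤ ∫⁻ x in ball x₀ r, ENNReal.ofReal ((2 * M) ^ q) := by
          refine setLIntegral_mono' measurableSet_ball fun x hx => ENNReal.ofReal_le_ofReal ?_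
          apply Real.rpow_le_rpow (abs_nonneg _) _ hq0.le
          have h1 := hu.bound x (ball_subset_ball hrR.le hx)
          have h2 := hu.bound (x + h) (add_mem_ball_of_norm_le hx hh (by linarith))
          linarith [abs_sub (u (x + h)) (u x)]
      _ ≤ ENNReal.ofReal ((2 * M) ^ q) * ENNReal.ofReal C₆ := by
          rw [setLIntegral_const]
          gcongr
          exact hvol x₀ r (by linarith)
      _ = _ := by
          rw [← ENNReal.ofReal_mul (by positivity), hLq, Real.mul_rpow (by norm_num) hM.le]
          congr 1; ring
  have hfinal := hsecond u hum (ball x₀ r) ρ (Q ^ (1 / q)) L hρ (by positivity) (by positivity)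
    hbdd hsnd
  set S : ℝ := C₄ * (Q ^ (1 / q) + L * ρ ^ (-α))
  have hS0 : 0 ≤ S := by positivity
  have hmain := hdint u hum x₀ r ρ (S ^ q) M (by linarith) hρ hρ1 (by positivity) hM.le
    (fun x hx => hu.bound x (ball_subset_ball hrR.le hx)) (fun h hh => by
      have := hfinal h hh
      rwa [Real.mul_rpow hS0 (by positivity), ← Real.rpow_mul (norm_nonneg h)] at this)
  refine hmain.trans (ENNReal.ofReal_le_ofReal ?_)
  have k1 : ρ ^ (-κ₂) ≤ ρ ^ (-κ) := rpow_neg_le_rpow_neg hρ hρ1 (by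
    have : 0 ≤ α * q + (N + γ' * q) := by positivity
    simp only [κ]; linarith)
  have k2 : ρ ^ (-(α * q)) ≤ ρ ^ (-κ) := rpow_neg_le_rpow_neg hρ hρ1 (by
    have : 0 ≤ κ₂ + (N + γ' * q) := by positivity
    simp only [κ]; linarith)
  have k3 : ρ ^ (-(N + γ' * q)) ≤ ρ ^ (-κ) := rpow_neg_le_rpow_neg hρ hρ1 (by
    have : 0 ≤ κ₂ + α * q := by positivity
    simp only [κ]; linarith)
  have hSq : S ^ q ≤ C₄ ^ q * (2 ^ q * (C₇ + 2 ^ q * C₆)) * M ^ q * ρ ^ (-κ) := by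
    simp only [S]
    rw [Real.mul_rpow hC₄.le (by positivity)]
    have h1 := add_rpow_le_two_rpow (a := Q ^ (1 / q)) (b := L * ρ ^ (-α)) (m := q) (by positivity)
      (by positivity) hq0.le
    rw [← Real.rpow_mul hQ0.le, one_div_mul_cancel hq0.ne', Real.rpow_one,
      Real.mul_rpow (x := L) (by positivity) (by positivity), hLq, ← Real.rpow_mul hρ.le, neg_mul] at h1
    calc _ ≤ C₄ ^ q * (2 ^ q * (C₇ * M ^ q * ρ ^ (-κ₂) +
          2 ^ q * C₆ * M ^ q * ρ ^ (-(α * q)))) := by gcongr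
      _ ≤ C₄ ^ q * (2 ^ q * (C₇ * M ^ q * ρ ^ (-κ) + 2 ^ q * C₆ * M ^ q * ρ ^ (-κ))) := by
          gcongr
      _ = _ := by ring
  rw [h8, Real.mul_rpow (by norm_num) hρ.le, Real.rpow_neg (by norm_num : (0 : ℝ) ≤ 8)]
  calc _ ≤ C₅ * (C₄ ^ q * (2 ^ q * (C₇ + 2 ^ q * C₆)) * M ^ q * ρ ^ (-κ) + M ^ q * ρ ^ (-κ)) := by
        gcongr
    _ = C₈ * M ^ q * ρ ^ (-κ) := by simp only [C₈]; ring
    _ = _ := by field_simp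

/-! ### Iteration of the regularity estimate -/

theorem regular_base {p s₁ sp : ℝ} : Regular N p s₁ sp sp p := by
  refine ⟨1, 1, one_pos, one_pos, fun u x₀ R M hu hR r hr hrR => ?_⟩
  refine (dint_mono_set _ _ _ (ball_subset_ball hrR.le)).trans (hu.dint_le.trans ?_)
  apply ENNReal.ofReal_le_ofReal
  rw [one_mul]
  have hM := hu.one_le
  exact le_mul_of_one_le_right (by positivity)
    (one_le_rpow_neg (by linarith) (by linarith) zero_le_one)

/-- Interpolation with the supremum norm. -/
theorem Regular.raise {p s₁ sp γ q q' : ℝ} (hq : 0 < q) (hqq' : q ≤ q')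
    (h : Regular N p s₁ sp γ q) : Regular N p s₁ sp (γ * (q / q')) q' := by
  obtain ⟨C, κ, hC, hκ, h⟩ := h
  have hq' : 0 < q' := hq.trans_le hqq'
  refine ⟨2 ^ (q' - q) * C, κ, by positivity, hκ, fun u x₀ R M hu hR r hr hrR => ?_⟩
  have hM : 0 < M := by linarith [hu.one_le]
  have he : γ * (q / q') * q' = γ * q := by field_simp
  rw [he]
  have hpt : ∀ x ∈ ball x₀ r, ∀ y ∈ ball x₀ r,
      ENNReal.ofReal (|u x - u y| ^ q' / ‖x - y‖ ^ (N + γ * q)) ≤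
        ENNReal.ofReal ((2 * M) ^ (q' - q)) *
          ENNReal.ofReal (|u x - u y| ^ q / ‖x - y‖ ^ (N + γ * q)) := by
    intro x hx y hy
    rw [← ENNReal.ofReal_mul (by positivity), ← mul_div_assoc]
    apply ENNReal.ofReal_le_ofReal
    gcongr
    have h1 : |u x - u y| ≤ 2 * M := by
      have h2 := hu.bound x (ball_subset_ball hrR.le hx)
      have h3 := hu.bound y (ball_subset_ball hrR.le hy)
      linarith [abs_sub (u x) (u y)]
    calc |u x - u y| ^ q' = |u x - u y| ^ (q' - q) * |u x - u y| ^ q := by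
          rw [← Real.rpow_add' (abs_nonneg _) (by linarith), sub_add_cancel]
      _ ≤ _ := by
          gcongr
  calc dint (N + γ * q) q' u (ball x₀ r) ≤ ENNReal.ofReal ((2 * M) ^ (q' - q)) *
        dint (N + γ * q) q u (ball x₀ r) := by
        unfold dint
        rw [← lintegral_const_mul' _ _ ENNReal.ofReal_ne_top]
        refine setLIntegral_mono' measurableSet_ball fun x hx => ?_
        rw [← lintegral_const_mul' _ _ ENNReal.ofReal_ne_top]
        exact setLIntegral_mono' measurableSet_ball (hpt x hx)
    _ ≤ ENNReal.ofReal ((2 * M) ^ (q' - q)) *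
          ENNReal.ofReal (C * M ^ q * (R - r) ^ (-κ)) := by
        gcongr
        exact h u x₀ R M hu hR r hr hrR
    _ = _ := by
        rw [← ENNReal.ofReal_mul (by positivity)]
        congr 1
        have : M ^ q' = M ^ (q' - q) * M ^ q := by rw [← Real.rpow_add hM, sub_add_cancel]
        rw [this, Real.mul_rpow (by norm_num) hM.le]
        ring

/-- Below σ each exponent improves strictly, so a supremum of attained exponents smaller than σ is
contradictory. Arguing with the supremum avoids counting steps and tracking the small losses. -/
theorem Regular.all_lt (hN : 1 ≤ N) {p s₁ sp q γ₀ : ℝ} (hp : 2 ≤ p) (hs₁ : 0 < s₁)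
    (hs₁' : s₁ < 1) (hsp : 0 < sp) (hsp' : sp * p ≤ p - 1) (hq : p ≤ q) (hγ₀ : 0 ≤ γ₀)
    (hγ₀' : γ₀ < sp * p / (p - 1)) (hγ : 0 < 1 - sp * p + γ₀ * (p - 1))
    (hreg : Regular N p s₁ sp γ₀ q) {γ : ℝ} (hγ0 : 0 ≤ γ) (hγσ : γ < sp * p / (p - 1)) :
    Regular N p s₁ sp γ q := by
  have hp1 : 0 < p - 1 := by linarith
  set σ := sp * p / (p - 1) with hσ
  have hσp : σ * (p - 1) = sp * p := div_mul_cancel₀ _ hp1.ne'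
  have hσ1 : σ ≤ 1 := by rw [hσ, div_le_one hp1]; exact hsp'
  obtain ⟨β, rfl⟩ : ∃ β, q = p - 1 + β := ⟨q - (p - 1), by ring⟩
  have hβ : 1 ≤ β := by linarith
  have hsp1 : sp < 1 := by nlinarith
  have hgain : ∀ a < σ, a * (p - 1 + β) < sp * p + a * β := fun a ha => by
    rw [← hσp]; nlinarith
  have himp : ∀ a b, γ₀ ≤ a → a < σ → Regular N p s₁ sp a (p - 1 + β) → 0 ≤ b →
      b * (p - 1 + β) < sp * p + a * β → Regular N p s₁ sp b (p - 1 + β) :=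
    -- The integrability condition persists as the exponent grows, and a < σ ≤ 1 keeps the gained
    -- exponent below 1.
    fun a b ha haσ hr hb hlt => hr.improve hN hp hs₁ hs₁' hsp hsp1 hβ (hγ₀.trans ha)
      (by nlinarith) hb hlt (by nlinarith)
  set S : Set ℝ := {a | γ₀ ≤ a ∧ a < σ ∧ Regular N p s₁ sp a (p - 1 + β)}
  have hne : S.Nonempty := ⟨γ₀, le_rfl, hγ₀', hreg⟩
  have hbdd : BddAbove S := ⟨σ, fun a ha => ha.2.1.le⟩
  have hq0 : 0 < p - 1 + β := by linarith
  have hsup : σ ≤ sSup S := by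
    by_contra! hlt
    set t := sSup S
    -- An exponent above this threshold improves beyond t, and t < σ places the threshold below t,
    -- so S meets that range.
    have h1 : (t * (p - 1 + β) - sp * p) / β < t := by
      rw [div_lt_iff₀ (by linarith)]
      linarith [hgain t hlt]
    obtain ⟨a, ha, hat⟩ := exists_lt_of_lt_csSup hne h1
    rw [div_lt_iff₀ (by linarith)] at hat
    set b := (sp * p + a * β) / (p - 1 + β)
    have hbeq : b * (p - 1 + β) = sp * p + a * β := div_mul_cancel₀ _ hq0.ne'
    have htb : t < b := by
      rw [lt_div_iff₀ hq0]; linarith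
    have hbσ : b < σ := by
      rw [div_lt_iff₀ hq0]
      have := ha.2.1
      nlinarith
    obtain ⟨c, htc, hcb⟩ := exists_between htb
    have hγt : γ₀ ≤ t := le_csSup hbdd ⟨le_rfl, hγ₀', hreg⟩
    have hc : c ∈ S := ⟨by linarith, by linarith, himp a c ha.1 ha.2.1 ha.2.2 (by linarith) (by
      rw [← hbeq]; exact mul_lt_mul_of_pos_right hcb hq0)⟩
    exact absurd (le_csSup hbdd hc) (not_le.2 htc)
  obtain ⟨a, ha, hγa⟩ := exists_lt_of_lt_csSup hne (hγσ.trans_le hsup)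
  refine himp a γ ha.1 ha.2.1 ha.2.2 hγ0 ?_
  exact (mul_lt_mul_of_pos_right hγa hq0).trans (hgain a ha.2.1)

/-- Raising q to q' multiplies the exponent by q/q'. With ratio at most l = p/(p-1), an exponent
near σ drops no lower than about sp, where 1 - sp p + sp (p-1) = 1 - sp > 0. Hence the iteration can
restart at q', and finitely many such steps reach any q. -/
theorem regular_of_lt (hN : 1 ≤ N) {p s₁ sp q γ : ℝ} (hp : 2 ≤ p) (hs₁ : 0 < s₁)
    (hs₁' : s₁ < 1) (hsp : 0 < sp) (hsp' : sp * p ≤ p - 1) (hq : p ≤ q) (hγ0 : 0 ≤ γ)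
    (hγσ : γ < sp * p / (p - 1)) : Regular N p s₁ sp γ q := by
  have hp1 : 0 < p - 1 := by linarith
  have hp0 : 0 < p := by linarith
  have hsp1 : sp < 1 := by nlinarith
  set σ := sp * p / (p - 1) with hσ
  have hσp : σ * (p - 1) = sp * p := div_mul_cancel₀ _ hp1.ne'
  set l : ℝ := p / (p - 1)
  have hl : 1 < l := by rw [lt_div_iff₀ hp1]; linarith
  have hl0 : 0 < l := by linarith
  have key : ∀ (n : ℕ) (q : ℝ), p ≤ q → q ≤ p * l ^ n → ∀ γ, 0 ≤ γ → γ < σ →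
      Regular N p s₁ sp γ q := by
    intro n
    induction n with
    | zero =>
      intro q hpq hqp γ hγ0 hγσ
      obtain rfl : q = p := by rw [pow_zero, mul_one] at hqp; exact le_antisymm hqp hpq
      refine regular_base.all_lt hN hp hs₁ hs₁' hsp hsp' le_rfl hsp.le ?_ ?_ hγ0 hγσ
      · rw [lt_div_iff₀ hp1]; nlinarith
      · nlinarith
    | succ n ih =>
      intro q' hpq' hq' γ hγ0 hγσ
      set q := max p (q' / l)
      have hpq : p ≤ q := le_max_left _ _
      have hq0 : 0 < q := hp0.trans_le hpq
      have hqn : q ≤ p * l ^ n := max_le (le_mul_of_one_le_right hp0.le (one_le_pow₀ hl.le)) (by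
        rw [div_le_iff₀ hl0, mul_assoc, ← pow_succ]; exact hq')
      have hqq' : q ≤ q' := max_le hpq' (div_le_self (by linarith) hl.le)
      have hq'l : q' ≤ q * l := by
        rw [← div_le_iff₀ hl0]; exact le_max_right _ _
      have hq'0 : 0 < q' := by linarith
      have hσ0 : 0 < σ := by positivity
      -- The left side is the least exponent that, after the loss of the factor (p-1)/p, still meets
      -- the integrability condition; that it lies below σ amounts to sp < 1.
      have h1 : (sp * p - 1) * p / (p - 1) ^ 2 < σ := by
        rw [div_lt_iff₀ (by positivity), pow_two, ← mul_assoc, hσp]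
        nlinarith
      obtain ⟨a, ha, haσ⟩ := exists_between (max_lt hσ0 h1)
      have ha0 : 0 < a := (le_max_left _ _).trans_lt ha
      have ha1 : (sp * p - 1) * p < a * (p - 1) ^ 2 := by
        rw [← div_lt_iff₀ (by positivity)]; exact (le_max_right _ _).trans_lt ha
      have hratio : (p - 1) / p ≤ q / q' := by
        rw [div_le_div_iff₀ hp0 hq'0]
        calc (p - 1) * q' ≤ (p - 1) * (q * l) := by gcongr
          _ = q * p := by simp only [l]; field_simp
      have hratio1 : q / q' ≤ 1 := (div_le_one hq'0).2 hqq'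
      refine ((ih q hpq hqn a ha0.le haσ).raise hq0 hqq').all_lt hN hp hs₁ hs₁' hsp hsp' hpq'
        (by positivity) ?_ ?_ hγ0 hγσ
      · exact (mul_le_of_le_one_right ha0.le hratio1).trans_lt haσ
      · have h2 : a * ((p - 1) / p) * (p - 1) ≤ a * (q / q') * (p - 1) := by gcongr
        have h3 : sp * p - 1 < a * ((p - 1) / p) * (p - 1) := by
          rw [show a * ((p - 1) / p) * (p - 1) = a * (p - 1) ^ 2 / p by ring, lt_div_iff₀ hp0]
          exact ha1
        linarith
  obtain ⟨n, hn⟩ := pow_unbounded_of_one_lt (q / p) hl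
  rw [div_lt_iff₀ hp0] at hn
  exact key n q hq (by linarith) γ hγ0 hγσ

/-! ### From weak solutions to local solutions -/

theorem dint_congr_ae {e q : ℝ} {u v : 𝔼 → ℝ} (h : u =ᵐ[volume] v) (A : Set 𝔼) :
    dint e q u A = dint e q v A := by
  have h' := ae_restrict_of_ae (s := A) h
  refine lintegral_congr_ae ?_
  filter_upwards [h'] with x hx
  refine lintegral_congr_ae ?_
  filter_upwards [h'] with y hy
  rw [hx, hy]

theorem gagliardo_rpow {s q : ℝ} (hq : 0 < q) (u : 𝔼 → ℝ) (A : Set 𝔼) :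
    gagliardo s q u A ^ q = dint (N + s * q) q u A := by
  unfold gagliardo dint
  rw [← ENNReal.rpow_mul, one_div_mul_cancel hq.ne', ENNReal.rpow_one]

theorem MemTailSpace.aestronglyMeasurable {q a : ℝ} {u : 𝔼 → ℝ} (h : MemTailSpace q a u) :
    AEStronglyMeasurable u volume := by
  have h1 : ∀ n : ℕ, AEStronglyMeasurable u (volume.restrict (closedBall (0 : 𝔼) n)) :=
    fun n => (h.1 _ (isCompact_closedBall _ _)).1
  have h2 := aestronglyMeasurable_iUnion_iff.2 h1
  rwa [iUnion_closedBall_nat, Measure.restrict_univ] at h2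

theorem tail_lt_top {p sp : ℝ} (hp : 2 ≤ p) (hsp : 0 < sp) {u : 𝔼 → ℝ}
    (h : MemTailSpace (p - 1) (sp * p) u) (x₀ : 𝔼) {R : ℝ} (hR : 0 < R) :
    tail p sp u x₀ R < ∞ := by
  unfold tail
  have hp1 : 0 < p - 1 := by linarith
  set e : ℝ := N + sp * p
  have he : 0 ≤ e := by positivity
  rw [ENNReal.rpow_lt_top_iff_of_pos (by positivity)]
  refine ENNReal.mul_lt_top ENNReal.ofReal_lt_top ?_
  set c : ℝ := (1 + ‖x₀‖) / R + 1
  calc _ ≤ ∫⁻ x in (ball x₀ R)ᶜ, ENNReal.ofReal (c ^ e) *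
        ENNReal.ofReal (|u x| ^ (p - 1) / (1 + ‖x‖) ^ e) := by
        refine setLIntegral_mono' measurableSet_ball.compl fun x hx => ?_
        rw [← ENNReal.ofReal_mul (by positivity), ← mul_div_assoc]
        apply ENNReal.ofReal_le_ofReal
        rw [mem_compl_iff, mem_ball, not_lt, dist_eq_norm] at hx
        have hd : 0 < ‖x - x₀‖ := by linarith
        rw [div_le_div_iff₀ (by positivity) (by positivity), mul_comm (c ^ e), mul_assoc,
          ← Real.mul_rpow (by positivity) hd.le]
        gcongr
        have h1 : ‖x‖ ≤ ‖x - x₀‖ + ‖x₀‖ := by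
          simpa using norm_add_le (x - x₀) x₀
        have h2 : 1 + ‖x₀‖ ≤ (1 + ‖x₀‖) / R * ‖x - x₀‖ := by
          rw [div_mul_eq_mul_div, le_div_iff₀ hR]
          gcongr
        simp only [c]
        linarith
    _ ≤ ENNReal.ofReal (c ^ e) * ∫⁻ x, ENNReal.ofReal (|u x| ^ (p - 1) / (1 + ‖x‖) ^ e) := by
        rw [lintegral_const_mul' _ _ ENNReal.ofReal_ne_top]
        gcongr
        exact Measure.restrict_le_self
    _ < ∞ := ENNReal.mul_lt_top ENNReal.ofReal_lt_top h.2

theorem measurable_signRepresentative {u : 𝔼 → ℝ} (hu : Measurable u) {Z : 𝔼 × 𝔼 → ℝ}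
    (hZ : Measurable Z) : Measurable fun z : 𝔼 × 𝔼 =>
      if u z.1 - u z.2 = 0 then max (-1) (min 1 (Z z)) else (u z.1 - u z.2) / |u z.1 - u z.2| := by
  refine Measurable.ite ?_ (by fun_prop) (by fun_prop)
  exact measurableSet_eq_fun (by fun_prop) measurable_const

-- Almost everywhere statements become pointwise ones after changing u and Z on null sets, which
-- affects neither the equation nor the seminorms. The size M collects the supremum, the tail and
-- the energy; the added 1 gives M ≥ 1.
open scoped Classical in
theorem exists_localSolution {p s₁ sp : ℝ} (hp : 2 ≤ p) (hsp : 0 < sp) {Ω : Set 𝔼} {u : 𝔼 → ℝ}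
    (hu : IsWeakSolution p s₁ sp Ω u) (hbd : LocallyBounded u Ω) {x₀ : 𝔼} {R : ℝ} (hR : 0 < R)
    (hΩ : closedBall x₀ R ⊆ Ω) :
    supTail p sp u x₀ R + gagliardo sp p u (ball x₀ R) + 1 ≠ ∞ ∧
    ∃ u' : 𝔼 → ℝ, u =ᵐ[volume] u' ∧ LocalSolution p s₁ sp u' x₀ R
      (supTail p sp u x₀ R + gagliardo sp p u (ball x₀ R) + 1).toReal := by
  have hp1 : 0 < p - 1 := by linarith
  have hp0 : 0 < p := by linarith
  have hcl : closure (ball x₀ R) ⊆ closedBall x₀ R := closure_ball_subset_closedBall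
  have hK : IsCompact (closure (ball x₀ R)) :=
    (isCompact_closedBall x₀ R).of_isClosed_subset isClosed_closure hcl
  have hbR := hbd (ball x₀ R) isOpen_ball hK (hcl.trans hΩ)
  have hW1 := hu.memW_one (ball x₀ R) isOpen_ball hK (hcl.trans hΩ)
  have hWp := hu.memW_p (ball x₀ R) isOpen_ball hK (hcl.trans hΩ)
  have htail := tail_lt_top hp hsp hu.memTail x₀ hR
  set 𝒯 := supTail p sp u x₀ R + gagliardo sp p u (ball x₀ R) + 1 with h𝒯
  have hfin : 𝒯 ≠ ∞ := by
    rw [h𝒯, supTail]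
    exact ENNReal.add_ne_top.2 ⟨ENNReal.add_ne_top.2
      ⟨ENNReal.add_ne_top.2 ⟨hbR.2.ne, htail.ne⟩, hWp.2.ne⟩, ENNReal.one_ne_top⟩
  refine ⟨hfin, ?_⟩
  set M := 𝒯.toReal
  have hM𝒯 : ENNReal.ofReal M = 𝒯 := ENNReal.ofReal_toReal hfin
  have hM1 : 1 ≤ M := by
    rw [← ENNReal.ofReal_le_ofReal_iff (by positivity), hM𝒯, ENNReal.ofReal_one]
    exact le_add_self
  have hum := hu.memTail.aestronglyMeasurable
  set u₁ := hum.mk u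
  have hu₁m : Measurable u₁ := hum.stronglyMeasurable_mk.measurable
  have hu₁ : u =ᵐ[volume] u₁ := hum.ae_eq_mk
  -- Clamping makes the bound hold at every point of the ball, and alters u₁ only on a null set.
  set u' : 𝔼 → ℝ := (ball x₀ R).piecewise (fun x => max (-M) (min M (u₁ x))) u₁
  have hu'm : Measurable u' := Measurable.piecewise measurableSet_ball (by fun_prop) hu₁m
  have huM : ∀ᵐ x ∂volume, x ∈ ball x₀ R → |u x| ≤ M := by
    rw [← ae_restrict_iff' measurableSet_ball]
    have h1 := enorm_ae_le_eLpNormEssSup u (volume.restrict (ball x₀ R))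
    filter_upwards [h1] with x hx
    rw [← eLpNorm_exponent_top] at hx
    have h2 : ‖u x‖ₑ ≤ ENNReal.ofReal M := by
      rw [hM𝒯]
      refine hx.trans ?_
      rw [h𝒯, supTail, add_assoc, add_assoc]
      exact le_self_add
    rw [Real.enorm_eq_ofReal_abs, ENNReal.ofReal_le_ofReal_iff (by linarith)] at h2
    exact h2
  have huu' : u =ᵐ[volume] u' := by
    filter_upwards [hu₁, huM] with x h1 h2
    by_cases hx : x ∈ ball x₀ R
    · have h3 := abs_le.1 (h2 hx)
      simp only [u', piecewise_eq_of_mem _ _ _ hx]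
      rw [← h1, min_eq_right h3.2, max_eq_right h3.1]
    · simp only [u', piecewise_eq_of_notMem _ _ _ hx]
      exact h1
  refine ⟨u', huu', hu'm, hM1, ?_, ?_, ?_, ?_, ?_⟩
  · intro x hx
    simp only [u', piecewise_eq_of_mem _ _ _ hx]
    rw [abs_le]
    exact ⟨le_max_left _ _, max_le (by linarith) (min_le_left _ _)⟩
  · have h1 : ∫⁻ x in (ball x₀ R)ᶜ, ENNReal.ofReal (|u' x| ^ (p - 1) / ‖x - x₀‖ ^ (N + sp * p)) =
        ∫⁻ x in (ball x₀ R)ᶜ, ENNReal.ofReal (|u x| ^ (p - 1) / ‖x - x₀‖ ^ (N + sp * p)) := by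
      refine lintegral_congr_ae (ae_restrict_of_ae ?_)
      filter_upwards [huu'] with x hx
      rw [hx]
    rw [h1]
    have h2 : tail p sp u x₀ R ≤ ENNReal.ofReal M := by
      rw [hM𝒯, h𝒯, supTail]
      exact (le_add_self.trans le_self_add).trans le_self_add
    unfold tail at h2
    rw [one_div, ENNReal.rpow_inv_le_iff hp1, ENNReal.ofReal_rpow_of_nonneg (by linarith) hp1.le,
      mul_comm, ← ENNReal.le_div_iff_mul_le (Or.inl (by
        rw [Ne, ENNReal.ofReal_eq_zero, not_le]; positivity)) (Or.inl ENNReal.ofReal_ne_top),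
      ← ENNReal.ofReal_div_of_pos (by positivity)] at h2
    rwa [Real.rpow_neg hR.le, ← div_eq_mul_inv]
  · rw [← dint_congr_ae huu', ← gagliardo_rpow hp0, ← ENNReal.ofReal_rpow_of_nonneg (by linarith)
      hp0.le, hM𝒯]
    exact ENNReal.rpow_le_rpow (le_add_self.trans le_self_add) hp0.le
  · rw [← dint_congr_ae huu', ← gagliardo_lt_top_iff one_pos]
    exact hW1.2
  · obtain ⟨Z, hZm, hZ, heq⟩ := hu.exists_sign
    set Z₁ := hZm.1.mk Z
    have hZ₁m : Measurable Z₁ := hZm.1.stronglyMeasurable_mk.measurable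
    have hZZ₁ : Z =ᵐ[volume.prod volume] Z₁ := hZm.1.ae_eq_mk
    -- Where u' differs the sign is forced; elsewhere Z₁ is clamped, so the inclusion holds for
    -- every pair.
    set Z' : 𝔼 × 𝔼 → ℝ := fun z => if u' z.1 - u' z.2 = 0 then max (-1) (min 1 (Z₁ z)) else
      (u' z.1 - u' z.2) / |u' z.1 - u' z.2|
    have hfst : ∀ᵐ z : 𝔼 × 𝔼 ∂(volume.prod volume), u z.1 = u' z.1 :=
      Measure.quasiMeasurePreserving_fst.ae huu'
    have hsnd : ∀ᵐ z : 𝔼 × 𝔼 ∂(volume.prod volume), u z.2 = u' z.2 :=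
      Measure.quasiMeasurePreserving_snd.ae huu'
    have hZZ' : Z =ᵐ[volume.prod volume] Z' := by
      filter_upwards [hZ, hZZ₁, hfst, hsnd] with z h1 h2 h3 h4
      rw [h3, h4] at h1
      by_cases h0 : u' z.1 - u' z.2 = 0
      · simp only [Z', h0, if_true]
        rw [← h2, min_eq_right h1.1.2, max_eq_right h1.1.1]
      · simp only [Z', h0, if_false]
        exact h1.2 h0
    refine ⟨Z', measurable_signRepresentative hu'm hZ₁m, fun z => ?_, ?_⟩
    · by_cases h0 : u' z.1 - u' z.2 = 0
      · simp only [Z', h0, if_true]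
        exact ⟨⟨le_max_left _ _, max_le (by norm_num) (min_le_left _ _)⟩, fun h => absurd rfl h⟩
      · simp only [Z', h0, if_false]
        refine ⟨?_, fun _ => rfl⟩
        rw [mem_Icc, ← abs_le, abs_div, abs_abs, div_self (abs_ne_zero.2 h0)]
    · intro φ h1 hpp hc hs
      rw [← heq φ h1 hpp hc (hs.trans (ball_subset_closedBall.trans hΩ))]
      congr 1
      · refine integral_congr_ae ?_
        filter_upwards [hZZ'] with z hz
        rw [hz]
      · refine integral_congr_ae ?_
        filter_upwards [hfst, hsnd] with z h1 h2
        rw [h1, h2, spow]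

/-- Cover the compact closure of V by small balls. With x in one of them, nearby y fall under the
ball estimate, and for the other y in V the kernel is bounded and so is u. -/
theorem memWLoc_of_ball {q γ : ℝ} (hq : 1 ≤ q) (hγ : 0 ≤ γ) {Ω : Set 𝔼} (hΩ : IsOpen Ω)
    {u : 𝔼 → ℝ} (hbd : LocallyBounded u Ω)
    (h : ∀ (x₀ : 𝔼) (R r : ℝ), 0 < R → R < 1 → closedBall x₀ R ⊆ Ω → 0 < r → r < R →
      dint (N + γ * q) q u (ball x₀ r) < ∞) : MemWLoc γ q u Ω := by
  intro V hV hVc hVΩ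
  have hq0 : 0 < q := by linarith
  have hVb := hbd V hV hVc hVΩ
  have hVfin : volume V < ∞ := (measure_mono subset_closure).trans_lt hVc.measure_lt_top
  have : IsFiniteMeasure (volume.restrict V) := ⟨by rwa [Measure.restrict_apply_univ]⟩
  refine ⟨hVb.mono_exponent le_top, ?_⟩
  rw [gagliardo_lt_top_iff hq0]
  set e : ℝ := N + γ * q
  set M := (eLpNormEssSup u (volume.restrict V)).toReal
  have hM : ∀ᵐ x ∂(volume.restrict V), |u x| ≤ M := by
    have hlt := hVb.2
    rw [eLpNorm_exponent_top] at hlt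
    filter_upwards [enorm_ae_le_eLpNormEssSup u (volume.restrict V)] with x hx
    rw [Real.enorm_eq_ofReal_abs] at hx
    exact (ENNReal.ofReal_le_iff_le_toReal hlt.ne).1 hx
  obtain ⟨δ, hδ, hδΩ⟩ := hVc.exists_cthickening_subset_open hΩ hVΩ
  set R := min δ (1 / 2)
  have hR0 : 0 < R := lt_min hδ (by norm_num)
  have hR1 : R < 1 := (min_le_right _ _).trans_lt (by norm_num)
  have hloc : ∫⁻ x in closure V ∩ V, ∫⁻ y in V,
      ENNReal.ofReal (|u x - u y| ^ q / ‖x - y‖ ^ e) < ∞ := by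
    -- Only the x variable is localized, since finiteness is then subadditive in S while y ranges
    -- over all of V.
    refine hVc.induction_on (p := fun S => ∫⁻ x in S ∩ V, ∫⁻ y in V,
      ENNReal.ofReal (|u x - u y| ^ q / ‖x - y‖ ^ e) < ∞) (by simp) ?_ ?_ ?_
    · intro S T hST hT
      exact (lintegral_mono_set (inter_subset_inter_left _ hST)).trans_lt hT
    · intro S T hS hT
      rw [union_inter_distrib_right]
      exact (lintegral_union_le _ _ _).trans_lt (ENNReal.add_lt_top.2 ⟨hS, hT⟩)
    · intro x₀ hx₀
      refine ⟨ball x₀ (R / 4), mem_nhdsWithin_of_mem_nhds (ball_mem_nhds _ (by linarith)), ?_⟩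
      have hball : closedBall x₀ R ⊆ Ω :=
        ((closedBall_subset_closedBall (min_le_left _ _)).trans
          (closedBall_subset_cthickening hx₀ δ)).trans hδΩ
      have hdint := h x₀ R (R / 2) hR0 hR1 hball (by linarith) (by linarith)
      set D : ℝ := (2 * M) ^ q / (R / 4) ^ e
      calc _ ≤ ∫⁻ x in ball x₀ (R / 4) ∩ V, ((∫⁻ y in ball x₀ (R / 2),
            ENNReal.ofReal (|u x - u y| ^ q / ‖x - y‖ ^ e)) + ENNReal.ofReal D * volume V) := by
            refine lintegral_mono_ae ?_
            filter_upwards [ae_restrict_mem (measurableSet_ball.inter hV.measurableSet),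
              ae_restrict_of_ae_restrict_of_subset inter_subset_right hM] with x hx hxM
            rw [← lintegral_inter_add_sdiff _ V (measurableSet_ball (x := x₀) (ε := R / 2))]
            refine add_le_add (lintegral_mono_set inter_subset_right) ?_
            calc _ ≤ ∫⁻ y in V \ ball x₀ (R / 2), ENNReal.ofReal D := by
                  refine lintegral_mono_ae ?_
                  filter_upwards [ae_restrict_mem (hV.measurableSet.diff measurableSet_ball),
                    ae_restrict_of_ae_restrict_of_subset sdiff_subset hM] with y hy hyM
                  apply ENNReal.ofReal_le_ofReal
                  have hd : R / 4 ≤ ‖x - y‖ := by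
                    refine norm_ge_of_mem_ball hx.1 ?_
                    rw [show R / 4 + R / 4 = R / 2 by ring]
                    exact hy.2
                  have hu2 : |u x - u y| ≤ 2 * M := by linarith [abs_sub (u x) (u y)]
                  simp only [D]
                  gcongr
              _ ≤ _ := by
                  rw [setLIntegral_const]
                  gcongr
                  exact sdiff_subset
        _ = (∫⁻ x in ball x₀ (R / 4) ∩ V, ∫⁻ y in ball x₀ (R / 2),
            ENNReal.ofReal (|u x - u y| ^ q / ‖x - y‖ ^ e)) +
            ENNReal.ofReal D * volume V * volume (ball x₀ (R / 4) ∩ V) := by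
            rw [lintegral_add_right _ measurable_const, setLIntegral_const]
        _ < ∞ := by
            refine ENNReal.add_lt_top.2 ⟨?_, ENNReal.mul_lt_top
              (ENNReal.mul_lt_top ENNReal.ofReal_lt_top hVfin)
              ((measure_mono inter_subset_right).trans_lt hVfin)⟩
            exact (lintegral_mono_set (inter_subset_left.trans
              (ball_subset_ball (by linarith)))).trans_lt hdint
  rwa [inter_eq_self_of_subset_right subset_closure] at hloc

end NonlocalOneP

/-! ### The regularity theorem -/

theorem theorem1p2 (N : ℕ) (hN : 2 ≤ N) (p s₁ sp q γ : ℝ) (hp : 2 ≤ p)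
    (hs₁ : s₁ ∈ Set.Ioo (0 : ℝ) 1) (hsp : sp ∈ Set.Ioc 0 ((p - 1) / p))
    (hq : p ≤ q) (hγ : γ ∈ Set.Ioo 0 (sp * p / (p - 1))) :
    ∃ C κ : ℝ, 0 < C ∧ 0 < κ ∧
      ∀ (Ω : Set (EuclideanSpace ℝ (Fin N))) (u : EuclideanSpace ℝ (Fin N) → ℝ),
        IsOpen Ω → IsConnected Ω → Bornology.IsBounded Ω →
        NonlocalOneP.IsWeakSolution p s₁ sp Ω u → NonlocalOneP.LocallyBounded u Ω →
        NonlocalOneP.MemWLoc γ q u Ω ∧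
        ∀ (x₀ : EuclideanSpace ℝ (Fin N)) (R r : ℝ), 0 < R → R < 1 →
          Metric.closedBall x₀ R ⊆ Ω → 0 < r → r < R →
          NonlocalOneP.gagliardo γ q u (Metric.ball x₀ r) ^ q ≤
            ENNReal.ofReal C *
              (NonlocalOneP.supTail p sp u x₀ R +
                NonlocalOneP.gagliardo sp p u (Metric.ball x₀ R) + 1) ^ q /
              ENNReal.ofReal ((R - r) ^ κ) := by
  have hp0 : 0 < p := by linarith
  have hq0 : 0 < q := by linarith
  obtain ⟨C, κ, hC, hκ, hreg⟩ := NonlocalOneP.regular_of_lt (N := N) (by omega) hp hs₁.1 hs₁.2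
    hsp.1 ((le_div_iff₀ hp0).1 hsp.2) hq hγ.1.le hγ.2
  refine ⟨C, κ, hC, hκ, fun Ω u hΩ _ _ hu hbd => ?_⟩
  have hmain : ∀ (x₀ : EuclideanSpace ℝ (Fin N)) (R r : ℝ), 0 < R → R < 1 →
      Metric.closedBall x₀ R ⊆ Ω → 0 < r → r < R →
      NonlocalOneP.supTail p sp u x₀ R +
        NonlocalOneP.gagliardo sp p u (Metric.ball x₀ R) + 1 ≠ ∞ ∧
      NonlocalOneP.dint (N + γ * q) q u (Metric.ball x₀ r) ≤ ENNReal.ofReal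
        (C * (NonlocalOneP.supTail p sp u x₀ R +
          NonlocalOneP.gagliardo sp p u (Metric.ball x₀ R) + 1).toReal ^ q * (R - r) ^ (-κ)) := by
    intro x₀ R r hR hR1 hball hr hrR
    obtain ⟨hfin, u', huu', hloc⟩ := NonlocalOneP.exists_localSolution hp hsp.1 hu hbd hR hball
    refine ⟨hfin, ?_⟩
    rw [NonlocalOneP.dint_congr_ae huu']
    exact hreg u' x₀ R _ hloc hR1.le r hr.le hrR
  refine ⟨NonlocalOneP.memWLoc_of_ball (by linarith) hγ.1.le hΩ hbd
    fun x₀ R r hR hR1 hball hr hrR =>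
      (hmain x₀ R r hR hR1 hball hr hrR).2.trans_lt ENNReal.ofReal_lt_top,
    fun x₀ R r hR hR1 hball hr hrR => ?_⟩
  obtain ⟨hfin, hle⟩ := hmain x₀ R r hR hR1 hball hr hrR
  rw [NonlocalOneP.gagliardo_rpow hq0]
  refine hle.trans (le_of_eq ?_)
  have hRr : 0 < R - r := by linarith
  rw [Real.rpow_neg hRr.le, ← div_eq_mul_inv, ENNReal.ofReal_div_of_pos (by positivity),
    ENNReal.ofReal_mul hC.le, ← ENNReal.ofReal_rpow_of_nonneg ENNReal.toReal_nonneg hq0.le,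
    ENNReal.ofReal_toReal hfin]
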